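/- **Setting.** Let $\Bbbk=\mathbb R$ or $\mathbb C$. An NQ-manifold is a non-negatively graded manifold (a Hausdorff, second countable smooth body with a sheaf of graded-commutative $\Bbbk$-algebras, locally freely generated over the smooth $\Bbbk$-valued functions of the body by finitely many coordinates of positive degrees) with a derivation $Q$ of degree $1$, $Q^2=0$. Let $\mathcal M$ be an NQ-manifold and let $(\mathcal E,\hat Q)$ be a representation of it: a graded vector bundle of finite rank over $\mathcal M$ with an operator $\hat Q$ of degree $1$ on sections, $\hat Q^2=0$ and $\hat Q(fs)=(Qf)s+(-1)^{\deg f}f\,\hat Qs$. In a trivialization $\zeta_\alpha$ over a patch (an open subset of the body over which $\mathcal E$ is trivialized; $\zeta_\alpha$ has degree, or level, $\alpha$) write $\hat Q\zeta_\alpha=(-1)^{\beta}\zeta_\beta T^\beta{}_\alpha$; transition functions $\Omega$ are given by $\tilde\zeta_{\alpha}=\zeta_\beta\Omega^\beta{}_{\tilde\alpha}$. Let $\mathcal L$ be an arbitrary NQ-manifold (the test manifold). A super-curve is a morphism of differential graded spaces $C:T[1][0,1]\times\mathcal L\to\mathcal M$, where $T[1][0,1]$ has coordinates $t,\theta$ and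 differential $\theta\partial_t$. For $0\le a\le b\le 1$ such that $C$ over $[a,b]$ lies in one patch, put $$U_C(b,a)=\mathbb P\exp\Big(-\int_a^b dt\,d\theta\ T(x(t,\theta,y))\Big)=\sum_{q\ge0}(-1)^q\int_{b\ge t_1\ge\dots\ge t_q\ge a}A(t_1)\cdots A(t_q)\,dt_1\cdots dt_q,\qquad A=\partial_\theta T|_{\theta=0},$$ a matrix of functions on $\mathcal L$. The Wilson line of $C$ is $U_C=U_C(1,0)$ if $C$ lies in one patch. In general choose $0=t_0\le\dots\le t_{k+1}=1$ and patches $\varphi_0,\dots,\varphi_k$ with trivializations such that $C|_{[t_i,t_{i+1}]}$ lies in $\varphi_i$; the spliced Wilson line is $$U_C=U^{(k)}(1,t_k)\,\Omega_{k,k-1}(t_k)\,U^{(k-1)}(t_k,t_{k-1})\cdots\Omega_{1,0}(t_1)\,U^{(0)}(t_1,0),\qquad \Omega_{i,i-1}(t_i)=\Omega_{i,i-1}(x(t_i,\theta,y))|_{\theta=0},$$ where $U^{(i)}$ is computed in $\varphi_i$ and $\Omega_{i,i-1}$ is the transition function from $\varphi_{i-1}$ to $\varphi_i$. A smooth non-decreasing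 parametrization $\rho$ of an interval by another one (mapping initial point to initial point and end point to end point) acts on super-curves by $(t,\theta)\mapsto(\rho(t),\rho'(t)\theta)$. **Theorem.** All the integrals and the series above converge, and the following hold. 1. *(Invariance in a patch.)* If $\rho:[0,1]\to[0,1]$ is smooth, non-decreasing, $\rho(0)=0$, $\rho(1)=1$ (for instance an orientation-preserving diffeomorphism), then the reparametrized super-curve $C\circ\rho$ exists, and $U_{C\circ\rho}=U_C$ for $C$ in one patch. 2. *(Realization as a homotopy.)* A homotopy of super-curves is a morphism $T[1][0,1]_{s,\vartheta}\times T[1][0,1]_{t,\theta}\times\mathcal L\to\mathcal M$; write it as $x+\vartheta\bar x$, that is, functions $f$ on $\mathcal M$ pull back to $f(x)+\vartheta\,\iota_{\bar x}f$. (a) Every diffeomorphism $\psi$ of $[0,1]$ with $\psi'>0$ fixing the ends is $\Psi_1$ for a smooth family $\Psi_s$, $s\in[0,1]$, of smooth non-decreasing maps of $[0,1]$ fixing the ends, with $\Psi_0=\mathrm{id}$, generated by a smooth vector field $\varepsilon(t)\partial_t$ with $\varepsilon(0)=\varepsilon(1)=0$ (which may depend on $s$): $\partial_s\Psi=\varepsilon\,\partial_t\Psi$.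 (b) For every super-curve $C$ and every such $\varepsilon,\Psi$ there is a homotopy with $\bar x=\varepsilon(t)\,\partial_\theta x$ whose super-curve at the parameter $s$ is $C\circ\Psi_s$, for all $s\in[0,1]$. (c) For every homotopy with $\bar x=\varepsilon(t)\,\partial_\theta x$, where $\varepsilon$ is smooth and vanishes at $t=0,1$, and every $s$, the restriction to $s$ and $\vartheta=0$ is a super-curve; if the homotopy stays in one patch, the Wilson line of this super-curve does not depend on $s$. 3. *(Cutting and reconnecting.)* In one patch, $U_C(c,a)=U_C(c,b)\,U_C(b,a)$ for $0\le a\le b\le c\le1$. If $\rho:[0,1]\to[a,b]\subseteq[0,1]$ is a smooth non-decreasing parametrization, the super-curve $C\circ\rho$ exists and, if $C|_{[a,b]}$ lies in the patch, its Wilson line is $U_C(b,a)$. The transition function from a patch with trivialization to itself is the identity matrix along $C$. 4. *(Invariance across patches.)* Spliced Wilson lines are invariant under reparametrization: with $\rho$ as in 1 and $C$ subdivided by $(t_i)$ with patches $(\varphi_i)$, there is a subdivision $(t'_i)$ of $C\circ\rho$ fitting the same patches with $\rho(t_i')=t_i$, and for every such subdivision the spliced Wilson line of $C\circ\rho$ equals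 that of $C$. 5. *(Composition.)* Let $C_1,C_2$ be super-curves with $C_1(1)=C_2(0)$ (as maps $\mathcal L\to\mathcal M$, at $\theta=0$). Then there is a super-curve $C=C_2\circ C_1$, a concatenation, which is $C_1\circ\rho_1$ on $[0,c]$ and $C_2\circ\rho_2$ on $[c,1]$ for some $0<c<1$ and some smooth non-decreasing parametrizations $\rho_1:[0,c]\to[0,1]$, $\rho_2:[c,1]\to[0,1]$. For every such concatenation of any two super-curves, $$U_{C_2}U_{C_1}=U_{C_2\circ C_1}$$ if $C$ lies in one patch. Across patches: given subdivisions and patches $\varphi_0,\dots,\varphi_{k_1}$ for $C_1$ and $\varphi'_0,\dots,\varphi'_{k_2}$ for $C_2$, there is a subdivision of $C$ fitting $\varphi_0,\dots,\varphi_{k_1},\varphi'_0,\dots,\varphi'_{k_2}$ which is carried by $\rho_1,\rho_2$ to the given ones, with $c$ as the junction, and for every such subdivision $U_{C_2}\,\Omega\,U_{C_1}=U_{C_2\circ C_1}$ for the spliced Wilson lines, where $\Omega$ is the transition function from $\varphi_{k_1}$ to $\varphi_0'$ at the end point of $C_1$ (the identity when these two trivialized patches are the same). -/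

import Mathlib

open scoped Manifold ContDiff
open Set TopologicalSpace MeasureTheory

noncomputable section

namespace NQ

/-! ### Adjoining an odd variable -/

section Adjoin

variable {𝕜 F : Type*} [Field 𝕜] [Ring F] [Algebra 𝕜 F]

/-- The algebra `F[θ]` obtained from a superalgebra `F`, with parity operator `σ`, by adjoining an
odd variable `θ`: elements are written `a + θ b`, and `θ² = 0`, `a θ = θ σ(a)`. -/
@[ext] structure Adj (σ : F →ₐ[𝕜] F) where
  /-- the `θ`-independent part `a` of `a + θ b` -/
  re : F
  /-- the coefficient `b = ∂_θ (a + θ b)` -/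
  im : F

namespace Adj

variable {σ : F →ₐ[𝕜] F}

instance : Zero (Adj σ) := ⟨⟨0, 0⟩⟩
instance : One (Adj σ) := ⟨⟨1, 0⟩⟩
instance : Add (Adj σ) := ⟨fun x y => ⟨x.re + y.re, x.im + y.im⟩⟩
instance : Neg (Adj σ) := ⟨fun x => ⟨-x.re, -x.im⟩⟩
instance : Mul (Adj σ) := ⟨fun x y => ⟨x.re * y.re, x.im * y.re + σ x.re * y.im⟩⟩
instance : SMul 𝕜 (Adj σ) := ⟨fun c x => ⟨c • x.re, c • x.im⟩⟩

@[simp] theorem zero_re : (0 : Adj σ).re = 0 := rfl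
@[simp] theorem zero_im : (0 : Adj σ).im = 0 := rfl
@[simp] theorem one_re : (1 : Adj σ).re = 1 := rfl
@[simp] theorem one_im : (1 : Adj σ).im = 0 := rfl
@[simp] theorem add_re (x y : Adj σ) : (x + y).re = x.re + y.re := rfl
@[simp] theorem add_im (x y : Adj σ) : (x + y).im = x.im + y.im := rfl
@[simp] theorem neg_re (x : Adj σ) : (-x).re = -x.re := rfl
@[simp] theorem neg_im (x : Adj σ) : (-x).im = -x.im := rfl
@[simp] theorem mul_re (x y : Adj σ) : (x * y).re = x.re * y.re := rfl
@[simp] theorem mul_im (x y : Adj σ) : (x * y).im = x.im * y.re + σ x.re * y.im := rfl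
@[simp] theorem smul_re (c : 𝕜) (x : Adj σ) : (c • x).re = c • x.re := rfl
@[simp] theorem smul_im (c : 𝕜) (x : Adj σ) : (c • x).im = c • x.im := rfl

instance : Ring (Adj σ) where
  add_assoc x y z := by ext <;> simp [add_assoc]
  zero_add x := by ext <;> simp
  add_zero x := by ext <;> simp
  add_comm x y := by ext <;> simp [add_comm]
  neg_add_cancel x := by ext <;> simp
  left_distrib x y z := by
    ext
    · simp [mul_add]
    · simp [mul_add]; abel
  right_distrib x y z := by
    ext
    · simp [add_mul]
    · simp [add_mul]; abel
  zero_mul x := by ext <;> simp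
  mul_zero x := by ext <;> simp
  mul_assoc x y z := by ext <;> simp [mul_add, add_mul, mul_assoc, add_assoc]
  one_mul x := by ext <;> simp
  mul_one x := by ext <;> simp
  nsmul := nsmulRec
  zsmul := zsmulRec

instance : Module 𝕜 (Adj σ) where
  one_smul x := by ext <;> simp
  mul_smul a b x := by ext <;> simp [mul_smul]
  smul_zero a := by ext <;> simp
  smul_add a x y := by ext <;> simp
  add_smul a b x := by ext <;> simp [add_smul]
  zero_smul x := by ext <;> simp

instance : Algebra 𝕜 (Adj σ) :=
  Algebra.ofModule (fun a x y => by ext <;> simp)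
    (fun a x y => by ext <;> simp)

/-- The parity operator of `F[θ]`: `a + θ b ↦ σ(a) - θ σ(b)`. -/
def par (σ : F →ₐ[𝕜] F) : Adj σ →ₐ[𝕜] Adj σ :=
  AlgHom.ofLinearMap
    { toFun := fun x => ⟨σ x.re, -σ x.im⟩
      map_add' := fun x y => by ext <;> simp [add_comm]
      map_smul' := fun c x => by ext <;> simp }
    (by ext <;> simp)
    (fun x y => by ext <;> simp [add_comm])

end Adj

end Adjoin

/-! ### Calculus in vector spaces, tested by linear functionals

The functions below take values in finite-dimensional subspaces of the space `F`. -/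

section Weak

variable (𝕜 : Type*) {F : Type*} [RCLike 𝕜] [AddCommGroup F] [Module 𝕜 F]

/-- The derivative at `t` of a function on `[0,1]`: the vector `v` with `ℓ(v) = (ℓ ∘ g)'(t)` for
all linear functionals `ℓ`. -/
def wderiv (g : ℝ → F) (t : ℝ) : F :=
  open Classical in
  if h : ∃ v : F, ∀ ℓ : Module.Dual 𝕜 F,
    HasDerivWithinAt (fun s => ℓ (g s)) (ℓ v) (Icc 0 1) t then h.choose else 0

/-- `v` is the integral of `g` from `a` to `b`. -/
def HasWInt (g : ℝ → F) (a b : ℝ) (v : F) : Prop :=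
  ∀ ℓ : Module.Dual 𝕜 F,
    IntervalIntegrable (fun s => ℓ (g s)) volume a b ∧ ℓ v = ∫ s in a..b, ℓ (g s)

/-- The integral of `g` from `a` to `b`. -/
def wint (g : ℝ → F) (a b : ℝ) : F :=
  open Classical in
  if h : ∃ v : F, HasWInt 𝕜 g a b v then h.choose else 0

/-- `v` is the sum of the series with terms `u`. -/
def HasWSum (u : ℕ → F) (v : F) : Prop :=
  ∀ ℓ : Module.Dual 𝕜 F, HasSum (fun q => ℓ (u q)) (ℓ v)

/-- The sum of the series with terms `u`. -/
def wsum (u : ℕ → F) : F :=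
  open Classical in
  if h : ∃ v : F, HasWSum 𝕜 u v then h.choose else 0

end Weak

/-- The sign `(-1)^d`. -/
def sgn (d : ℤ) : ℤ := (d.negOnePow : ℤ)

/-- Restriction of a section. -/
def res {X : Type*} [TopologicalSpace X] {F : X → Type*} {U V : Opens X} (h : V ≤ U)
    (f : (x : U) → F x) : (x : V) → F x := fun x => f ⟨x.1, h x.2⟩

/-! ### NQ-manifolds

In a non-negatively graded manifold the functions of degree zero are the functions on the body, and
those of degree `d` form a locally free module of finite rank over them. The structure sheaf is thus
the sheaf of smooth sections of a bundle of graded-commutative algebras over the body, locally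
freely generated by finitely many coordinates of positive degree, and this is how it is given. -/

/-- A space with graded functions and an operator `q` on them: `Fun U d` is the set of functions of
degree `d` over `U`, written as sections of a family of algebras `fib x`; `par` is the parity
operator of the fibres. Only the values of `q` on `Fun U d` matter. -/
structure QSpace (𝕜 : Type*) [RCLike 𝕜] (X : Type*) [TopologicalSpace X] where
  fib : X → Type
  [ring : ∀ x, Ring (fib x)]
  [alg : ∀ x, Algebra 𝕜 (fib x)]
  par : ∀ x, fib x →ₐ[𝕜] fib x
  Fun : (U : Opens X) → ℤ → Set ((x : U) → fib x)
  q : (U : Opens X) → ((x : U) → fib x) → (x : U) → fib x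

attribute [instance] QSpace.ring QSpace.alg

/-- The exponents of the monomials of degree `d` in variables of degrees `deg`, odd variables
occurring at most once. -/
def exponents {m : ℕ} (deg : Fin m → ℕ) (d : ℤ) : Finset (Fin m → ℕ) :=
  (Fintype.piFinset fun _ => Finset.range (d.toNat + 1)).filter
    fun n => (∀ j, Odd (deg j) → n j ≤ 1) ∧ ((∑ j, n j * deg j : ℕ) : ℤ) = d

/-- The ordered monomial `ξ₀^{n₀} ξ₁^{n₁} ⋯`. -/
def monomial {R : Type*} [Ring R] {m : ℕ} (ξ : Fin m → R) (n : Fin m → ℕ) : R :=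
  (List.ofFn fun j => ξ j ^ n j).prod

namespace QSpace

variable {𝕜 : Type*} [RCLike 𝕜] {X : Type*} [TopologicalSpace X]
  {E₀ H₀ : Type*} [NormedAddCommGroup E₀] [NormedSpace ℝ E₀] [TopologicalSpace H₀]

/-- `ξ` is a system of coordinates of positive degrees `deg` over `V`: the functions of degree `d`
over an open `U ⊆ V` are the polynomials of degree `d` in `ξ` whose coefficients are smooth functions
on `U`, and there are no relations besides graded commutativity. -/
structure IsCoords (A : QSpace 𝕜 X) (I : ModelWithCorners ℝ E₀ H₀) [ChartedSpace H₀ X]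
    (V : Opens X) {m : ℕ} (deg : Fin m → ℕ) (ξ : Fin m → (x : V) → A.fib x) : Prop where
  pos : ∀ j, 0 < deg j
  mem : ∀ j, ξ j ∈ A.Fun V (deg j)
  indep : ∀ x : V, LinearIndependent 𝕜
    fun n : {n : Fin m → ℕ // ∀ j, Odd (deg j) → n j ≤ 1} => monomial (fun j => ξ j x) n.1
  span : ∀ x : V, Submodule.span 𝕜 (Set.range
    fun n : {n : Fin m → ℕ // ∀ j, Odd (deg j) → n j ≤ 1} => monomial (fun j => ξ j x) n.1) = ⊤
  fun_iff : ∀ (U : Opens X) (hU : U ≤ V) (d : ℤ) (f : (x : U) → A.fib x), f ∈ A.Fun U d ↔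
    ∃ a : (Fin m → ℕ) → U → 𝕜, (∀ n, ContMDiff I 𝓘(ℝ, 𝕜) ∞ (a n)) ∧
      ∀ x : U, f x = ∑ n ∈ exponents deg d, a n x • monomial (fun j => ξ j ⟨x.1, hU x.2⟩) n

/-- `A` is an NQ-manifold: its functions form a sheaf of graded-commutative algebras, locally freely
generated by coordinates of positive degrees over the smooth functions of the body, and `q` is a
derivation of degree one with square zero. -/
structure IsNQManifold (A : QSpace 𝕜 X) (I : ModelWithCorners ℝ E₀ H₀) [ChartedSpace H₀ X] :
    Prop where
  res_mem : ∀ (U V : Opens X) (h : V ≤ U) (d : ℤ) (f), f ∈ A.Fun U d → res h f ∈ A.Fun V d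
  glue : ∀ (U : Opens X) (d : ℤ) (f : (x : U) → A.fib x),
    (∀ x : U, ∃ (V : Opens X) (h : V ≤ U), x.1 ∈ V ∧ res h f ∈ A.Fun V d) → f ∈ A.Fun U d
  zero_mem : ∀ (U : Opens X) (d : ℤ), 0 ∈ A.Fun U d
  add_mem : ∀ (U : Opens X) (d : ℤ) (f g), f ∈ A.Fun U d → g ∈ A.Fun U d → f + g ∈ A.Fun U d
  smul_mem : ∀ (U : Opens X) (d : ℤ) (c : 𝕜) (f), f ∈ A.Fun U d → c • f ∈ A.Fun U d
  one_mem : ∀ U : Opens X, 1 ∈ A.Fun U 0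
  mul_mem : ∀ (U : Opens X) (d e : ℤ) (f g), f ∈ A.Fun U d → g ∈ A.Fun U e →
    f * g ∈ A.Fun U (d + e)
  mul_comm : ∀ (U : Opens X) (d e : ℤ) (f g), f ∈ A.Fun U d → g ∈ A.Fun U e →
    f * g = sgn (d * e) • (g * f)
  par_eq : ∀ (U : Opens X) (d : ℤ) (f), f ∈ A.Fun U d → ∀ x : U, A.par x (f x) = sgn d • f x
  coords : ∀ x : X, ∃ (V : Opens X) (m : ℕ) (deg : Fin m → ℕ) (ξ : Fin m → (x : V) → A.fib x),
    x ∈ V ∧ A.IsCoords I V deg ξ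
  q_mem : ∀ (U : Opens X) (d : ℤ) (f), f ∈ A.Fun U d → A.q U f ∈ A.Fun U (d + 1)
  q_res : ∀ (U V : Opens X) (h : V ≤ U) (d : ℤ) (f), f ∈ A.Fun U d →
    A.q V (res h f) = res h (A.q U f)
  q_add : ∀ (U : Opens X) (d : ℤ) (f g), f ∈ A.Fun U d → g ∈ A.Fun U d →
    A.q U (f + g) = A.q U f + A.q U g
  q_smul : ∀ (U : Opens X) (d : ℤ) (c : 𝕜) (f), f ∈ A.Fun U d → A.q U (c • f) = c • A.q U f
  q_mul : ∀ (U : Opens X) (d e : ℤ) (f g), f ∈ A.Fun U d → g ∈ A.Fun U e →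
    A.q U (f * g) = A.q U f * g + sgn d • (f * A.q U g)
  q_sq : ∀ (U : Opens X) (d : ℤ) (f), f ∈ A.Fun U d → A.q U (A.q U f) = 0

/-! ### The product with `T[1][0,1]` -/

/-- The slice `{x | (t, x) ∈ W}`. -/
def slice (W : Opens (Icc (0 : ℝ) 1 × X)) (t : Icc (0 : ℝ) 1) : Opens X :=
  ⟨{x | (t, x) ∈ W}, W.isOpen.preimage (by fun_prop)⟩

/-- The functions of degree `d` on `[0,1] × A`: families of elements `f(t,x)` of `A.fib x` which are
locally finite sums `∑ aᵢ(t,x) gᵢ(x)` with smooth functions `aᵢ` and functions `gᵢ` of degree `d`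
on `A`. -/
def IsFamily (A : QSpace 𝕜 X) (I : ModelWithCorners ℝ E₀ H₀) [ChartedSpace H₀ X]
    (W : Opens (Icc (0 : ℝ) 1 × X)) (d : ℤ) (f : (p : W) → A.fib p.1.2) : Prop :=
  ∀ p : W, ∃ (W' : Opens (Icc (0 : ℝ) 1 × X)) (V : Opens X) (hW : W' ≤ W)
    (hV : ∀ z ∈ W', z.2 ∈ V), p.1 ∈ W' ∧
    ∃ (r : ℕ) (a : Fin r → W' → 𝕜) (g : Fin r → (x : V) → A.fib x),
      (∀ i, ContMDiff ((𝓡∂ 1).prod I) 𝓘(ℝ, 𝕜) ∞ (a i)) ∧ (∀ i, g i ∈ A.Fun V d) ∧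
      ∀ z : W', f ⟨z.1, hW z.2⟩ = ∑ i, a i z • g i ⟨z.1.2, hV z.1 z.2⟩

/-- The product `T[1][0,1] × A`: the functions are `f = f₀ + θ f₁` with `f₀, f₁` functions on
`[0,1] × A`, and the differential is `θ ∂_t + q`, so that
`f₀ + θ f₁ ↦ q f₀ + θ (∂_t f₀ - q f₁)`. -/
def T1 (A : QSpace 𝕜 X) (I : ModelWithCorners ℝ E₀ H₀) [ChartedSpace H₀ X] :
    QSpace 𝕜 (Icc (0 : ℝ) 1 × X) where
  fib p := Adj (A.par p.2)
  par p := Adj.par (A.par p.2)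
  Fun W d := {f | A.IsFamily I W d (fun p => (f p).re) ∧ A.IsFamily I W (d - 1) (fun p => (f p).im)}
  q W f p :=
    ⟨A.q (slice W p.1.1) (fun x => (f ⟨(p.1.1, x.1), x.2⟩).re) ⟨p.1.2, p.2⟩,
      wderiv 𝕜 (fun s => open Classical in
        if h : (projIcc 0 1 zero_le_one s, p.1.2) ∈ W then (f ⟨_, h⟩).re else 0) p.1.1 -
      A.q (slice W p.1.1) (fun x => (f ⟨(p.1.1, x.1), x.2⟩).im) ⟨p.1.2, p.2⟩⟩

/-- A morphism from `A` (with body `X`) to `B` (with body `Y`): a smooth map of the bodies and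
compatible homomorphisms of the graded algebras of functions, commuting with the differentials. Only
the values of `pull U` on `B.Fun U d` matter. -/
structure Hom {Y : Type*} [TopologicalSpace Y] {E₁ H₁ : Type*} [NormedAddCommGroup E₁]
    [NormedSpace ℝ E₁] [TopologicalSpace H₁] (A : QSpace 𝕜 X) (I : ModelWithCorners ℝ E₀ H₀)
    [ChartedSpace H₀ X] (B : QSpace 𝕜 Y) (J : ModelWithCorners ℝ E₁ H₁) [ChartedSpace H₁ Y] where
  map : X → Y
  smooth : ContMDiff I J ∞ map
  pull : (U : Opens Y) → ((y : U) → B.fib y) →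
    (x : Opens.comap ⟨map, smooth.continuous⟩ U) → A.fib x
  pull_mem : ∀ (U : Opens Y) (d : ℤ) (f), f ∈ B.Fun U d → pull U f ∈ A.Fun _ d
  pull_res : ∀ (U V : Opens Y) (h : V ≤ U) (d : ℤ) (f : (y : U) → B.fib y), f ∈ B.Fun U d →
    ∀ x, pull V (res h f) x = pull U f ⟨x.1, h x.2⟩
  pull_add : ∀ (U : Opens Y) (d : ℤ) (f g), f ∈ B.Fun U d → g ∈ B.Fun U d →
    pull U (f + g) = pull U f + pull U g
  pull_smul : ∀ (U : Opens Y) (d : ℤ) (c : 𝕜) (f), f ∈ B.Fun U d → pull U (c • f) = c • pull U f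
  pull_one : ∀ U : Opens Y, pull U 1 = 1
  pull_mul : ∀ (U : Opens Y) (d e : ℤ) (f g), f ∈ B.Fun U d → g ∈ B.Fun U e →
    pull U (f * g) = pull U f * pull U g
  pull_q : ∀ (U : Opens Y) (d : ℤ) (f), f ∈ B.Fun U d → pull U (B.q U f) = A.q _ (pull U f)

end QSpace

universe u

/-- An NQ-manifold, with its body. -/
structure NQManifold (𝕜 : Type*) [RCLike 𝕜] where
  dim : ℕ
  body : Type u
  [top : TopologicalSpace body]
  [t2 : T2Space body]
  [countable : SecondCountableTopology body]
  [charted : ChartedSpace (EuclideanSpace ℝ (Fin dim)) body]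
  [manifold : IsManifold (𝓡 dim) ∞ body]
  space : QSpace 𝕜 body
  isNQ : space.IsNQManifold (𝓡 dim)

attribute [instance] NQManifold.top NQManifold.t2 NQManifold.countable NQManifold.charted
  NQManifold.manifold

/-! ### Representations -/

section Bundles

variable {𝕜 : Type*} [RCLike 𝕜] {X : Type*} [TopologicalSpace X]

/-- A family of modules over the fibres of `M`, with sets `Sec U k` of sections of degree `k` and an
operator `qhat` on sections. Only the values of `qhat` on `Sec U k` matter. -/
structure QBundle (M : QSpace 𝕜 X) where
  fib : X → Type
  [acg : ∀ x, AddCommGroup (fib x)]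
  [mod : ∀ x, Module (M.fib x) (fib x)]
  Sec : (U : Opens X) → ℤ → Set ((x : U) → fib x)
  qhat : (U : Opens X) → ((x : U) → fib x) → (x : U) → fib x

attribute [instance] QBundle.acg QBundle.mod

namespace QBundle

variable {M : QSpace 𝕜 X} {ι : Type*} [Fintype ι]

/-- `ζ` is a trivialization over `U`: sections `ζ_α` of degree `lev α` which freely generate the
sections over all open subsets of `U`. -/
structure IsFrame (E : QBundle M) (lev : ι → ℤ) (U : Opens X) (ζ : ι → (x : U) → E.fib x) :
    Prop where
  mem : ∀ i, ζ i ∈ E.Sec U (lev i)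
  indep : ∀ x : U, LinearIndependent (M.fib x) fun i => ζ i x
  span : ∀ x : U, Submodule.span (M.fib x) (Set.range fun i => ζ i x) = ⊤
  sec_iff : ∀ (V : Opens X) (h : V ≤ U) (k : ℤ) (s : (x : V) → E.fib x), s ∈ E.Sec V k ↔
    ∃ a : ι → (x : V) → M.fib x, (∀ i, a i ∈ M.Fun V (k - lev i)) ∧
      ∀ x : V, s x = ∑ i, a i x • ζ i ⟨x.1, h x.2⟩

/-- `E` is a representation of `M`: a graded vector bundle, whose typical fibre has a basis with
levels `lev`, with a lift `Q̂` of `Q` of degree one and square zero. -/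
structure IsRepresentation (E : QBundle M) (lev : ι → ℤ) : Prop where
  res_mem : ∀ (U V : Opens X) (h : V ≤ U) (k : ℤ) (s), s ∈ E.Sec U k → res h s ∈ E.Sec V k
  glue : ∀ (U : Opens X) (k : ℤ) (s : (x : U) → E.fib x),
    (∀ x : U, ∃ (V : Opens X) (h : V ≤ U), x.1 ∈ V ∧ res h s ∈ E.Sec V k) → s ∈ E.Sec U k
  frames : ∀ x : X, ∃ (V : Opens X) (ζ : ι → (x : V) → E.fib x), x ∈ V ∧ E.IsFrame lev V ζ
  qhat_mem : ∀ (U : Opens X) (k : ℤ) (s), s ∈ E.Sec U k → E.qhat U s ∈ E.Sec U (k + 1)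
  qhat_res : ∀ (U V : Opens X) (h : V ≤ U) (k : ℤ) (s), s ∈ E.Sec U k →
    E.qhat V (res h s) = res h (E.qhat U s)
  qhat_add : ∀ (U : Opens X) (k : ℤ) (s s'), s ∈ E.Sec U k → s' ∈ E.Sec U k →
    E.qhat U (s + s') = E.qhat U s + E.qhat U s'
  qhat_smul : ∀ (U : Opens X) (d k : ℤ) (f s), f ∈ M.Fun U d → s ∈ E.Sec U k →
    E.qhat U (fun x => f x • s x) =
      fun x => M.q U f x • s x + sgn d • (f x • E.qhat U s x)
  qhat_sq : ∀ (U : Opens X) (k : ℤ) (s), s ∈ E.Sec U k → E.qhat U (E.qhat U s) = 0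

end QBundle

end Bundles

/-- A representation of the NQ-manifold `M`: a `Q`-equivariant graded vector bundle over `M`; `lev`
are the levels of a basis of its typical fibre. -/
structure NQRepresentation {𝕜 : Type*} [RCLike 𝕜] (M : NQManifold 𝕜) where
  ι : Type
  [fin : Fintype ι]
  [dec : DecidableEq ι]
  lev : ι → ℤ
  bundle : QBundle M.space
  isRep : bundle.IsRepresentation lev

attribute [instance] NQRepresentation.fin NQRepresentation.dec

/-- A patch with a trivialization of the bundle over it. -/
structure Patch {𝕜 : Type*} [RCLike 𝕜] {M : NQManifold 𝕜} (E : NQRepresentation M) where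
  dom : Opens M.body
  ζ : E.ι → (x : dom) → E.bundle.fib x
  isFrame : E.bundle.IsFrame E.lev dom ζ

namespace Patch

variable {𝕜 : Type*} [RCLike 𝕜] {M : NQManifold 𝕜} {E : NQRepresentation M}

/-- The basis of a fibre given by a trivialization. -/
def basis (φ : Patch E) (x : φ.dom) : Module.Basis E.ι (M.space.fib x) (E.bundle.fib x) :=
  Module.Basis.mk (φ.isFrame.indep x) (φ.isFrame.span x).ge

/-- The connection matrix, `Q̂ ζ_α = ∑ R^β_α ζ_β`. -/
def R (φ : Patch E) (β α : E.ι) : (x : φ.dom) → M.space.fib x :=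
  fun x => (φ.basis x).repr (E.bundle.qhat φ.dom (φ.ζ α) x) β

/-- The normalized connection matrix `T^β_α = (-1)^{αβ+β} R^β_α`, so that
`Q̂ ζ_α = ∑ (-1)^β ζ_β T^β_α`. Here and below an index in a sign stands for its level. -/
def T (φ : Patch E) (β α : E.ι) : (x : φ.dom) → M.space.fib x :=
  fun x => sgn (E.lev α * E.lev β + E.lev β) • φ.R β α x

/-- The transition function `Ω` from `φ'` to `φ`, `ζ'_α = ∑ ζ_β Ω^β_α`. The sign comes from moving
`Ω^β_α`, of degree `lev α - lev β`, past `ζ_β`. -/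
def Ω (φ φ' : Patch E) (β α : E.ι) : (x : (φ.dom ⊓ φ'.dom : Opens M.body)) → M.space.fib x :=
  fun x => sgn (E.lev β * (E.lev α - E.lev β)) •
    (φ.basis ⟨x.1, x.2.1⟩).repr (φ'.ζ α ⟨x.1, x.2.2⟩) β

end Patch

/-! ### Path-ordered exponentials -/

section PathOrdered

variable (𝕜 : Type*) [RCLike 𝕜] {F : Type*} [Ring F] [Algebra 𝕜 F]
  {ι : Type*} [Fintype ι] [DecidableEq ι]

/-- The iterated integrals
`(-1)^q ∫_a^t dt₁ A(t₁) ∫_a^{t₁} dt₂ A(t₂) ⋯ ∫_a^{t_{q-1}} dt_q A(t_q)`. -/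
def iterInt (A : ℝ → Matrix ι ι F) (a : ℝ) : ℕ → ℝ → Matrix ι ι F
  | 0 => fun _ => 1
  | q + 1 => fun t => Matrix.of fun α β =>
      wint 𝕜 (fun s => (-(A s * iterInt A a q s)) α β) a t

/-- The path-ordered exponential `P exp (- ∫_a^b A)`, the sum of the iterated integrals. -/
def pathExp (A : ℝ → Matrix ι ι F) (b a : ℝ) : Matrix ι ι F :=
  Matrix.of fun α β => wsum 𝕜 fun q => iterInt 𝕜 A a q b α β

/-- All the integrals and the series in `pathExp 𝕜 A b a` converge, so that it is
the sum of the iterated integrals. -/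
def PathExpConverges (A : ℝ → Matrix ι ι F) (b a : ℝ) : Prop :=
  (∀ (q : ℕ), ∀ t ∈ Icc a b, ∀ α β, HasWInt 𝕜 (fun s => (-(A s * iterInt 𝕜 A a q s)) α β) a t
    (iterInt 𝕜 A a (q + 1) t α β)) ∧
  ∀ α β, HasWSum 𝕜 (fun q => iterInt 𝕜 A a q b α β) (pathExp 𝕜 A b a α β)

end PathOrdered

/-! ### Super-curves, homotopies and Wilson lines -/

/-- The point of `[0,1]` given by a real number. -/
def pt (t : ℝ) : Icc (0 : ℝ) 1 := projIcc 0 1 zero_le_one t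

section Curves

variable {𝕜 : Type*} [RCLike 𝕜]

/-- Super-curves in `M` parametrized by the test manifold `L`: morphisms `T[1][0,1] × L → M`. -/
abbrev SuperCurve (M L : NQManifold 𝕜) :=
  QSpace.Hom (L.space.T1 (𝓡 L.dim)) ((𝓡∂ 1).prod (𝓡 L.dim)) M.space (𝓡 M.dim)

/-- Homotopies of super-curves: morphisms `T[1][0,1] × (T[1][0,1] × L) → M`, with coordinates
`s, ϑ` on the first factor and `t, θ` on the second one. -/
abbrev SuperHomotopy (M L : NQManifold 𝕜) :=
  QSpace.Hom ((L.space.T1 (𝓡 L.dim)).T1 ((𝓡∂ 1).prod (𝓡 L.dim)))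
    ((𝓡∂ 1).prod ((𝓡∂ 1).prod (𝓡 L.dim))) M.space (𝓡 M.dim)

variable {M L : NQManifold 𝕜}

/-- `C` is the super-curve at the parameter `s` (and `ϑ = 0`) of the homotopy `H`. -/
def SuperHomotopy.IsAt (H : SuperHomotopy M L) (s : Icc (0 : ℝ) 1) (C : SuperCurve M L) : Prop :=
  ∀ (t : Icc (0 : ℝ) 1) (y : L.body), H.map (s, t, y) = C.map (t, y) ∧
    ∀ (U : Opens M.body) (d : ℤ), ∀ f ∈ M.space.Fun U d, ∀ (h : H.map (s, t, y) ∈ U) (h' : C.map (t, y) ∈ U),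
      (H.pull U f ⟨(s, t, y), h⟩).re = C.pull U f ⟨(t, y), h'⟩

/-- The `ϑ`-component of the homotopy is `x̄ = ε ∂_θ x`, that is, every function `f` on `M` pulls
back to `f(x) + ϑ ε(t,s) ∂_θ f(x)`, where `x = x(t,θ,y,s)`. -/
def SuperHomotopy.IsReparamWith (H : SuperHomotopy M L) (ε : ℝ → ℝ → ℝ) : Prop :=
  ∀ (s t : Icc (0 : ℝ) 1) (y : L.body) (U : Opens M.body) (d : ℤ), ∀ f ∈ M.space.Fun U d,
    ∀ h : H.map (s, t, y) ∈ U,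
      (H.pull U f ⟨(s, t, y), h⟩).im =
        (⟨((ε t s : ℝ) : 𝕜) • (H.pull U f ⟨(s, t, y), h⟩).re.im, 0⟩ : Adj (L.space.par y))

/-- On `[a,b]`, `C'` is the reparametrization of `C` by `ρ`: it is the composition of `C` with
`(t, θ) ↦ (ρ(t), ρ'(t) θ)`. -/
def IsReparamOn (C' C : SuperCurve M L) (ρ : ℝ → ℝ) (a b : ℝ) : Prop :=
  ∀ t ∈ Icc a b, ∀ y : L.body, C'.map (pt t, y) = C.map (pt (ρ t), y) ∧
    ∀ (U : Opens M.body) (d : ℤ), ∀ f ∈ M.space.Fun U d,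
      ∀ (h' : C'.map (pt t, y) ∈ U) (h : C.map (pt (ρ t), y) ∈ U),
      C'.pull U f ⟨(pt t, y), h'⟩ =
        (⟨(C.pull U f ⟨(pt (ρ t), y), h⟩).re,
          ((derivWithin ρ (Icc a b) t : ℝ) : 𝕜) • (C.pull U f ⟨(pt (ρ t), y), h⟩).im⟩ :
          Adj (L.space.par y))

/-- The end point of `C₁` is the initial point of `C₂`, as maps from `L` to `M`. -/
def Meets (C₁ C₂ : SuperCurve M L) : Prop :=
  ∀ y : L.body, C₁.map (1, y) = C₂.map (0, y) ∧
    ∀ (U : Opens M.body) (d : ℤ), ∀ f ∈ M.space.Fun U d,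
      ∀ (h₁ : C₁.map (1, y) ∈ U) (h₂ : C₂.map (0, y) ∈ U),
      ((C₁.pull U f ⟨(1, y), h₁⟩).re : L.space.fib y) = (C₂.pull U f ⟨(0, y), h₂⟩).re

end Curves

/-- `ρ` is a smooth monotone parametrization of `[a',b']` by `[a,b]`. -/
structure IsParam (ρ : ℝ → ℝ) (a b a' b' : ℝ) : Prop where
  smooth : ContDiffOn ℝ ∞ ρ (Icc a b)
  mono : MonotoneOn ρ (Icc a b)
  left : ρ a = a'
  right : ρ b = b'

/-- A smooth vector field `ε(t) ∂_t` on `[0,1]`, vanishing at the ends, which may depend on the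
parameter `s`. -/
structure IsEndFixingField (ε : ℝ → ℝ → ℝ) : Prop where
  smooth : ContDiffOn ℝ ∞ (fun p : ℝ × ℝ => ε p.1 p.2) (Icc 0 1 ×ˢ Icc 0 1)
  zero : ∀ s ∈ Icc (0 : ℝ) 1, ε 0 s = 0
  one : ∀ s ∈ Icc (0 : ℝ) 1, ε 1 s = 0

/-- `Ψ(t,s)` is a smooth family of reparametrizations of `[0,1]`, starting at the identity, which is
generated by `ε`: `∂_s Ψ = ε ∂_t Ψ`. -/
structure Generates (ε Ψ : ℝ → ℝ → ℝ) : Prop where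
  field : IsEndFixingField ε
  smooth : ContDiffOn ℝ ∞ (fun p : ℝ × ℝ => Ψ p.1 p.2) (Icc 0 1 ×ˢ Icc 0 1)
  init : ∀ t ∈ Icc (0 : ℝ) 1, Ψ t 0 = t
  param : ∀ s ∈ Icc (0 : ℝ) 1, IsParam (fun t => Ψ t s) 0 1 0 1
  flow : ∀ t ∈ Icc (0 : ℝ) 1, ∀ s ∈ Icc (0 : ℝ) 1,
    derivWithin (fun s' => Ψ t s') (Icc 0 1) s = ε t s * derivWithin (fun t' => Ψ t' s) (Icc 0 1) t

section Wilson

variable {𝕜 : Type*} [RCLike 𝕜] {M L : NQManifold 𝕜}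

/-- `C` is a concatenation `C₂ ∘ C₁`: it runs through `C₁` on `[0,c]` and then through `C₂` on
`[c,1]`, parametrized by `ρ₁` and `ρ₂`. -/
structure IsConcat (C C₂ C₁ : SuperCurve M L) (c : ℝ) (ρ₁ ρ₂ : ℝ → ℝ) : Prop where
  pos : 0 < c
  lt_one : c < 1
  param₁ : IsParam ρ₁ 0 c 0 1
  param₂ : IsParam ρ₂ c 1 0 1
  first : IsReparamOn C C₁ ρ₁ 0 c
  second : IsReparamOn C C₂ ρ₂ c 1

variable {E : NQRepresentation M}

/-- The piece of `C` over `[a,b]` lies in the patch `φ`. -/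
def LiesIn (C : SuperCurve M L) (φ : Patch E) (a b : ℝ) : Prop :=
  ∀ t ∈ Icc a b, ∀ y : L.body, C.map (pt t, y) ∈ φ.dom

/-- The matrix `∂_θ T(x(t,θ,y))|_{θ=0}` at a point `y` of the body of `L`. -/
def conn (C : SuperCurve M L) (φ : Patch E) (y : L.body) (t : ℝ) : Matrix E.ι E.ι (L.space.fib y) :=
  Matrix.of fun α β => open Classical in
    if h : C.map (pt t, y) ∈ φ.dom then (C.pull φ.dom (φ.T α β) ⟨(pt t, y), h⟩).im else 0

/-- The Wilson line `U(b,a) = P exp (- ∫_a^b dt dθ T)` of a super-curve in a patch, a matrix of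
functions on `L`, evaluated in the fibre over a point `y` of the body of `L`. The Wilson line of the
super-curve itself is `U(1,0)`. -/
def wilson (C : SuperCurve M L) (φ : Patch E) (y : L.body) (b a : ℝ) : Matrix E.ι E.ι (L.space.fib y) :=
  pathExp 𝕜 (conn C φ y) b a

/-- The transition function `Ω(x(t,θ,y))|_{θ=0}` from the patch `φ'` to the patch `φ`. -/
def transitionAt (C : SuperCurve M L) (φ φ' : Patch E) (y : L.body) (t : ℝ) :
    Matrix E.ι E.ι (L.space.fib y) :=
  Matrix.of fun α β => open Classical in
    if h : C.map (pt t, y) ∈ φ.dom ⊓ φ'.dom then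
      (C.pull (φ.dom ⊓ φ'.dom) (φ.Ω φ' α β) ⟨(pt t, y), h⟩).re else 0

/-- The spliced Wilson line
`U_k(t_{k+1},t_k) Ω_{k,k-1}(t_k) U_{k-1}(t_k,t_{k-1}) ⋯ Ω_{1,0}(t_1) U_0(t_1,t_0)`, where `U_i` is
computed in the patch `φ i`. -/
def spliced (C : SuperCurve M L) (φ : ℕ → Patch E) (t : ℕ → ℝ) (y : L.body) :
    ℕ → Matrix E.ι E.ι (L.space.fib y)
  | 0 => wilson C (φ 0) y (t 1) (t 0)
  | k + 1 => wilson C (φ (k + 1)) y (t (k + 2)) (t (k + 1)) *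
      transitionAt C (φ (k + 1)) (φ k) y (t (k + 1)) * spliced C φ t y k

/-- `0 = t_0 ≤ ⋯ ≤ t_{k+1} = 1` is a subdivision such that the `i`-th piece of `C` lies in the patch
`φ i`, for `i = 0, …, k`. -/
structure Fits (C : SuperCurve M L) (φ : ℕ → Patch E) (k : ℕ) (t : ℕ → ℝ) : Prop where
  zero : t 0 = 0
  one : t (k + 1) = 1
  mono : ∀ i ≤ k, t i ≤ t (i + 1)
  liesIn : ∀ i ≤ k, LiesIn C (φ i) (t i) (t (i + 1))

/-- The patches `φ₁ 0, …, φ₁ k` followed by `φ₂ 0, φ₂ 1, …`. -/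
def followedBy (φ₁ : ℕ → Patch E) (k : ℕ) (φ₂ : ℕ → Patch E) : ℕ → Patch E :=
  fun i => if i ≤ k then φ₁ i else φ₂ (i - (k + 1))

end Wilson

end NQ

end

open NQ

/-! ### Linear differential equations in Banach algebras -/

/-! Everything takes place in the fibre over one fixed point `y` of the body of `L`. The entry
`T^α_β` has degree `lev β + 1 - lev α`, and `∂_θ` lowers degrees by one, so the connection matrix
`A(t)` has entries in the homogeneous parts of degree `lev β - lev α` of the fibre. These parts are
finite-dimensional, because only finitely many monomials in the coordinates have a given degree.
Since degrees telescope under matrix multiplication, such matrices form a finite-dimensional algebra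
`B`, which carries a submultiplicative norm (`exists_normedModel`). The weakly defined integrals and
series are thus images of honest ones in `B` (`pathExp_eq`): the Dyson series converges factorially,
and its sum `evol A a t` is the solution of `u' = -A u`, `u(a) = 1`.

Composition and reparametrization are both uniqueness of solutions (`eq_evol_mul`). Cutting a path
restarts the same equation. Reparametrizing by `ρ` replaces `A(t)` by `ρ'(t) A(ρ(t))`, because a
`θ`-component acquires the factor `ρ'`, and by the chain rule `t ↦ u(ρ(t))` solves the new equation.
Neither argument inverts `ρ`. Transition functions involve only the `θ`-independent part, which is
merely evaluated at `ρ(t)`, so a spliced Wilson line is invariant factor by factor.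

For a homotopy with `x̄ = ε ∂_θ x`, let `b` be the `θ`-component of the pullback of a function.
Compatibility with the differentials, read off in the `ϑθ`-component, is the equation `∂_s b = ∂_t
(ε b)` (`IsReparamWith.exists_hasWDeriv`). Hence `∂_s A = ∂_t (ε A)`: the connection `A dt + ε A ds`
is flat, since the commutator of `A` and `ε A` vanishes, and its holonomy from `t = 0` to `t = 1` is
constant because `ε` vanishes at the ends. Analytically, `u - h ε A u` solves the equation at `s +
h` up to `o(h)`, and Gronwall's inequality shows that the holonomy has zero derivative in `s`
(`evol_homotopy`).

Conversely, a family `Φ(t,s)` with `∂_t Φ = Φ₁` and `∂_s Φ = ε Φ₁` acts on a super-curve by `a + θ b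
↦ a + θ Φ₁ b + ϑ ε Φ₁ b`, with `a` and `b` taken at `Φ`. This is an algebra homomorphism, and it
commutes with the differentials by the chain rule and `∂_s Φ₁ = ∂_t (ε Φ₁)` (`flowPull_q`). A single
reparametrization is the case of a constant family, `ε = 0`. Linear interpolation connects the
identity to a given diffeomorphism. To concatenate, both curves are first made stationary near the
junction; there they agree on an open interval and can be glued. -/

noncomputable section

namespace NQ

section Evolution

variable {B : Type*} [NormedRing B] [NormedAlgebra ℝ B]

/-- The terms of the Dyson series of the equation `u' = -A u`, `u(a) = 1`. -/
def dyson (A : ℝ → B) (a : ℝ) : ℕ → ℝ → B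
  | 0 => fun _ => 1
  | q + 1 => fun t => ∫ s in a..t, -(A s * dyson A a q s)

/-- The solution of `u' = -A u`, `u(a) = 1`. -/
def evol (A : ℝ → B) (a t : ℝ) : B := ∑' q, dyson A a q t

variable {A : ℝ → B}

theorem dyson_continuous [CompleteSpace B] (hA : Continuous A) (a : ℝ) (q : ℕ) :
    Continuous (dyson A a q) := by
  induction q with
  | zero => exact continuous_const
  | succ q ih => 
    exact intervalIntegral.continuous_primitive (μ := volume)
      (fun x y => ((hA.mul ih).neg).intervalIntegrable x y) a

theorem dyson_hasDerivAt [CompleteSpace B] (hA : Continuous A) (a : ℝ) (q : ℕ) (t : ℝ) :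
    HasDerivAt (dyson A a (q + 1)) (-(A t * dyson A a q t)) t :=
  ((hA.mul (dyson_continuous hA a q)).neg).integral_hasStrictDerivAt a t |>.hasDerivAt

/-- By induction, each integration of `|s - a| ^ q` supplies the next factor of the factorial. The
factor `‖1‖` stays because the norm is not assumed to be normalized. -/
theorem norm_dyson_le {K : ℝ} (hK : ∀ s, ‖A s‖ ≤ K) (a : ℝ)
    (q : ℕ) (t : ℝ) : ‖dyson A a q t‖ ≤ ‖(1 : B)‖ * ((K * |t - a|) ^ q / q.factorial) := by
  induction q generalizing t with
  | zero => simp [dyson]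
  | succ q ih =>
    have hK0 : 0 ≤ K := (norm_nonneg _).trans (hK 0)
    have hb : ∀ s, ‖-(A s * dyson A a q s)‖ ≤
        |s - a| ^ q * (‖(1 : B)‖ * (K ^ (q + 1) / q.factorial)) := fun s => by
      rw [norm_neg]
      calc ‖A s * dyson A a q s‖ ≤ ‖A s‖ * ‖dyson A a q s‖ := norm_mul_le _ _
        _ ≤ K * (‖(1 : B)‖ * ((K * |s - a|) ^ q / q.factorial)) := by
          gcongr
          · exact hK s
          · exact ih s
        _ = _ := by rw [mul_pow]; ring
    have hc : Continuous fun s : ℝ => |s - a| ^ q * (‖(1 : B)‖ * (K ^ (q + 1) / q.factorial)) := by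
      fun_prop
    calc ‖dyson A a (q + 1) t‖ ≤ |∫ s in a..t, |s - a| ^ q *
          (‖(1 : B)‖ * (K ^ (q + 1) / q.factorial))| :=
        intervalIntegral.norm_integral_le_abs_of_norm_le (Filter.Eventually.of_forall hb)
          (hc.intervalIntegrable _ _)
      _ = _ := by
        have h1 : 0 ≤ |t - a| ^ (q + 1) / ((q : ℝ) + 1) := by positivity
        have h2 : 0 ≤ ‖(1 : B)‖ * (K ^ (q + 1) / q.factorial) := by positivity
        rw [intervalIntegral.integral_mul_const, abs_mul, intervalIntegral.abs_intervalIntegral_eq,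
          integral_pow_abs_sub_uIoc, abs_of_nonneg h1, abs_of_nonneg h2, mul_pow,
          Nat.factorial_succ]
        push_cast
        field_simp

theorem dyson_hasSum [CompleteSpace B] {K : ℝ} (hK : ∀ s, ‖A s‖ ≤ K) (a t : ℝ) :
    HasSum (fun q => dyson A a q t) (evol A a t) :=
  (Summable.of_norm_bounded ((Real.summable_pow_div_factorial _).mul_left _)
    fun q => norm_dyson_le hK a q t).hasSum

theorem evol_self (A : ℝ → B) (a : ℝ) : evol A a a = 1 := by
  rw [evol, tsum_eq_single 0]
  · rfl
  · intro q hq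
    obtain ⟨q, rfl⟩ := Nat.exists_eq_succ_of_ne_zero hq
    simp [dyson]

theorem evol_hasDerivAt [CompleteSpace B] (hA : Continuous A) {K : ℝ} (hK : ∀ s, ‖A s‖ ≤ K) (a t : ℝ) :
    HasDerivAt (evol A a) (-(A t * evol A a t)) t := by
  have hK0 : 0 ≤ K := (norm_nonneg _).trans (hK 0)
  -- Termwise differentiation needs a summable bound uniform near `t`; on the ball of radius `R`
  -- about `a` the factorial estimate provides one. The constant term `q = 0` is split off, so that
  -- the derivative of term `q + 1` is `-A` times term `q`.
  set R := |t - a| + 1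
  have ht : t ∈ Metric.ball a R := by
    rw [Metric.mem_ball, Real.dist_eq]
    exact lt_add_one _
  have hsum : Summable fun q : ℕ => K * (‖(1 : B)‖ * ((K * R) ^ q / q.factorial)) :=
    ((Real.summable_pow_div_factorial _).mul_left _).mul_left _
  have hbd : ∀ q : ℕ, ∀ y ∈ Metric.ball a R,
      ‖-(A y * dyson A a q y)‖ ≤ K * (‖(1 : B)‖ * ((K * R) ^ q / q.factorial)) := by
    intro q y hy
    have hy' : |y - a| ≤ R := by
      rw [Metric.mem_ball, Real.dist_eq] at hy
      exact hy.le
    rw [norm_neg]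
    calc ‖A y * dyson A a q y‖ ≤ ‖A y‖ * ‖dyson A a q y‖ := norm_mul_le _ _
      _ ≤ K * (‖(1 : B)‖ * ((K * |y - a|) ^ q / q.factorial)) := by
        gcongr
        · exact hK y
        · exact norm_dyson_le hK a q y
      _ ≤ _ := by gcongr
  have h := hasDerivAt_tsum_of_isPreconnected (g := fun q => dyson A a (q + 1)) hsum
    Metric.isOpen_ball (convex_ball a R).isPreconnected
    (fun q y _ => dyson_hasDerivAt hA a q y) hbd ht
    ((summable_nat_add_iff 1).2 (dyson_hasSum hK a t).summable) ht
  have he : evol A a = fun t => 1 + ∑' q, dyson A a (q + 1) t := by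
    funext t
    exact (dyson_hasSum hK a t).summable.tsum_eq_zero_add
  rw [((dyson_hasSum hK a t).mul_left (A t)).neg.tsum_eq] at h
  rw [he] at h ⊢
  exact h.const_add 1

theorem lipschitzWith_neg_mul_left {B : Type*} [NormedRing B] {K : ℝ} (c : B) (hK : ‖c‖ ≤ K) :
    LipschitzWith K.toNNReal fun x : B => -(c * x) :=
  LipschitzWith.of_dist_le_mul fun x y => by
    rw [dist_neg_neg, dist_eq_norm, dist_eq_norm, ← mul_sub]
    refine (norm_mul_le _ _).trans ?_
    gcongr
    exact hK.trans (Real.le_coe_toNNReal K)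

theorem hasDerivWithinAt_Ici_of_Icc {E : Type*} [NormedAddCommGroup E] [NormedSpace ℝ E] {f : ℝ → E}
    {f' : E} {a b t : ℝ} (ht : t ∈ Ico a b) (h : HasDerivWithinAt f f' (Icc a b) t) :
    HasDerivWithinAt f f' (Ici t) t :=
  h.mono_of_mem_nhdsWithin <| Filter.mem_of_superset (Icc_mem_nhdsGE ht.2) (Icc_subset_Icc_left ht.1)

/-- Uniqueness for the linear equation: as `A` acts from the left, right multiplication by the
constant `w a` preserves solutions. Cutting and reparametrization both reduce to this. -/
theorem eq_evol_mul [CompleteSpace B] (hA : Continuous A) {K : ℝ} (hK : ∀ s, ‖A s‖ ≤ K) {a b : ℝ}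
    {w : ℝ → B}
    (hw : ∀ t ∈ Icc a b, HasDerivWithinAt w (-(A t * w t)) (Icc a b) t) :
    ∀ t ∈ Icc a b, w t = evol A a t * w a := by
  have hd : ∀ t, HasDerivAt (fun t => evol A a t * w a) (-(A t * (evol A a t * w a))) t := fun t =>
    ((evol_hasDerivAt hA hK a t).mul_const (w a)).congr_deriv (by rw [neg_mul, mul_assoc])
  refine ODE_solution_unique (v := fun t x => -(A t * x))
    (fun t => lipschitzWith_neg_mul_left (A t) (hK t))
    (fun t ht => (hw t ht).continuousWithinAt)
    (fun t ht => hasDerivWithinAt_Ici_of_Icc ht (hw t (Ico_subset_Icc_self ht)))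
    (fun t _ => (hd t).continuousAt.continuousWithinAt)
    (fun t _ => (hd t).hasDerivWithinAt) (by simp [evol_self])

theorem evol_mul_evol [CompleteSpace B] (hA : Continuous A) {K : ℝ} (hK : ∀ s, ‖A s‖ ≤ K) {a b c : ℝ}
    (hbc : b ≤ c) : evol A a c = evol A b c * evol A a b :=
  eq_evol_mul hA hK (fun t _ => (evol_hasDerivAt hA hK a t).hasDerivWithinAt) c ⟨hbc, le_rfl⟩

/-- By the chain rule `t ↦ evol A (ρ a) (ρ t)` solves the equation of `A'` with initial value one.
As `A` is defined and bounded on the whole line, neither monotonicity nor invertibility of `ρ` plays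
a role. -/
theorem evol_reparam [CompleteSpace B] (hA : Continuous A) {K : ℝ} (hK : ∀ s, ‖A s‖ ≤ K) {A' : ℝ → B}
    (hA' : Continuous A') {K' : ℝ} (hK' : ∀ s, ‖A' s‖ ≤ K') {a b : ℝ} (hab : a ≤ b) {ρ r : ℝ → ℝ}
    (hρ : ∀ t ∈ Icc a b, HasDerivWithinAt ρ (r t) (Icc a b) t)
    (h : ∀ t ∈ Icc a b, A' t = r t • A (ρ t)) :
    evol A' a b = evol A (ρ a) (ρ b) := by
  have := eq_evol_mul hA' hK' (a := a) (b := b) (w := fun t => evol A (ρ a) (ρ t)) (fun t ht => by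
    refine ((evol_hasDerivAt hA hK (ρ a) (ρ t)).scomp_hasDerivWithinAt t (hρ t ht)).congr_deriv ?_
    rw [h t ht, smul_neg, smul_mul_assoc]) b ⟨hab, le_rfl⟩
  simpa [evol_self] using this.symm

end Evolution

end NQ

end

/-! ### Invariance of the holonomy under homotopies along the path -/

noncomputable section

namespace NQ

section Homotopy

variable {B : Type*} [NormedRing B] [NormedAlgebra ℝ B] [CompleteSpace B]

/-- Here `A'` stands for the connection at `s + h` and `e` for the vector field. The infinitesimal
gauge transform `w = u - h e A u` of the old solution `u` nearly solves the new equation; since `e`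
vanishes at both ends, `w` has the same end values as `u`. Gronwall's inequality then compares it
with the new solution. -/
theorem norm_evol_sub_le {A A' D : ℝ → B} (hA : Continuous A) (hA' : Continuous A') {K : ℝ}
    (hK : ∀ t, ‖A t‖ ≤ K) (hK' : ∀ t, ‖A' t‖ ≤ K) {e : ℝ → ℝ} {h η N R : ℝ}
    (hN : ∀ t ∈ Icc (0 : ℝ) 1, ‖evol A 0 t‖ ≤ N) (hR : ∀ t ∈ Icc (0 : ℝ) 1, |e t| ≤ R)
    (hη : 0 ≤ η) (h₁ : ∀ t ∈ Icc (0 : ℝ) 1, ‖A' t - A t - h • D t‖ ≤ η * |h|)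
    (h₂ : ∀ t ∈ Icc (0 : ℝ) 1, ‖A' t - A t‖ ≤ η)
    (hD : ∀ t ∈ Icc (0 : ℝ) 1, HasDerivWithinAt (fun t => e t • A t) (D t) (Icc 0 1) t)
    (h0 : e 0 = 0) (h1 : e 1 = 0) :
    ‖evol A' 0 1 - evol A 0 1‖ ≤
      gronwallBound 0 K.toNNReal (0 + η * |h| * (N + R * K * N)) 1 := by
  set w : ℝ → B := fun t => evol A 0 t - h • (e t • A t * evol A 0 t)
  set w' : ℝ → B := fun t => -(A t * evol A 0 t) -
    h • (D t * evol A 0 t + e t • A t * -(A t * evol A 0 t))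
  have hw : ∀ t ∈ Icc (0 : ℝ) 1, HasDerivWithinAt w (w' t) (Icc 0 1) t := fun t ht =>
    have hu := (evol_hasDerivAt hA hK 0 t).hasDerivWithinAt (s := Icc 0 1)
    hu.sub (((hD t ht).mul hu).const_smul h)
  have hbd : ∀ t ∈ Icc (0 : ℝ) 1, dist (w' t) (-(A' t * w t)) ≤ η * |h| * (N + R * K * N) := by
    intro t ht
    -- As `e` is a scalar function, `A` commutes with `e A`; only the first-order error of `A'` and
    -- a product of two small factors, `h` and `A' - A`, remain.
    have : w' t - -(A' t * w t) = (A' t - A t - h • D t) * evol A 0 t -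
        (h * e t) • ((A' t - A t) * (A t * evol A 0 t)) := by
      simp only [w, w', mul_sub, sub_mul, smul_mul_assoc, mul_smul_comm, smul_sub, mul_smul,
        smul_add, mul_neg, smul_neg]
      abel
    rw [dist_eq_norm, this]
    have hK0 : 0 ≤ K := (norm_nonneg _).trans (hK 0)
    have hN0 : 0 ≤ N := (norm_nonneg _).trans (hN t ht)
    calc _ ≤ ‖A' t - A t - h • D t‖ * ‖evol A 0 t‖ +
          |h| * |e t| * (‖A' t - A t‖ * (‖A t‖ * ‖evol A 0 t‖)) := by
          refine (norm_sub_le _ _).trans (add_le_add (norm_mul_le _ _) ?_)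
          rw [norm_smul, Real.norm_eq_abs, abs_mul]
          gcongr
          refine (norm_mul_le _ _).trans ?_
          gcongr
          exact norm_mul_le _ _
      _ ≤ η * |h| * N + |h| * R * (η * (K * N)) := by
          gcongr
          · exact h₁ t ht
          · exact hN t ht
          · exact mul_nonneg (abs_nonneg _) ((abs_nonneg _).trans (hR t ht))
          · exact hR t ht
          · exact h₂ t ht
          · exact hK t
          · exact hN t ht
      _ = _ := by ring
  have := dist_le_of_approx_trajectories_ODE (v := fun t x => -(A' t * x)) (a := 0) (b := 1) (δ := 0)
    (fun t => lipschitzWith_neg_mul_left (A' t) (hK' t))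
    (fun t _ => (evol_hasDerivAt hA' hK' 0 t).continuousAt.continuousWithinAt)
    (fun t _ => (evol_hasDerivAt hA' hK' 0 t).hasDerivWithinAt)
    (fun t _ => (dist_self _).le)
    (fun t ht => (hw t ht).continuousWithinAt)
    (fun t ht => hasDerivWithinAt_Ici_of_Icc ht (hw t (Ico_subset_Icc_self ht)))
    (fun t ht => hbd t (Ico_subset_Icc_self ht)) (by simp [w, evol_self, h0]) 1 ⟨zero_le_one, le_rfl⟩
  simpa [w, h1, dist_eq_norm] using this

/-- The common value `D` of `∂_s A` and `∂_t (ε A)` expresses flatness of `A dt + ε A ds`. Uniform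
continuity of `A` and `D` on the compact square makes the errors in `norm_evol_sub_le` of size
`o(h)` uniformly in `t`, so the holonomy has zero derivative in `s`. -/
theorem evol_homotopy {A D : ℝ → ℝ → B} {ε : ℝ → ℝ → ℝ} (hA : Continuous fun p : ℝ × ℝ => A p.1 p.2)
    {K : ℝ} (hK : ∀ s t, ‖A s t‖ ≤ K)
    (hDc : ContinuousOn (fun p : ℝ × ℝ => D p.1 p.2) (Icc 0 1 ×ˢ Icc 0 1))
    (hεc : ContinuousOn (fun p : ℝ × ℝ => ε p.1 p.2) (Icc 0 1 ×ˢ Icc 0 1))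
    (hs : ∀ s ∈ Icc (0 : ℝ) 1, ∀ t ∈ Icc (0 : ℝ) 1,
      HasDerivWithinAt (fun s => A s t) (D s t) (Icc 0 1) s)
    (ht : ∀ s ∈ Icc (0 : ℝ) 1, ∀ t ∈ Icc (0 : ℝ) 1,
      HasDerivWithinAt (fun t => ε t s • A s t) (D s t) (Icc 0 1) t)
    (h0 : ∀ s ∈ Icc (0 : ℝ) 1, ε 0 s = 0) (h1 : ∀ s ∈ Icc (0 : ℝ) 1, ε 1 s = 0) :
    ∀ s ∈ Icc (0 : ℝ) 1, evol (A s) 0 1 = evol (A 0) 0 1 := by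
  have hAs : ∀ s, Continuous (A s) := fun s => hA.comp (by fun_prop : Continuous fun t => (s, t))
  have hK0 : 0 ≤ K := (norm_nonneg _).trans (hK 0 0)
  have hcpt : IsCompact (Icc (0 : ℝ) 1 ×ˢ Icc (0 : ℝ) 1) := isCompact_Icc.prod isCompact_Icc
  obtain ⟨R, hR⟩ := hcpt.exists_bound_of_continuousOn hεc
  have key : ∀ s ∈ Icc (0 : ℝ) 1, HasDerivWithinAt (fun s => evol (A s) 0 1) 0 (Icc 0 1) s := by
    intro s hsI
    obtain ⟨N, hN⟩ := isCompact_Icc.exists_bound_of_continuousOn (f := evol (A s) 0)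
      (s := Icc (0 : ℝ) 1)
      fun t _ => (evol_hasDerivAt (hAs s) (hK s) 0 t).continuousAt.continuousWithinAt
    have hN0 : 0 ≤ N := (norm_nonneg _).trans (hN 0 (by simp))
    have hR0 : 0 ≤ R := (norm_nonneg _).trans (hR (0, 0) (by simp))
    set P := N + R * (K + 1) * N
    have hP : 0 ≤ P := by positivity
    -- Gronwall's bound is linear in the forcing term. The constant `K + 1` avoids the separate
    -- formula for the case `K = 0`, and the summand `1` in `G` makes it positive.
    obtain ⟨G, hG0, hG⟩ : ∃ G : ℝ, 0 < G ∧ ∀ x : ℝ, 0 ≤ x →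
        gronwallBound 0 (K + 1) (0 + x * P) 1 ≤ G * x := by
      have hK1 : K + 1 ≠ 0 := by positivity
      refine ⟨P / (K + 1) * (Real.exp ((K + 1) * 1) - 1) + 1, ?_, fun x hx => ?_⟩
      · have : 0 ≤ Real.exp ((K + 1) * 1) - 1 := by
          rw [sub_nonneg, Real.one_le_exp_iff]
          positivity
        positivity
      · simp only [gronwallBound_of_K_ne_0 hK1, zero_add, zero_mul]
        have : x * P / (K + 1) * (Real.exp ((K + 1) * 1) - 1) =
          P / (K + 1) * (Real.exp ((K + 1) * 1) - 1) * x := by ring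
        rw [this, add_mul]
        linarith
    rw [hasDerivWithinAt_iff_isLittleO, Asymptotics.isLittleO_iff]
    intro c hc
    -- With this `η` the final estimate `G * (η * |s' - s|)` is exactly `c * |s' - s|`.
    set η := c / G
    have hη : 0 < η := div_pos hc hG0
    obtain ⟨δ₁, hδ₁, hu₁⟩ := Metric.uniformContinuousOn_iff.1
      (hcpt.uniformContinuousOn_of_continuous hDc) η hη
    obtain ⟨δ₂, hδ₂, hu₂⟩ := Metric.uniformContinuousOn_iff.1
      (hcpt.uniformContinuousOn_of_continuous hA.continuousOn) η hη
    filter_upwards [inter_mem_nhdsWithin (Icc (0 : ℝ) 1) (Metric.ball_mem_nhds s (lt_min hδ₁ hδ₂))]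
      with s' hs'
    have hd₁ : dist s' s < δ₁ := (Metric.mem_ball.1 hs'.2).trans_le (min_le_left _ _)
    have hd₂ : dist s' s < δ₂ := (Metric.mem_ball.1 hs'.2).trans_le (min_le_right _ _)
    have hsub : uIcc s s' ⊆ Icc (0 : ℝ) 1 := uIcc_subset_Icc hsI hs'.1
    have hpt : ∀ t ∈ Icc (0 : ℝ) 1, ∀ x ∈ Icc (0 : ℝ) 1, dist (x, t) (s, t) = dist x s :=
      fun t _ x _ => by simp [Prod.dist_eq]
    have hlin : ∀ t ∈ Icc (0 : ℝ) 1, ‖A s' t - A s t - (s' - s) • D s t‖ ≤ η * |s' - s| := by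
      intro t ht'
      -- Subtracting the linear part leaves the derivative `D x t - D s t`, which is at most `η`;
      -- the mean value inequality gives a first-order error uniform in `t`.
      have hd : ∀ x ∈ uIcc s s', HasDerivWithinAt (fun x => A x t - x • D s t)
          (D x t - D s t) (uIcc s s') x := fun x hx =>
        (((hs x (hsub hx) t ht').mono hsub).sub
          ((hasDerivWithinAt_id x _).smul_const (D s t))).congr_deriv (by simp)
      have := (convex_uIcc s s').norm_image_sub_le_of_norm_hasDerivWithin_le hd (C := η)
        (fun x hx => by
          rw [← dist_eq_norm]
          refine (hu₁ (x, t) ⟨hsub hx, ht'⟩ (s, t) ⟨hsI, ht'⟩ ?_).le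
          rw [hpt t ht' x (hsub hx)]
          refine lt_of_le_of_lt ?_ hd₁
          rw [Real.dist_eq, Real.dist_eq]
          exact abs_sub_left_of_mem_uIcc hx) left_mem_uIcc right_mem_uIcc
      rw [Real.norm_eq_abs] at this
      refine le_of_eq_of_le ?_ this
      congr 1
      rw [sub_smul]
      abel
    have hdist : ∀ t ∈ Icc (0 : ℝ) 1, ‖A s' t - A s t‖ ≤ η := fun t ht' => by
      rw [← dist_eq_norm]
      refine (hu₂ (s', t) ⟨hs'.1, ht'⟩ (s, t) ⟨hsI, ht'⟩ ?_).le
      rwa [hpt t ht' s' hs'.1]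
    have hest := norm_evol_sub_le (hAs s) (hAs s') (K := K + 1) (D := D s) (e := fun t => ε t s)
      (h := s' - s) (η := η) (N := N) (R := R)
      (fun t => (hK s t).trans (by linarith)) (fun t => (hK s' t).trans (by linarith)) hN
      (fun t ht => hR (t, s) ⟨ht, hsI⟩) hη.le hlin hdist (fun t htI => ht s hsI t htI) (h0 s hsI)
      (h1 s hsI)
    rw [Real.coe_toNNReal _ (by positivity)] at hest
    rw [smul_zero, sub_zero, Real.norm_eq_abs]
    refine hest.trans ((hG _ (by positivity)).trans_eq ?_)
    simp only [η]
    field_simp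
  exact constant_of_has_deriv_right_zero (fun s hs => (key s hs).continuousWithinAt)
    fun s hs => hasDerivWithinAt_Ici_of_Icc hs (key s (Ico_subset_Icc_self hs))

end Homotopy

end NQ

end

/-! ### Path-ordered exponentials in finite-dimensional algebras of matrices -/

noncomputable section

namespace NQ

section Weak

variable {𝕜 F : Type*} [RCLike 𝕜] [AddCommGroup F] [Module 𝕜 F]

/-- Functionals separate the points of any vector space. Weak derivatives, integrals and sums are
therefore unique, and the chosen values in `wderiv`, `wint` and `wsum` are the expected ones. -/
theorem eq_of_dual_eq {v w : F} (h : ∀ ℓ : Module.Dual 𝕜 F, ℓ v = ℓ w) : v = w :=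
  sub_eq_zero.1 <| (Module.forall_dual_apply_eq_zero_iff 𝕜 _).1 fun ℓ => by rw [map_sub, h, sub_self]

theorem HasWInt.wint_eq {g : ℝ → F} {a b : ℝ} {v : F} (h : HasWInt 𝕜 g a b v) :
    wint 𝕜 g a b = v := by
  have hex : ∃ v : F, HasWInt 𝕜 g a b v := ⟨v, h⟩
  rw [wint, dif_pos hex]
  exact eq_of_dual_eq fun ℓ => ((hex.choose_spec ℓ).2).trans (h ℓ).2.symm

theorem HasWSum.wsum_eq {u : ℕ → F} {v : F} (h : HasWSum 𝕜 u v) : wsum 𝕜 u = v := by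
  have hex : ∃ v : F, HasWSum 𝕜 u v := ⟨v, h⟩
  rw [wsum, dif_pos hex]
  exact eq_of_dual_eq fun ℓ => (hex.choose_spec ℓ).unique (h ℓ)

/-- `v` is the derivative of `g` at `t`, tested by linear functionals. -/
def HasWDeriv (𝕜 : Type*) [RCLike 𝕜] {F : Type*} [AddCommGroup F] [Module 𝕜 F] (g : ℝ → F) (v : F)
    (t : ℝ) : Prop :=
  ∀ ℓ : Module.Dual 𝕜 F, HasDerivWithinAt (fun s => ℓ (g s)) (ℓ v) (Icc 0 1) t

theorem HasWDeriv.wderiv_eq {g : ℝ → F} {v : F} {t : ℝ} (h : HasWDeriv 𝕜 g v t)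
    (ht : t ∈ Icc (0 : ℝ) 1) : wderiv 𝕜 g t = v := by
  have hex : ∃ v : F, ∀ ℓ : Module.Dual 𝕜 F,
    HasDerivWithinAt (fun s => ℓ (g s)) (ℓ v) (Icc 0 1) t := ⟨v, h⟩
  rw [wderiv, dif_pos hex]
  exact eq_of_dual_eq fun ℓ => (uniqueDiffOn_Icc zero_lt_one t ht).eq_deriv _ (hex.choose_spec ℓ) (h ℓ)

end Weak

section Bridge

variable {𝕜 : Type*} [RCLike 𝕜] {F : Type*} [Ring F] [Algebra 𝕜 F]
  {ι : Type*} [Fintype ι] [DecidableEq ι]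
  {B : Type*} [NormedRing B] [NormedAlgebra ℝ B] [NormedAlgebra 𝕜 B] [IsScalarTower ℝ 𝕜 B]
  [FiniteDimensional 𝕜 B]

/-- The continuous linear functional on `B` given by a functional on an entry of a matrix. -/
def entryFunctional (Θ : B →ₐ[𝕜] Matrix ι ι F) (ℓ : Module.Dual 𝕜 F) (α β : ι) : B →L[ℝ] 𝕜 :=
  (LinearMap.toContinuousLinearMap
    (ℓ ∘ₗ Matrix.entryLinearMap 𝕜 F α β ∘ₗ Θ.toLinearMap)).restrictScalars ℝ

@[simp] theorem entryFunctional_apply (Θ : B →ₐ[𝕜] Matrix ι ι F) (ℓ : Module.Dual 𝕜 F) (α β : ι)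
    (x : B) : entryFunctional Θ ℓ α β x = ℓ (Θ x α β) := rfl

variable [CompleteSpace B]

/-- On the finite-dimensional `B` every functional is continuous, hence commutes with the integral.
`G` need only match `Θ ∘ g` on `[a,b]`. -/
theorem hasWInt_of_eq (Θ : B →ₐ[𝕜] Matrix ι ι F) {g : ℝ → B} (hg : Continuous g) {G : ℝ → Matrix ι ι F}
    {a b : ℝ} (hab : a ≤ b) (h : ∀ s ∈ Icc a b, G s = Θ (g s)) (α β : ι) :
    HasWInt 𝕜 (fun s => G s α β) a b (Θ (∫ s in a..b, g s) α β) := by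
  intro ℓ
  have he : EqOn (fun s => ℓ (G s α β)) (fun s => entryFunctional Θ ℓ α β (g s)) (uIcc a b) := by
    intro s hs
    rw [uIcc_of_le hab] at hs
    simp only [entryFunctional_apply, h s hs]
  refine ⟨?_, ?_⟩
  · refine (((entryFunctional Θ ℓ α β).continuous.comp hg).intervalIntegrable a b).congr ?_
    intro s hs
    exact (he (uIoc_subset_uIcc hs)).symm
  · rw [intervalIntegral.integral_congr he,
      ContinuousLinearMap.intervalIntegral_comp_comm _ (hg.intervalIntegrable a b),
      entryFunctional_apply]

variable {A : ℝ → Matrix ι ι F} {A' : ℝ → B} (Θ : B →ₐ[𝕜] Matrix ι ι F) {a b : ℝ}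

/-- `Θ` is multiplicative, so it carries the integrand of each Dyson term to that of the
corresponding weak iterated integral. -/
theorem iterInt_eq (hA' : Continuous A') (h : ∀ s ∈ Icc a b, A s = Θ (A' s)) (q : ℕ) :
    ∀ t ∈ Icc a b, iterInt 𝕜 A a q t = Θ (dyson A' a q t) := by
  induction q with
  | zero => intro t _; exact (map_one Θ).symm
  | succ q ih =>
    intro t ht
    ext α β
    refine HasWInt.wint_eq (hasWInt_of_eq Θ (hA'.mul (dyson_continuous hA' a q)).neg ht.1
      (G := fun s => -(A s * iterInt 𝕜 A a q s)) (fun s hs => ?_) α β)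
    have hs' : s ∈ Icc a b := ⟨hs.1, hs.2.trans ht.2⟩
    change -(A s * iterInt 𝕜 A a q s) = Θ (-(A' s * dyson A' a q s))
    rw [map_neg, map_mul, h s hs', ih s hs']

theorem hasWSum_iterInt (hA' : Continuous A') {K : ℝ} (hK : ∀ s, ‖A' s‖ ≤ K) (hab : a ≤ b)
    (h : ∀ s ∈ Icc a b, A s = Θ (A' s)) (α β : ι) :
    HasWSum 𝕜 (fun q => iterInt 𝕜 A a q b α β) (Θ (evol A' a b) α β) := by
  intro ℓ
  simp only [iterInt_eq Θ hA' h _ b ⟨hab, le_rfl⟩]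
  exact (entryFunctional Θ ℓ α β).hasSum (dyson_hasSum hK a b)

theorem pathExp_eq (hA' : Continuous A') {K : ℝ} (hK : ∀ s, ‖A' s‖ ≤ K) (hab : a ≤ b)
    (h : ∀ s ∈ Icc a b, A s = Θ (A' s)) : pathExp 𝕜 A b a = Θ (evol A' a b) := by
  ext α β
  exact (hasWSum_iterInt Θ hA' hK hab h α β).wsum_eq

theorem pathExpConverges_of_eq (hA' : Continuous A') {K : ℝ} (hK : ∀ s, ‖A' s‖ ≤ K) (hab : a ≤ b)
    (h : ∀ s ∈ Icc a b, A s = Θ (A' s)) : PathExpConverges 𝕜 A b a := by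
  refine ⟨fun q t ht α β => ?_, fun α β => ?_⟩
  · rw [iterInt_eq Θ hA' h (q + 1) t ht]
    refine hasWInt_of_eq Θ (hA'.mul (dyson_continuous hA' a q)).neg ht.1
      (G := fun s => -(A s * iterInt 𝕜 A a q s)) (fun s hs => ?_) α β
    have hs' : s ∈ Icc a b := ⟨hs.1, hs.2.trans ht.2⟩
    change -(A s * iterInt 𝕜 A a q s) = Θ (-(A' s * dyson A' a q s))
    rw [map_neg, map_mul, h s hs', iterInt_eq Θ hA' h q s hs']
  · rw [pathExp_eq Θ hA' hK hab h]
    exact hasWSum_iterInt Θ hA' hK hab h α β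

end Bridge

/-! ### Normed models of graded matrix algebras -/

section Model

variable (𝕜 : Type*) [RCLike 𝕜] {F : Type} [Ring F] [Algebra 𝕜 F]
  {ι : Type} [Fintype ι] [DecidableEq ι]

/-- The subalgebra of matrices with entries in given subspaces. -/
def entrySubalgebra (V : ι → ι → Submodule 𝕜 F) (h1 : ∀ α, 1 ∈ V α α)
    (hmul : ∀ α β γ x y, x ∈ V α β → y ∈ V β γ → x * y ∈ V α γ) : Subalgebra 𝕜 (Matrix ι ι F) where
  carrier := {M | ∀ α β, M α β ∈ V α β}
  mul_mem' {M N} hM hN α γ := by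
    rw [Matrix.mul_apply]
    exact Submodule.sum_mem _ fun β _ => hmul α β γ _ _ (hM α β) (hN β γ)
  add_mem' {M N} hM hN α β := Submodule.add_mem _ (hM α β) (hN α β)
  algebraMap_mem' c α β := by
    rw [Matrix.algebraMap_matrix_apply]
    split_ifs with h
    · subst h
      rw [Algebra.algebraMap_eq_smul_one]
      exact Submodule.smul_mem _ _ (h1 α)
    · exact Submodule.zero_mem _

theorem finiteDimensional_entrySubalgebra (V : ι → ι → Submodule 𝕜 F) (h1 : ∀ α, 1 ∈ V α α)
    (hmul : ∀ α β γ x y, x ∈ V α β → y ∈ V β γ → x * y ∈ V α γ)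
    [∀ α β, FiniteDimensional 𝕜 (V α β)] : FiniteDimensional 𝕜 (entrySubalgebra 𝕜 V h1 hmul) := by
  let f : entrySubalgebra 𝕜 V h1 hmul →ₗ[𝕜] (∀ α β, V α β) :=
    { toFun := fun M α β => ⟨M.1 α β, M.2 α β⟩
      map_add' := fun M N => rfl
      map_smul' := fun c M => rfl }
  refine FiniteDimensional.of_injective f fun M N h => ?_
  ext α β
  exact congrArg Subtype.val (congrFun (congrFun h α) β)

attribute [local instance] Matrix.linftyOpNormedRing Matrix.linftyOpNormedAlgebra in
-- The algebra is `entrySubalgebra`, normed through its left regular representation by matrices over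
-- `𝕜`. `Λ` extends the inverse of the inclusion linearly to all matrices, so it can be applied to a
-- matrix before its entries are known to lie in the right subspaces.
theorem exists_normedModel (V : ι → ι → Submodule 𝕜 F) (h1 : ∀ α, 1 ∈ V α α)
    (hmul : ∀ α β γ x y, x ∈ V α β → y ∈ V β γ → x * y ∈ V α γ)
    [∀ α β, FiniteDimensional 𝕜 (V α β)] :
    ∃ (B : Type) (_ : NormedRing B) (_ : NormedAlgebra ℝ B) (_ : NormedAlgebra 𝕜 B)
      (_ : IsScalarTower ℝ 𝕜 B) (_ : FiniteDimensional 𝕜 B) (_ : CompleteSpace B)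
      (Θ : B →ₐ[𝕜] Matrix ι ι F) (Λ : Matrix ι ι F →ₗ[𝕜] B),
      (∀ x, Λ (Θ x) = x) ∧ ∀ M : Matrix ι ι F, (∀ α β, M α β ∈ V α β) → Θ (Λ M) = M := by
  let S := entrySubalgebra 𝕜 V h1 hmul
  have : FiniteDimensional 𝕜 S := finiteDimensional_entrySubalgebra 𝕜 V h1 hmul
  let b := Module.finBasis 𝕜 S
  let Φ := Algebra.leftMulMatrix b
  let r : NormedRing S := NormedRing.induced S _ Φ (Algebra.leftMulMatrix_injective b)
  let na : NormedAlgebra 𝕜 S := NormedAlgebra.induced 𝕜 S _ Φ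
  let : NormedAlgebra ℝ S := NormedAlgebra.restrictScalars ℝ 𝕜 S
  have : IsScalarTower ℝ 𝕜 S := ⟨fun a c x => by
    change (a • c) • x = algebraMap ℝ 𝕜 a • c • x
    rw [Algebra.smul_def (R := ℝ) (A := 𝕜) a c, mul_smul]⟩
  obtain ⟨Λ, hΛ⟩ := S.val.toLinearMap.exists_leftInverse_of_injective
    (LinearMap.ker_eq_bot.2 Subtype.val_injective)
  have hΛ' : ∀ x : S, Λ x.1 = x := fun x => LinearMap.congr_fun hΛ x
  refine ⟨S, r, inferInstance, na, inferInstance, inferInstance, FiniteDimensional.complete 𝕜 S, S.val,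
    Λ, hΛ', fun M hM => ?_⟩
  exact congrArg Subtype.val (hΛ' ⟨M, hM⟩)

/-- A linear map from matrices to a finite-dimensional space, in coordinates. -/
theorem exists_functionals {B : Type*} [AddCommGroup B] [Module 𝕜 B] [FiniteDimensional 𝕜 B]
    (Λ : Matrix ι ι F →ₗ[𝕜] B) :
    ∃ (n : ℕ) (b : Fin n → B) (ℓ : Fin n → ι → ι → Module.Dual 𝕜 F),
      ∀ M, Λ M = ∑ k, (∑ α, ∑ β, ℓ k α β (M α β)) • b k := by
  let b := Module.finBasis 𝕜 B
  refine ⟨_, b, fun k α β => b.coord k ∘ₗ Λ ∘ₗ Matrix.singleLinearMap 𝕜 α β, fun M => ?_⟩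
  conv_lhs => rw [← b.sum_repr (Λ M)]
  refine Finset.sum_congr rfl fun k _ => ?_
  congr 1
  conv_lhs => rw [Matrix.matrix_eq_sum_single M]
  simp [map_sum]

end Model

end NQ

end

/-! ### Germs of functions and of families of functions -/

noncomputable section

namespace NQ

open scoped Topology

/-- Extension of a section by zero. -/
def extend {X : Type*} [TopologicalSpace X] {F : X → Type*} [∀ x, Zero (F x)] (U : Opens X)
    (f : (x : U) → F x) (x : X) : F x :=
  open Classical in if h : x ∈ U then f ⟨x, h⟩ else 0

theorem extend_of_mem {X : Type*} [TopologicalSpace X] {F : X → Type*} [∀ x, Zero (F x)]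
    {U : Opens X} (f : (x : U) → F x) {x : X} (h : x ∈ U) : extend U f x = f ⟨x, h⟩ :=
  dif_pos h

theorem restrict_extend {X : Type*} [TopologicalSpace X] {F : X → Type*} [∀ x, Zero (F x)]
    {U : Opens X} (f : (x : U) → F x) : (fun x : U => extend U f x) = f :=
  funext fun x => extend_of_mem f x.2

theorem contMDiffAt_mul {𝕜 : Type*} [RCLike 𝕜] {E H M : Type*} [NormedAddCommGroup E]
    [NormedSpace ℝ E] [TopologicalSpace H] {I : ModelWithCorners ℝ E H} [TopologicalSpace M]
    [ChartedSpace H M] {f g : M → 𝕜} {x : M} (hf : ContMDiffAt I 𝓘(ℝ, 𝕜) ∞ f x)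
    (hg : ContMDiffAt I 𝓘(ℝ, 𝕜) ∞ g x) : ContMDiffAt I 𝓘(ℝ, 𝕜) ∞ (fun x => f x * g x) x :=
  (contDiff_mul (𝕜 := ℝ) (𝔸 := 𝕜)).contMDiff.contMDiffAt.comp x (hf.prodMk_space hg)

namespace QSpace

variable {𝕜 : Type*} [RCLike 𝕜] {X : Type*} [TopologicalSpace X]
  {E₀ H₀ : Type*} [NormedAddCommGroup E₀] [NormedSpace ℝ E₀] [TopologicalSpace H₀]

/-- Functions restrict to smaller open sets. -/
def Restricts (A : QSpace 𝕜 X) : Prop :=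
  ∀ (U V : Opens X) (h : V ≤ U) (d : ℤ) (f), f ∈ A.Fun U d → res h f ∈ A.Fun V d

/-- `g` is a function of degree `d` near `x`. -/
def FunAt (A : QSpace 𝕜 X) (d : ℤ) (g : (x : X) → A.fib x) (x : X) : Prop :=
  ∃ V : Opens X, x ∈ V ∧ (fun y : V => g y) ∈ A.Fun V d

/-- `f` is a family of functions of degree `d`, parametrized by `[0,1]`, near `p`. -/
def FamAt (A : QSpace 𝕜 X) (I : ModelWithCorners ℝ E₀ H₀) [ChartedSpace H₀ X] (d : ℤ)
    (f : (p : Icc (0 : ℝ) 1 × X) → A.fib p.2) (p : Icc (0 : ℝ) 1 × X) : Prop :=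
  ∃ (κ : Type) (_ : Fintype κ) (a : κ → Icc (0 : ℝ) 1 × X → 𝕜) (g : κ → (x : X) → A.fib x),
    (∀ i, A.FunAt d (g i) p.2) ∧
    (∀ i, ∀ᶠ z in 𝓝 p, ContMDiffAt ((𝓡∂ 1).prod I) 𝓘(ℝ, 𝕜) ∞ (a i) z) ∧
    ∀ᶠ z in 𝓝 p, f z = ∑ i, a i z • g i z.2

variable {A : QSpace 𝕜 X} {I : ModelWithCorners ℝ E₀ H₀} [ChartedSpace H₀ X] {d e : ℤ}

theorem FunAt.eventually {g : (x : X) → A.fib x} {x : X} (h : A.FunAt d g x) :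
    ∀ᶠ y in 𝓝 x, A.FunAt d g y := by
  obtain ⟨V, hx, hV⟩ := h
  exact Filter.eventually_of_mem (V.isOpen.mem_nhds hx) fun y hy => ⟨V, hy, hV⟩

theorem Restricts.funAt_nhds (hA : A.Restricts) {g : (x : X) → A.fib x} {x : X} (h : A.FunAt d g x)
    {U : Set X} (hU : U ∈ 𝓝 x) : ∃ V : Opens X, x ∈ V ∧ (V : Set X) ⊆ U ∧
      ∀ V' ≤ V, (fun y : V' => g y) ∈ A.Fun V' d := by
  obtain ⟨V, hx, hV⟩ := h
  obtain ⟨W, hWU, hW, hxW⟩ := mem_nhds_iff.1 hU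
  exact ⟨V ⊓ ⟨W, hW⟩, ⟨hx, hxW⟩, fun y hy => hWU hy.2, fun V' h =>
    hA V V' (h.trans inf_le_left) d _ hV⟩

theorem Restricts.funAt_nhds_forall (hA : A.Restricts) {κ : Type} [Finite κ]
    {g : κ → (x : X) → A.fib x} {x : X} (h : ∀ i, A.FunAt d (g i) x) {U : Set X} (hU : U ∈ 𝓝 x) :
    ∃ V : Opens X, x ∈ V ∧ (V : Set X) ⊆ U ∧ ∀ i, (fun y : V => g i y) ∈ A.Fun V d := by
  choose V hx hVU hV using fun i => hA.funAt_nhds (h i) hU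
  obtain ⟨W, hWU, hW, hxW⟩ := mem_nhds_iff.1 hU
  refine ⟨⟨W ∩ ⋂ i, V i, hW.inter (isOpen_iInter_of_finite fun i => (V i).isOpen)⟩,
    ⟨hxW, mem_iInter.2 hx⟩, fun y hy => hWU hy.1, fun i => hV i _ fun y hy => mem_iInter.1 hy.2 i⟩

namespace FamAt

variable {f f' : (p : Icc (0 : ℝ) 1 × X) → A.fib p.2} {p : Icc (0 : ℝ) 1 × X}

theorem congr (h : A.FamAt I d f p) (hf : ∀ᶠ z in 𝓝 p, f' z = f z) : A.FamAt I d f' p := by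
  obtain ⟨κ, _, a, g, hg, ha, hs⟩ := h
  exact ⟨κ, _, a, g, hg, ha, by filter_upwards [hs, hf] with z h1 h2; rw [h2, h1]⟩

theorem eventually (h : A.FamAt I d f p) : ∀ᶠ z in 𝓝 p, A.FamAt I d f z := by
  obtain ⟨κ, _, a, g, hg, ha, hs⟩ := h
  have hg' : ∀ᶠ z in 𝓝 p, ∀ i, A.FunAt d (g i) z.2 :=
    Filter.eventually_all.2 fun i => continuousAt_snd.eventually (hg i).eventually
  have ha' : ∀ᶠ z in 𝓝 p, ∀ i, ∀ᶠ z in 𝓝 z, ContMDiffAt ((𝓡∂ 1).prod I) 𝓘(ℝ, 𝕜) ∞ (a i) z :=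
    Filter.eventually_all.2 fun i => (ha i).eventually_nhds
  filter_upwards [hg', ha', hs.eventually_nhds] with z h1 h2 h3
  exact ⟨κ, _, a, g, h1, h2, h3⟩

theorem of_funAt {g : (x : X) → A.fib x} (h : A.FunAt d g p.2) :
    A.FamAt I d (fun z => g z.2) p :=
  ⟨Unit, inferInstance, fun _ _ => 1, fun _ => g, fun _ => h,
    fun _ => Filter.Eventually.of_forall fun _ => contMDiffAt_const,
    Filter.Eventually.of_forall fun _ => by simp⟩

theorem zero : A.FamAt I d (fun _ => 0) p :=
  ⟨Empty, inferInstance, fun _ _ => 1, fun _ _ => 0, fun i => i.elim, fun i => i.elim,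
    Filter.Eventually.of_forall fun _ => by simp⟩

theorem add (h : A.FamAt I d f p) (h' : A.FamAt I d f' p) : A.FamAt I d (fun z => f z + f' z) p := by
  obtain ⟨κ, _, a, g, hg, ha, hs⟩ := h
  obtain ⟨κ', _, a', g', hg', ha', hs'⟩ := h'
  refine ⟨κ ⊕ κ', inferInstance, Sum.elim a a', Sum.elim g g', ?_, ?_, ?_⟩
  · rintro (i | i)
    exacts [hg i, hg' i]
  · rintro (i | i)
    exacts [ha i, ha' i]
  · filter_upwards [hs, hs'] with z h1 h2
    simp [h1, h2]

theorem smul {c : Icc (0 : ℝ) 1 × X → 𝕜}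
    (hc : ∀ᶠ z in 𝓝 p, ContMDiffAt ((𝓡∂ 1).prod I) 𝓘(ℝ, 𝕜) ∞ c z) (h : A.FamAt I d f p) :
    A.FamAt I d (fun z => c z • f z) p := by
  obtain ⟨κ, _, a, g, hg, ha, hs⟩ := h
  refine ⟨κ, inferInstance, fun i z => c z * a i z, g, hg, fun i => ?_, ?_⟩
  · filter_upwards [hc, ha i] with z h1 h2
    exact contMDiffAt_mul h1 h2
  · filter_upwards [hs] with z h1
    simp only [h1, Finset.smul_sum, mul_smul]

theorem sum {κ : Type*} (s : Finset κ) {f : κ → (p : Icc (0 : ℝ) 1 × X) → A.fib p.2}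
    (h : ∀ i ∈ s, A.FamAt I d (f i) p) : A.FamAt I d (fun z => ∑ i ∈ s, f i z) p := by
  classical
  induction s using Finset.induction_on with
  | empty => simpa using zero
  | insert i s hi ih =>
    simp only [Finset.sum_insert hi]
    exact (h i (by simp)).add (ih fun j hj => h j (by simp [hj]))

end FamAt

/-- Extension by zero replaces sections over varying open sets by functions on the whole space, and
all shrinking of neighbourhoods is left to filters. The finitely many germs involved have a common
domain. -/
theorem isFamily_iff (hA : A.Restricts) {W : Opens (Icc (0 : ℝ) 1 × X)} {f : (p : W) → A.fib p.1.2} :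
    A.IsFamily I W d f ↔
      ∀ p ∈ W, A.FamAt I d (extend (F := fun p : Icc (0 : ℝ) 1 × X => A.fib p.2) W f) p := by
  constructor
  · intro h p hp
    obtain ⟨W', V, hW, hV, hpW, r, a, g, ha, hg, hs⟩ := h ⟨p, hp⟩
    refine ⟨Fin r, inferInstance, fun i => extend W' (a i), fun i => extend V (g i), fun i => ?_,
      fun i => ?_, ?_⟩
    · exact ⟨V, hV p hpW, by rw [restrict_extend]; exact hg i⟩
    · refine Filter.eventually_of_mem (W'.isOpen.mem_nhds hpW) fun z hz => ?_
      have := (ha i) ⟨z, hz⟩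
      rw [← restrict_extend (F := fun _ => 𝕜) (a i)] at this
      exact contMDiffAt_subtype_iff.1 this
    · refine Filter.eventually_of_mem (W'.isOpen.mem_nhds hpW) fun z hz => ?_
      rw [extend_of_mem _ (hW hz), hs ⟨z, hz⟩]
      refine Finset.sum_congr rfl fun i _ => ?_
      simp only [extend_of_mem _ hz, extend_of_mem _ (hV z hz)]
  · intro h p
    obtain ⟨κ, _, a, g, hg, ha, hs⟩ := h p.1 p.2
    obtain ⟨V, hpV, -, hgV⟩ := hA.funAt_nhds_forall hg Filter.univ_mem
    have hev : ∀ᶠ z in 𝓝 p.1, z ∈ W ∧ z.2 ∈ V ∧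
        (∀ i, ContMDiffAt ((𝓡∂ 1).prod I) 𝓘(ℝ, 𝕜) ∞ (a i) z) ∧
        extend (F := fun p : Icc (0 : ℝ) 1 × X => A.fib p.2) W f z = ∑ i, a i z • g i z.2 := by
      filter_upwards [W.isOpen.mem_nhds p.2,
        continuousAt_snd.preimage_mem_nhds (V.isOpen.mem_nhds hpV), Filter.eventually_all.2 ha, hs]
        with z h1 h2 h3 h4 using ⟨h1, h2, h3, h4⟩
    obtain ⟨W', hW', hopen, hpW'⟩ := mem_nhds_iff.1 hev
    refine ⟨⟨W', hopen⟩, V, fun z hz => (hW' hz).1, fun z hz => (hW' hz).2.1, hpW',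
      Fintype.card κ, fun i z => a ((Fintype.equivFin κ).symm i) z,
      fun i x => g ((Fintype.equivFin κ).symm i) x, fun i z => ?_, fun i => hgV _, fun z => ?_⟩
    · exact contMDiffAt_subtype_iff.2 ((hW' z.2).2.2.1 _)
    · have := (hW' z.2).2.2.2
      rw [extend_of_mem _ (hW' z.2).1] at this
      rw [this]
      exact ((Fintype.equivFin κ).symm.sum_comp fun i => a i z • g i z.1.2).symm

theorem isFamily_res (hA : A.Restricts) {W W' : Opens (Icc (0 : ℝ) 1 × X)} (h : W' ≤ W)
    {f : (p : W) → A.fib p.1.2} (hf : A.IsFamily I W d f) :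
    A.IsFamily I W' d (fun p => f ⟨p.1, h p.2⟩) := by
  rw [isFamily_iff hA] at hf ⊢
  refine fun p hp => (hf p (h hp)).congr ?_
  refine Filter.eventually_of_mem (W'.isOpen.mem_nhds hp) fun z hz => ?_
  rw [extend_of_mem _ hz, extend_of_mem _ (h hz)]

theorem T1_restricts (hA : A.Restricts) : (A.T1 I).Restricts := fun _ _ h _ _ hf =>
  ⟨isFamily_res hA h hf.1, isFamily_res hA h hf.2⟩

theorem isFamily_of_famAt (hA : A.Restricts) {W : Opens (Icc (0 : ℝ) 1 × X)}
    {f : (p : Icc (0 : ℝ) 1 × X) → A.fib p.2} (h : ∀ p ∈ W, A.FamAt I d f p) :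
    A.IsFamily I W d (fun p => f p.1) := by
  rw [isFamily_iff hA]
  refine fun p hp => (h p hp).congr ?_
  exact Filter.eventually_of_mem (W.isOpen.mem_nhds hp) fun z hz => extend_of_mem _ hz

theorem famAt_of_isFamily (hA : A.Restricts) {W : Opens (Icc (0 : ℝ) 1 × X)}
    {f : (p : Icc (0 : ℝ) 1 × X) → A.fib p.2} (h : A.IsFamily I W d (fun p => f p.1))
    {p : Icc (0 : ℝ) 1 × X} (hp : p ∈ W) : A.FamAt I d f p := by
  rw [isFamily_iff hA] at h
  refine (h p hp).congr ?_
  exact Filter.eventually_of_mem (W.isOpen.mem_nhds hp) fun z hz =>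
    (extend_of_mem (F := fun p : Icc (0 : ℝ) 1 × X => A.fib p.2) (fun p : W => f p.1) hz).symm

/-- The part of degree `d` of the fibre of the algebra of functions. -/
def homog (A : QSpace 𝕜 X) (d : ℤ) (x : X) : Submodule 𝕜 (A.fib x) :=
  Submodule.span 𝕜 {v | ∃ g : (x : X) → A.fib x, A.FunAt d g x ∧ g x = v}

theorem FunAt.mem_homog {g : (x : X) → A.fib x} {x : X} (h : A.FunAt d g x) : g x ∈ A.homog d x :=
  Submodule.subset_span ⟨g, h, rfl⟩

theorem FamAt.mem_homog {f : (p : Icc (0 : ℝ) 1 × X) → A.fib p.2} {p : Icc (0 : ℝ) 1 × X}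
    (h : A.FamAt I d f p) : f p ∈ A.homog d p.2 := by
  obtain ⟨κ, _, a, g, hg, ha, hs⟩ := h
  rw [hs.self_of_nhds]
  exact Submodule.sum_mem _ fun i _ => Submodule.smul_mem _ _ (hg i).mem_homog

namespace IsNQManifold

variable (hA : A.IsNQManifold I)

include hA

theorem restricts : A.Restricts := hA.res_mem

theorem one_mem_homog (x : X) : 1 ∈ A.homog 0 x :=
  FunAt.mem_homog (g := fun _ => 1) ⟨⊤, trivial, hA.one_mem ⊤⟩

theorem funAt_mul {g h : (x : X) → A.fib x} {x : X} (hg : A.FunAt d g x) (hh : A.FunAt e h x) :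
    A.FunAt (d + e) (fun x => g x * h x) x := by
  obtain ⟨V, hxV, -, hV⟩ := hA.restricts.funAt_nhds hg Filter.univ_mem
  obtain ⟨W, hxW, -, hW⟩ := hA.restricts.funAt_nhds hh Filter.univ_mem
  exact ⟨V ⊓ W, ⟨hxV, hxW⟩, hA.mul_mem _ d e _ _ (hV _ inf_le_left) (hW _ inf_le_right)⟩

theorem funAt_add {g h : (x : X) → A.fib x} {x : X} (hg : A.FunAt d g x) (hh : A.FunAt d h x) :
    A.FunAt d (fun x => g x + h x) x := by
  obtain ⟨V, hxV, -, hV⟩ := hA.restricts.funAt_nhds hg Filter.univ_mem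
  obtain ⟨W, hxW, -, hW⟩ := hA.restricts.funAt_nhds hh Filter.univ_mem
  exact ⟨V ⊓ W, ⟨hxV, hxW⟩, hA.add_mem _ d _ _ (hV _ inf_le_left) (hW _ inf_le_right)⟩

theorem mul_mem_homog {x : X} {v w : A.fib x} (hv : v ∈ A.homog d x) (hw : w ∈ A.homog e x) :
    v * w ∈ A.homog (d + e) x := by
  refine Submodule.mul_le.1 ?_ v hv w hw
  rw [homog, homog, Submodule.span_mul_span, Submodule.span_le]
  rintro _ ⟨_, ⟨g, hg, rfl⟩, _, ⟨h, hh, rfl⟩, rfl⟩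
  exact (hA.funAt_mul hg hh).mem_homog

/-- In coordinates around `x`, every value of a function of degree `d` is a combination of the
finitely many monomials of that degree. -/
theorem finiteDimensional_homog (d : ℤ) (x : X) : FiniteDimensional 𝕜 (A.homog d x) := by
  obtain ⟨V, m, deg, ξ, hx, hξ⟩ := hA.coords x
  classical
  let T : Set (A.fib x) := ((exponents deg d).image fun n => monomial (fun j => ξ j ⟨x, hx⟩) n : Finset _)
  have hT : FiniteDimensional 𝕜 (Submodule.span 𝕜 T) := FiniteDimensional.span_finset 𝕜 _
  refine Submodule.finiteDimensional_of_le (S₂ := Submodule.span 𝕜 T) ?_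
  rw [homog, Submodule.span_le]
  rintro _ ⟨g, hg, rfl⟩
  obtain ⟨W, hxW, hWV, hW⟩ := hA.restricts.funAt_nhds hg (V.isOpen.mem_nhds hx)
  obtain ⟨a, -, ha⟩ := (hξ.fun_iff W hWV d _).1 (hW W le_rfl)
  have := ha ⟨x, hxW⟩
  simp only at this
  rw [SetLike.mem_coe, this]
  exact Submodule.sum_mem _ fun n hn => Submodule.smul_mem _ _
    (Submodule.subset_span (Finset.mem_coe.2 (Finset.mem_image_of_mem _ hn)))

/-- The axiom `smul_mem` concerns constants only; for a smooth factor the coefficients in local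
coordinates are multiplied. -/
theorem funAt_smul {c : X → 𝕜} {g : (x : X) → A.fib x} {x : X}
    (hc : ∀ᶠ y in 𝓝 x, ContMDiffAt I 𝓘(ℝ, 𝕜) ∞ c y) (hg : A.FunAt d g x) :
    A.FunAt d (fun y => c y • g y) x := by
  obtain ⟨V, m, deg, ξ, hx, hξ⟩ := hA.coords x
  obtain ⟨W, hxW, hWV, hW⟩ := hA.restricts.funAt_nhds hg
    (Filter.inter_mem (V.isOpen.mem_nhds hx) hc)
  have hWV' : W ≤ V := fun y hy => (hWV hy).1
  obtain ⟨a, ha, hs⟩ := (hξ.fun_iff W hWV' d _).1 (hW W le_rfl)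
  refine ⟨W, hxW, (hξ.fun_iff W hWV' d _).2 ⟨fun n y => c y * a n y, fun n y => ?_, fun y => ?_⟩⟩
  · have : ContMDiffAt I 𝓘(ℝ, 𝕜) ∞ (fun y : W => c y) y := contMDiffAt_subtype_iff.2 (hWV y.2).2
    exact contMDiffAt_mul this (ha n y)
  · simp only [hs y, Finset.smul_sum, mul_smul]

theorem mem_fun_of_funAt {U : Opens X} {g : (x : X) → A.fib x} (h : ∀ x ∈ U, A.FunAt d g x) :
    (fun x : U => g x) ∈ A.Fun U d := by
  refine hA.glue U d _ fun x => ?_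
  obtain ⟨V, hxV, hVU, hV⟩ := hA.restricts.funAt_nhds (h x x.2) (U.isOpen.mem_nhds x.2)
  exact ⟨V, hVU, hxV, hV V le_rfl⟩

/-- Freezing `t` turns the coefficients of a family into smooth functions on the body. This makes
the algebraic laws of `q`, valid on functions only, available on slices. -/
theorem funAt_slice {f : (p : Icc (0 : ℝ) 1 × X) → A.fib p.2} {t : Icc (0 : ℝ) 1} {x : X}
    (h : A.FamAt I d f (t, x)) : A.FunAt d (fun y => f (t, y)) x := by
  obtain ⟨κ, _, a, g, hg, ha, hs⟩ := h
  have hcont : Filter.Tendsto (fun y : X => (t, y)) (𝓝 x) (𝓝 (t, x)) :=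
    (by fun_prop : Continuous fun y : X => (t, y)).continuousAt
  have hsum : ∀ s : Finset κ, A.FunAt d (fun y => ∑ i ∈ s, a i (t, y) • g i y) x := by
    classical
    intro s
    induction s using Finset.induction_on with
    | empty => simpa using ⟨⊤, trivial, hA.zero_mem ⊤ d⟩
    | insert i s hi ih =>
      simp only [Finset.sum_insert hi]
      refine hA.funAt_add (hA.funAt_smul ?_ (hg i)) ih
      filter_upwards [hcont.eventually (ha i)] with y hy
      exact hy.comp y (contMDiffAt_const.prodMk contMDiffAt_id)
  obtain ⟨V, hxV, hVU, hV⟩ := hA.restricts.funAt_nhds (hsum Finset.univ) (hcont.eventually hs)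
  refine ⟨V, hxV, ?_⟩
  convert! hV V le_rfl using 1
  funext y
  exact hVU y.2

end IsNQManifold

end QSpace

end NQ

end

/-! ### Smoothness of families -/

noncomputable section

namespace NQ

open scoped Topology

/-! ### Smooth functions of parameters in the closed interval -/

section Interval

variable {𝕜 : Type*} [RCLike 𝕜] {X : Type*} [TopologicalSpace X]
  {E₀ H₀ : Type*} [NormedAddCommGroup E₀] [NormedSpace ℝ E₀] [TopologicalSpace H₀]
  {I : ModelWithCorners ℝ E₀ H₀} [ChartedSpace H₀ X]

theorem continuous_pt : Continuous pt := continuous_projIcc (h := zero_le_one)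

theorem coe_pt {t : ℝ} (ht : t ∈ Icc (0 : ℝ) 1) : (pt t : ℝ) = t := by
  rw [pt, projIcc_of_mem _ ht]

theorem pt_coe (t : Icc (0 : ℝ) 1) : pt t = t := projIcc_val _ t

theorem contMDiffWithinAt_pt {t : ℝ} (ht : t ∈ Icc (0 : ℝ) 1) :
    ContMDiffWithinAt 𝓘(ℝ, ℝ) (𝓡∂ 1) ∞ pt (Icc 0 1) t :=
  contMDiffOn_projIcc t ht

theorem contDiffWithinAt_comp_pt {c : Icc (0 : ℝ) 1 × X → 𝕜} {t : ℝ} (ht : t ∈ Icc (0 : ℝ) 1) {x : X}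
    (hc : ContMDiffAt ((𝓡∂ 1).prod I) 𝓘(ℝ, 𝕜) ∞ c (pt t, x)) :
    ContDiffWithinAt ℝ ∞ (fun s => c (pt s, x)) (Icc 0 1) t :=
  contMDiffWithinAt_iff_contDiffWithinAt.1
    (hc.comp_contMDiffWithinAt t ((contMDiffWithinAt_pt ht).prodMk contMDiffWithinAt_const))

theorem contDiffWithinAt_comp_pt_pt {c : Icc (0 : ℝ) 1 × Icc (0 : ℝ) 1 × X → 𝕜} {s t : ℝ}
    (hs : s ∈ Icc (0 : ℝ) 1) (ht : t ∈ Icc (0 : ℝ) 1) {x : X}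
    (hc : ContMDiffAt ((𝓡∂ 1).prod ((𝓡∂ 1).prod I)) 𝓘(ℝ, 𝕜) ∞ c (pt s, pt t, x)) :
    ContDiffWithinAt ℝ ∞ (fun p : ℝ × ℝ => c (pt p.1, pt p.2, x)) (Icc 0 1 ×ˢ Icc 0 1) (s, t) := by
  have h1 : ContMDiffWithinAt 𝓘(ℝ, ℝ × ℝ) (𝓡∂ 1) ∞ (fun p : ℝ × ℝ => pt p.1)
      (Icc 0 1 ×ˢ Icc 0 1) (s, t) :=
    ContMDiffWithinAt.comp (s, t) (g := pt) (contMDiffWithinAt_pt hs)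
      contDiff_fst.contMDiff.contMDiffAt.contMDiffWithinAt fun p hp => hp.1
  have h2 : ContMDiffWithinAt 𝓘(ℝ, ℝ × ℝ) (𝓡∂ 1) ∞ (fun p : ℝ × ℝ => pt p.2)
      (Icc 0 1 ×ˢ Icc 0 1) (s, t) :=
    ContMDiffWithinAt.comp (s, t) (g := pt) (contMDiffWithinAt_pt ht)
      contDiff_snd.contMDiff.contMDiffAt.contMDiffWithinAt fun p hp => hp.2
  exact contMDiffWithinAt_iff_contDiffWithinAt.1
    (hc.comp_contMDiffWithinAt (s, t) (h1.prodMk (h2.prodMk contMDiffWithinAt_const)))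

/-- A smooth function on the unit square, as a function of the parameters of a homotopy. -/
theorem contMDiff_of_square {F : Type*} [NormedAddCommGroup F] [NormedSpace ℝ F] {Φ : ℝ × ℝ → F}
    (hΦ : ContDiffOn ℝ ∞ Φ (Icc 0 1 ×ˢ Icc 0 1)) :
    ContMDiff ((𝓡∂ 1).prod ((𝓡∂ 1).prod I)) 𝓘(ℝ, F) ∞
      (fun z : Icc (0 : ℝ) 1 × Icc (0 : ℝ) 1 × X => Φ (z.2.1, z.1)) := by
  have h1 : ContMDiff ((𝓡∂ 1).prod ((𝓡∂ 1).prod I)) 𝓘(ℝ, ℝ) ∞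
      (fun z : Icc (0 : ℝ) 1 × Icc (0 : ℝ) 1 × X => (z.1 : ℝ)) :=
    contMDiff_subtypeVal_Icc.comp contMDiff_fst
  have h2 : ContMDiff ((𝓡∂ 1).prod ((𝓡∂ 1).prod I)) 𝓘(ℝ, ℝ) ∞
      (fun z : Icc (0 : ℝ) 1 × Icc (0 : ℝ) 1 × X => (z.2.1 : ℝ)) :=
    contMDiff_subtypeVal_Icc.comp (contMDiff_fst.comp contMDiff_snd)
  exact (contMDiffOn_iff_contDiffOn.2 hΦ).comp_contMDiff (h2.prodMk_space h1)
    fun z => ⟨z.2.1.2, z.1.2⟩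

theorem contMDiff_pt_of_square {Φ : ℝ × ℝ → ℝ} (hΦ : ContDiffOn ℝ ∞ Φ (Icc 0 1 ×ˢ Icc 0 1))
    (hm : MapsTo Φ (Icc 0 1 ×ˢ Icc 0 1) (Icc 0 1)) :
    ContMDiff ((𝓡∂ 1).prod ((𝓡∂ 1).prod I)) (𝓡∂ 1) ∞
      (fun z : Icc (0 : ℝ) 1 × Icc (0 : ℝ) 1 × X => pt (Φ (z.2.1, z.1))) := by
  have h := contMDiff_of_square (X := X) (I := I) hΦ
  refine contMDiff_iff_comp_subtypeVal_Icc.2 ⟨continuous_pt.comp h.continuous, ?_⟩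
  convert! h using 1
  funext z
  exact coe_pt (hm ⟨z.2.1.2, z.1.2⟩)

end Interval

namespace QSpace

variable {𝕜 : Type*} [RCLike 𝕜] {X : Type*} [TopologicalSpace X]
  {E₀ H₀ : Type*} [NormedAddCommGroup E₀] [NormedSpace ℝ E₀] [TopologicalSpace H₀]
  {A : QSpace 𝕜 X} {I : ModelWithCorners ℝ E₀ H₀} [ChartedSpace H₀ X] {d e : ℤ}

theorem FamAt.contDiffWithinAt {f : (p : Icc (0 : ℝ) 1 × X) → A.fib p.2} {t : ℝ}
    (ht : t ∈ Icc (0 : ℝ) 1) {x : X} (h : A.FamAt I d f (pt t, x)) (ℓ : Module.Dual 𝕜 (A.fib x)) :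
    ContDiffWithinAt ℝ ∞ (fun s => ℓ (f (pt s, x))) (Icc 0 1) t := by
  obtain ⟨κ, _, a, g, hg, ha, hs⟩ := h
  have hcont : Filter.Tendsto (fun s : ℝ => (pt s, x)) (𝓝 t) (𝓝 (pt t, x)) :=
    (continuous_pt.prodMk continuous_const).continuousAt
  have hev : ∀ᶠ s in 𝓝 t, ℓ (f (pt s, x)) = ∑ i, a i (pt s, x) * ℓ (g i x) := by
    filter_upwards [hcont.eventually hs] with s hs
    simp [hs]
  refine ContDiffWithinAt.congr_of_eventuallyEq (f := fun s => ∑ i, a i (pt s, x) * ℓ (g i x)) ?_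
    (hev.filter_mono nhdsWithin_le_nhds) hev.self_of_nhds
  exact ContDiffWithinAt.sum fun i _ =>
    (contDiffWithinAt_comp_pt ht (ha i).self_of_nhds).mul contDiffWithinAt_const

/-- Near the point, the family moves in the span of finitely many fixed vectors `g i x`;
differentiating the coefficients yields an actual vector as derivative. -/
theorem FamAt.exists_hasWDeriv {f : (p : Icc (0 : ℝ) 1 × X) → A.fib p.2} {t : ℝ}
    (ht : t ∈ Icc (0 : ℝ) 1) {x : X} (h : A.FamAt I d f (pt t, x)) :
    ∃ v : A.fib x, HasWDeriv 𝕜 (F := A.fib x) (fun s => f (pt s, x)) v t := by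
  obtain ⟨κ, _, a, g, hg, ha, hs⟩ := h
  have hcont : Filter.Tendsto (fun s : ℝ => (pt s, x)) (𝓝 t) (𝓝 (pt t, x)) :=
    (continuous_pt.prodMk continuous_const).continuousAt
  refine ⟨∑ i, derivWithin (fun s => a i (pt s, x)) (Icc 0 1) t • g i x, fun ℓ => ?_⟩
  have hev : ∀ᶠ s in 𝓝 t, ℓ (f (pt s, x)) = ∑ i, a i (pt s, x) * ℓ (g i x) := by
    filter_upwards [hcont.eventually hs] with s hs
    simp [hs]
  refine HasDerivWithinAt.congr_of_eventuallyEq (f := fun s => ∑ i, a i (pt s, x) * ℓ (g i x)) ?_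
    (hev.filter_mono nhdsWithin_le_nhds) hev.self_of_nhds
  simp only [map_sum, map_smul, smul_eq_mul]
  exact HasDerivWithinAt.fun_sum fun i _ =>
    (((contDiffWithinAt_comp_pt ht (ha i).self_of_nhds).differentiableWithinAt
      (by simp)).hasDerivWithinAt).mul_const _

theorem T1_funAt_iff (hA : A.Restricts) {F : (p : Icc (0 : ℝ) 1 × X) → Adj (A.par p.2)}
    {p : Icc (0 : ℝ) 1 × X} : (A.T1 I).FunAt d F p ↔
      A.FamAt I d (fun z => (F z).re) p ∧ A.FamAt I (d - 1) (fun z => (F z).im) p := by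
  constructor
  · rintro ⟨V, hp, h1, h2⟩
    exact ⟨famAt_of_isFamily hA (f := fun z => (F z).re) h1 hp,
      famAt_of_isFamily hA (f := fun z => (F z).im) h2 hp⟩
  · rintro ⟨h1, h2⟩
    obtain ⟨W, hW, hopen, hp⟩ := mem_nhds_iff.1 (h1.eventually.and h2.eventually)
    exact ⟨⟨W, hopen⟩, hp, isFamily_of_famAt (f := fun z => (F z).re) hA fun z hz => (hW hz).1,
      isFamily_of_famAt (f := fun z => (F z).im) hA fun z hz => (hW hz).2⟩

variable {f : (p : Icc (0 : ℝ) 1 × Icc (0 : ℝ) 1 × X) → Adj (A.par p.2.2)}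

variable (A I) in
/-- The `θ`-independent part of a function on `T[1][0,1] × A`. -/
def T1re (p : Icc (0 : ℝ) 1 × X) : (A.T1 I).fib p →ₗ[𝕜] A.fib p.2 where
  toFun := Adj.re
  map_add' _ _ := rfl
  map_smul' _ _ := rfl

variable (A I) in
/-- The `θ`-component of a function on `T[1][0,1] × A`. -/
def T1im (p : Icc (0 : ℝ) 1 × X) : (A.T1 I).fib p →ₗ[𝕜] A.fib p.2 where
  toFun := Adj.im
  map_add' _ _ := rfl
  map_smul' _ _ := rfl

theorem T1_sum_smul_re {κ : Type*} (s : Finset κ) (p : Icc (0 : ℝ) 1 × X) (a : κ → 𝕜)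
    (g : κ → (A.T1 I).fib p) : Adj.re (∑ i ∈ s, a i • g i) = ∑ i ∈ s, a i • Adj.re (g i) :=
  map_sum (T1re A I p) _ _

theorem T1_sum_smul_im {κ : Type*} (s : Finset κ) (p : Icc (0 : ℝ) 1 × X) (a : κ → 𝕜)
    (g : κ → (A.T1 I).fib p) : Adj.im (∑ i ∈ s, a i • g i) = ∑ i ∈ s, a i • Adj.im (g i) :=
  map_sum (T1im A I p) _ _

theorem FamAt.slice (hA : A.Restricts) {s : Icc (0 : ℝ) 1} {p : Icc (0 : ℝ) 1 × X}
    (h : (A.T1 I).FamAt ((𝓡∂ 1).prod I) d f (s, p)) :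
    A.FamAt I d (fun z => (f (s, z)).re) p ∧ A.FamAt I (d - 1) (fun z => (f (s, z)).im) p := by
  obtain ⟨κ, _, a, g, hg, ha, hs⟩ := h
  have hcont : Filter.Tendsto (fun z : Icc (0 : ℝ) 1 × X => (s, z)) (𝓝 p) (𝓝 (s, p)) :=
    (by fun_prop : Continuous fun z : Icc (0 : ℝ) 1 × X => (s, z)).continuousAt
  have ha' : ∀ i, ∀ᶠ z in 𝓝 p, ContMDiffAt ((𝓡∂ 1).prod I) 𝓘(ℝ, 𝕜) ∞ (fun z => a i (s, z)) z := by
    intro i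
    filter_upwards [hcont.eventually (ha i)] with z hz
    exact hz.comp z (contMDiffAt_const.prodMk contMDiffAt_id)
  have hg' := fun i => (T1_funAt_iff hA).1 (hg i)
  constructor
  · refine (FamAt.sum Finset.univ fun i _ => (hg' i).1.smul (ha' i)).congr ?_
    filter_upwards [hcont.eventually hs] with z hz
    rw [hz]
    exact T1_sum_smul_re _ _ _ _
  · refine (FamAt.sum Finset.univ fun i _ => (hg' i).2.smul (ha' i)).congr ?_
    filter_upwards [hcont.eventually hs] with z hz
    rw [hz]
    exact T1_sum_smul_im _ _ _ _

/-- Joint smoothness holds because the coefficients are smooth in `(s,t)`, while the generators are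
themselves families in `t` that do not depend on `s`. -/
theorem FamAt.contDiffWithinAt_im (hA : A.Restricts) {s t : ℝ} (hs : s ∈ Icc (0 : ℝ) 1)
    (ht : t ∈ Icc (0 : ℝ) 1) {x : X} (h : (A.T1 I).FamAt ((𝓡∂ 1).prod I) d f (pt s, pt t, x))
    (ℓ : Module.Dual 𝕜 (A.fib x)) :
    ContDiffWithinAt ℝ ∞ (fun p : ℝ × ℝ => ℓ (f (pt p.1, pt p.2, x)).im)
      (Icc 0 1 ×ˢ Icc 0 1) (s, t) := by
  obtain ⟨κ, _, a, g, hg, ha, he⟩ := h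
  have hcont : Filter.Tendsto (fun p : ℝ × ℝ => (pt p.1, pt p.2, x)) (𝓝 (s, t))
      (𝓝 (pt s, pt t, x)) :=
    ((continuous_pt.comp continuous_fst).prodMk
      ((continuous_pt.comp continuous_snd).prodMk continuous_const)).continuousAt
  have hev : ∀ᶠ p in 𝓝 (s, t), ℓ (f (pt p.1, pt p.2, x)).im =
      ∑ i, a i (pt p.1, pt p.2, x) * ℓ (Adj.im (g i (pt p.2, x))) := by
    filter_upwards [hcont.eventually he] with p hp
    rw [hp]
    refine (congrArg ℓ (T1_sum_smul_im _ _ _ _)).trans ?_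
    simp
  refine ContDiffWithinAt.congr_of_eventuallyEq
    (f := fun p : ℝ × ℝ => ∑ i, a i (pt p.1, pt p.2, x) * ℓ (Adj.im (g i (pt p.2, x)))) ?_
    (hev.filter_mono nhdsWithin_le_nhds) hev.self_of_nhds
  refine ContDiffWithinAt.sum fun i _ =>
    (contDiffWithinAt_comp_pt_pt hs ht (ha i).self_of_nhds).mul ?_
  exact ContDiffWithinAt.comp (s, t) (g := fun t => ℓ (Adj.im (g i (pt t, x)))) (((T1_funAt_iff hA).1 (hg i)).2.contDiffWithinAt ht ℓ)
    contDiffWithinAt_snd fun p hp => hp.2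

variable {τ : Icc (0 : ℝ) 1 × Icc (0 : ℝ) 1 × X → Icc (0 : ℝ) 1}
  {k : (p : Icc (0 : ℝ) 1 × X) → A.fib p.2} {z : Icc (0 : ℝ) 1 × Icc (0 : ℝ) 1 × X}

/-- Under the substitution `t = τ(z)` only the coefficients change: the generators live on `X` and
involve neither parameter. -/
theorem FamAt.lift_re (hA : A.Restricts)
    (hτ : ContMDiff ((𝓡∂ 1).prod ((𝓡∂ 1).prod I)) (𝓡∂ 1) ∞ τ) (h : A.FamAt I d k (τ z, z.2.2)) :
    (A.T1 I).FamAt ((𝓡∂ 1).prod I) d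
      (fun z => (⟨k (τ z, z.2.2), 0⟩ : Adj (A.par z.2.2))) z := by
  obtain ⟨κ, _, a, g, hg, ha, hs⟩ := h
  have hπ : ContMDiff ((𝓡∂ 1).prod ((𝓡∂ 1).prod I)) ((𝓡∂ 1).prod I) ∞
      (fun z : Icc (0 : ℝ) 1 × Icc (0 : ℝ) 1 × X => (τ z, z.2.2)) :=
    hτ.prodMk (contMDiff_snd.comp contMDiff_snd)
  have hcont := hπ.continuous.tendsto z
  refine ⟨κ, inferInstance, fun i z => a i (τ z, z.2.2),
    fun i p => (⟨g i p.2, 0⟩ : Adj (A.par p.2)), fun i => ?_, fun i => ?_, ?_⟩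
  · exact (T1_funAt_iff hA).2 ⟨FamAt.of_funAt (hg i), FamAt.zero⟩
  · filter_upwards [hcont.eventually (ha i)] with z' hz'
    exact hz'.comp z' hπ.contMDiffAt
  · filter_upwards [hcont.eventually hs] with z' hz'
    refine Adj.ext ?_ ?_
    · refine Eq.trans ?_ (T1_sum_smul_re Finset.univ z'.2 _ _).symm
      exact hz'
    · refine Eq.trans ?_ (T1_sum_smul_im Finset.univ z'.2 _ _).symm
      simp

theorem FamAt.lift_im (hA : A.Restricts)
    (hτ : ContMDiff ((𝓡∂ 1).prod ((𝓡∂ 1).prod I)) (𝓡∂ 1) ∞ τ)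
    (h : A.FamAt I (d - 1) k (τ z, z.2.2)) :
    (A.T1 I).FamAt ((𝓡∂ 1).prod I) d
      (fun z => (⟨0, k (τ z, z.2.2)⟩ : Adj (A.par z.2.2))) z := by
  obtain ⟨κ, _, a, g, hg, ha, hs⟩ := h
  have hπ : ContMDiff ((𝓡∂ 1).prod ((𝓡∂ 1).prod I)) ((𝓡∂ 1).prod I) ∞
      (fun z : Icc (0 : ℝ) 1 × Icc (0 : ℝ) 1 × X => (τ z, z.2.2)) :=
    hτ.prodMk (contMDiff_snd.comp contMDiff_snd)
  have hcont := hπ.continuous.tendsto z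
  refine ⟨κ, inferInstance, fun i z => a i (τ z, z.2.2),
    fun i p => (⟨0, g i p.2⟩ : Adj (A.par p.2)), fun i => ?_, fun i => ?_, ?_⟩
  · exact (T1_funAt_iff hA).2 ⟨FamAt.zero, FamAt.of_funAt (hg i)⟩
  · filter_upwards [hcont.eventually (ha i)] with z' hz'
    exact hz'.comp z' hπ.contMDiffAt
  · filter_upwards [hcont.eventually hs] with z' hz'
    refine Adj.ext ?_ ?_
    · refine Eq.trans ?_ (T1_sum_smul_re Finset.univ z'.2 _ _).symm
      simp
    · refine Eq.trans ?_ (T1_sum_smul_im Finset.univ z'.2 _ _).symm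
      exact hz'

end QSpace

end NQ

end

/-! ### Constructions of morphisms -/

noncomputable section

namespace NQ

open scoped Topology

namespace HasWDeriv

variable {𝕜 F : Type*} [RCLike 𝕜] [AddCommGroup F] [Module 𝕜 F] {g g' : ℝ → F} {v : F} {t : ℝ}

theorem congr_of_eqOn (h : HasWDeriv 𝕜 g v t) (ht : t ∈ Icc (0 : ℝ) 1)
    (hg : EqOn g' g (Icc 0 1)) : HasWDeriv 𝕜 g' v t := fun ℓ =>
  (h ℓ).congr (fun s hs => by rw [hg hs]) (by rw [hg ht])

theorem congr_of_eventuallyEq (h : HasWDeriv 𝕜 g v t) (hg : ∀ᶠ s in 𝓝 t, g' s = g s) :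
    HasWDeriv 𝕜 g' v t := fun ℓ =>
  (h ℓ).congr_of_eventuallyEq
    ((hg.mono fun _ hs => congrArg ℓ hs).filter_mono nhdsWithin_le_nhds)
    (congrArg ℓ hg.self_of_nhds)

theorem comp {ρ : ℝ → ℝ} {r : ℝ} (h : HasWDeriv 𝕜 g v (ρ t))
    (hρ : HasDerivWithinAt ρ r (Icc 0 1) t) (hm : MapsTo ρ (Icc 0 1) (Icc 0 1)) :
    HasWDeriv 𝕜 (fun s => g (ρ s)) ((r : 𝕜) • v) t := fun ℓ => by
  rw [map_smul, smul_eq_mul, ← RCLike.real_smul_eq_coe_mul]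
  exact (h ℓ).scomp t hρ hm

theorem smul {c : ℝ → ℝ} {c' : ℝ} (hc : HasDerivWithinAt c c' (Icc 0 1) t) (h : HasWDeriv 𝕜 g v t) :
    HasWDeriv 𝕜 (fun s => (c s : 𝕜) • g s) ((c' : 𝕜) • g t + (c t : 𝕜) • v) t := fun ℓ => by
  simp only [map_add, map_smul, smul_eq_mul, ← RCLike.real_smul_eq_coe_mul]
  exact (hc.smul (h ℓ)).congr_deriv (add_comm _ _)

end HasWDeriv

section AdjFacts

variable {𝕜 F : Type*} [RCLike 𝕜] [Ring F] [Algebra 𝕜 F] {σ : F →ₐ[𝕜] F}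

theorem HasWDeriv.adj {g₁ g₂ : ℝ → F} {v₁ v₂ : F} {t : ℝ} (h₁ : HasWDeriv 𝕜 g₁ v₁ t)
    (h₂ : HasWDeriv 𝕜 g₂ v₂ t) : HasWDeriv 𝕜 (fun s => (⟨g₁ s, g₂ s⟩ : Adj σ)) ⟨v₁, v₂⟩ t := by
  intro ℓ
  let i₁ : F →ₗ[𝕜] Adj σ :=
    { toFun := fun x => ⟨x, 0⟩
      map_add' := fun x y => by ext <;> simp
      map_smul' := fun c x => by ext <;> simp }
  let i₂ : F →ₗ[𝕜] Adj σ :=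
    { toFun := fun x => ⟨0, x⟩
      map_add' := fun x y => by ext <;> simp
      map_smul' := fun c x => by ext <;> simp }
  have h : ∀ x y : F, ℓ ⟨x, y⟩ = (ℓ ∘ₗ i₁) x + (ℓ ∘ₗ i₂) y := fun x y => by
    change _ = ℓ (⟨x, 0⟩ : Adj σ) + ℓ (⟨0, y⟩ : Adj σ)
    rw [← map_add]
    congr 1
    ext <;> simp
  simp only [h]
  exact (h₁ (ℓ ∘ₗ i₁)).add (h₂ (ℓ ∘ₗ i₂))

/-- The substitution `a + θ b ↦ a + θ r b + ϑ r' b`. -/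
def substHom (σ : F →ₐ[𝕜] F) (r r' : 𝕜) : Adj σ →ₐ[𝕜] Adj (Adj.par σ) :=
  AlgHom.ofLinearMap
    { toFun := fun c => ⟨⟨c.re, r • c.im⟩, ⟨r' • c.im, 0⟩⟩
      map_add' := fun x y => by ext <;> simp
      map_smul' := fun c x => by ext <;> simp [smul_smul, mul_comm c] }
    (by ext <;> simp)
    (fun x y => by
      ext
      · simp
      · simp
      · change r' • (x.im * y.re + σ x.re * y.im) = r' • x.im * y.re + σ x.re * r' • y.im
        rw [smul_add, smul_mul_assoc, mul_smul_comm]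
      -- This is the `ϑθ`-component: the two cross terms cancel because `θ` and `ϑ` anticommute,
      -- which is the minus sign in `Adj.par`.
      · change 0 = (0 * y.re + σ (r' • x.im) * r • y.im) +
          (-σ (r • x.im) * r' • y.im + σ (σ x.re) * 0)
        simp [smul_smul, mul_comm])

end AdjFacts

namespace QSpace

variable {𝕜 : Type*} [RCLike 𝕜] {X : Type*} [TopologicalSpace X]
  {E₀ H₀ : Type*} [NormedAddCommGroup E₀] [NormedSpace ℝ E₀] [TopologicalSpace H₀]
  {A : QSpace 𝕜 X} {I : ModelWithCorners ℝ E₀ H₀} [ChartedSpace H₀ X] {d e : ℤ}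
  {Y : Type*} [TopologicalSpace Y] {E₁ H₁ : Type*} [NormedAddCommGroup E₁]
  [NormedSpace ℝ E₁] [TopologicalSpace H₁] {B : QSpace 𝕜 Y} {J : ModelWithCorners ℝ E₁ H₁}
  [ChartedSpace H₁ Y]

theorem q_congr {U V : Opens X} (h : U = V) {f : (x : U) → A.fib x} {g : (x : V) → A.fib x}
    (hfg : ∀ x (hx : x ∈ U) (hx' : x ∈ V), f ⟨x, hx⟩ = g ⟨x, hx'⟩) {x : X} (hx : x ∈ U)
    (hx' : x ∈ V) : A.q U f ⟨x, hx⟩ = A.q V g ⟨x, hx'⟩ := by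
  subst h
  have : f = g := funext fun x => hfg x.1 x.2 x.2
  rw [this]

/-- The extension by zero in the differential of `T1` is harmless: `W` is open, so near `t` the
defining branch is the genuine one. -/
theorem wderiv_extend {W : Opens (Icc (0 : ℝ) 1 × X)} {k : (p : W) → A.fib p.1.2}
    {K : (p : Icc (0 : ℝ) 1 × X) → A.fib p.2} (hK : ∀ p : W, k p = K p.1) {t : Icc (0 : ℝ) 1} {x : X}
    (hp : (t, x) ∈ W) {v : A.fib x} (h : HasWDeriv 𝕜 (F := A.fib x) (fun s => K (pt s, x)) v t) :
    wderiv 𝕜 (F := A.fib x) (fun s => open Classical in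
      if h : (projIcc 0 1 zero_le_one s, x) ∈ W then k ⟨_, h⟩ else 0) t = v := by
  refine HasWDeriv.wderiv_eq (h.congr_of_eventuallyEq ?_) t.2
  have hc : Continuous fun s : ℝ => (pt s, x) := continuous_pt.prodMk continuous_const
  have hW : ∀ᶠ s in 𝓝 (t : ℝ), (pt s, x) ∈ W :=
    hc.continuousAt.preimage_mem_nhds (W.isOpen.mem_nhds (by rw [pt_coe]; exact hp))
  filter_upwards [hW] with s hs
  exact (dif_pos hs).trans (hK ⟨_, hs⟩)

theorem IsNQManifold.q_zero (hA : A.IsNQManifold I) (U : Opens X) : A.q U 0 = 0 := by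
  have := hA.q_smul U 0 0 0 (hA.zero_mem U 0)
  rwa [zero_smul, zero_smul] at this

/-- The pullback of functions, extended by zero. -/
def Hom.ev (C : Hom A I B J) (U : Opens Y) (f : (y : U) → B.fib y) : (x : X) → A.fib x :=
  extend (F := A.fib) (Opens.comap ⟨C.map, C.smooth.continuous⟩ U) (C.pull U f)

section Ev

variable (C : Hom A I B J) {U : Opens Y} {x : X}

theorem Hom.ev_eq (f : (y : U) → B.fib y) (hx : C.map x ∈ U) : C.ev U f x = C.pull U f ⟨x, hx⟩ :=
  extend_of_mem (F := A.fib) (C.pull U f) hx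

theorem Hom.funAt_ev {f : (y : U) → B.fib y} (hf : f ∈ B.Fun U d) (hx : C.map x ∈ U) :
    A.FunAt d (C.ev U f) x :=
  ⟨_, hx, by rw [ev, restrict_extend]; exact C.pull_mem U d f hf⟩

theorem Hom.ev_res {V : Opens Y} (h : V ≤ U) {f : (y : U) → B.fib y} (hf : f ∈ B.Fun U d)
    (hx : C.map x ∈ V) : C.ev V (res h f) x = C.ev U f x := by
  rw [C.ev_eq _ hx, C.ev_eq _ (h hx), C.pull_res U V h d f hf]

theorem Hom.ev_add {f g : (y : U) → B.fib y} (hf : f ∈ B.Fun U d) (hg : g ∈ B.Fun U d)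
    (hx : C.map x ∈ U) : C.ev U (f + g) x = C.ev U f x + C.ev U g x := by
  rw [C.ev_eq _ hx, C.ev_eq _ hx, C.ev_eq _ hx, C.pull_add U d f g hf hg]
  rfl

theorem Hom.ev_smul (c : 𝕜) {f : (y : U) → B.fib y} (hf : f ∈ B.Fun U d)
    (hx : C.map x ∈ U) : C.ev U (c • f) x = c • C.ev U f x := by
  rw [C.ev_eq _ hx, C.ev_eq _ hx, C.pull_smul U d c f hf]
  rfl

theorem Hom.ev_one (hx : C.map x ∈ U) : C.ev U 1 x = 1 := by
  rw [C.ev_eq _ hx, C.pull_one]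
  rfl

theorem Hom.ev_mul {f g : (y : U) → B.fib y} (hf : f ∈ B.Fun U d) (hg : g ∈ B.Fun U e)
    (hx : C.map x ∈ U) : C.ev U (f * g) x = C.ev U f x * C.ev U g x := by
  rw [C.ev_eq _ hx, C.ev_eq _ hx, C.ev_eq _ hx, C.pull_mul U d e f g hf hg]
  rfl

end Ev

/-- `Φ(t,s)` is a family of maps of `[0,1]` into itself with derivatives
`∂_t Φ = Φ₁`, `∂_s Φ = ε Φ₁`, `∂_s Φ₁ = μ = ∂_t (ε Φ₁)`. -/
structure IsFlow (Φ Φ₁ ε μ : ℝ × ℝ → ℝ) : Prop where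
  smooth : ContDiffOn ℝ ∞ Φ (Icc 0 1 ×ˢ Icc 0 1)
  smooth₁ : ContDiffOn ℝ ∞ Φ₁ (Icc 0 1 ×ˢ Icc 0 1)
  smooth_field : ContDiffOn ℝ ∞ ε (Icc 0 1 ×ˢ Icc 0 1)
  mapsTo : MapsTo Φ (Icc 0 1 ×ˢ Icc 0 1) (Icc 0 1)
  deriv_t : ∀ t ∈ Icc (0 : ℝ) 1, ∀ s ∈ Icc (0 : ℝ) 1,
    HasDerivWithinAt (fun t => Φ (t, s)) (Φ₁ (t, s)) (Icc 0 1) t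
  deriv_s : ∀ t ∈ Icc (0 : ℝ) 1, ∀ s ∈ Icc (0 : ℝ) 1,
    HasDerivWithinAt (fun s => Φ (t, s)) (ε (t, s) * Φ₁ (t, s)) (Icc 0 1) s
  deriv_s₁ : ∀ t ∈ Icc (0 : ℝ) 1, ∀ s ∈ Icc (0 : ℝ) 1,
    HasDerivWithinAt (fun s => Φ₁ (t, s)) (μ (t, s)) (Icc 0 1) s
  deriv_t₁ : ∀ t ∈ Icc (0 : ℝ) 1, ∀ s ∈ Icc (0 : ℝ) 1,
    HasDerivWithinAt (fun t => ε (t, s) * Φ₁ (t, s)) (μ (t, s)) (Icc 0 1) t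

/-- The point of `[0,1] × X` at which a homotopy along a flow evaluates. -/
def flowPt (Φ : ℝ × ℝ → ℝ) (z : Icc (0 : ℝ) 1 × Icc (0 : ℝ) 1 × X) : Icc (0 : ℝ) 1 × X :=
  (pt (Φ (z.2.1, z.1)), z.2.2)

theorem IsFlow.contMDiff_flowPt {Φ Φ₁ ε μ : ℝ × ℝ → ℝ} (hΦ : IsFlow Φ Φ₁ ε μ) :
    ContMDiff ((𝓡∂ 1).prod ((𝓡∂ 1).prod I)) ((𝓡∂ 1).prod I) ∞ (flowPt (X := X) Φ) :=
  (contMDiff_pt_of_square hΦ.smooth hΦ.mapsTo).prodMk (contMDiff_snd.comp contMDiff_snd)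

theorem contMDiff_ofReal_square {Ψ : ℝ × ℝ → ℝ} (h : ContDiffOn ℝ ∞ Ψ (Icc 0 1 ×ˢ Icc 0 1)) :
    ContMDiff ((𝓡∂ 1).prod ((𝓡∂ 1).prod I)) 𝓘(ℝ, 𝕜) ∞
      (fun z : Icc (0 : ℝ) 1 × Icc (0 : ℝ) 1 × X => ((Ψ (z.2.1, z.1) : ℝ) : 𝕜)) :=
  contMDiff_of_square (Φ := fun p => ((Ψ p : ℝ) : 𝕜))
    ((RCLike.ofRealCLM (K := 𝕜)).contDiff.comp_contDiffOn h)

end QSpace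

end NQ

end

/-! ### Homotopies generated by reparametrizations -/

noncomputable section

namespace NQ

open scoped Topology

namespace QSpace

variable {𝕜 : Type*} [RCLike 𝕜] {X : Type*} [TopologicalSpace X]
  {E₀ H₀ : Type*} [NormedAddCommGroup E₀] [NormedSpace ℝ E₀] [TopologicalSpace H₀]
  {A : QSpace 𝕜 X} {I : ModelWithCorners ℝ E₀ H₀} [ChartedSpace H₀ X] {d e : ℤ}
  {Y : Type*} [TopologicalSpace Y] {E₁ H₁ : Type*} [NormedAddCommGroup E₁]
  [NormedSpace ℝ E₁] [TopologicalSpace H₁] {B : QSpace 𝕜 Y} {J : ModelWithCorners ℝ E₁ H₁}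
  [ChartedSpace H₁ Y] {Φ Φ₁ ε μ : ℝ × ℝ → ℝ}

/-- The pullback of functions along a homotopy generated by a flow. -/
def flowPull (C : Hom (A.T1 I) ((𝓡∂ 1).prod I) B J) (Φ Φ₁ ε : ℝ × ℝ → ℝ) (U : Opens Y)
    (f : (y : U) → B.fib y) (z : Icc (0 : ℝ) 1 × Icc (0 : ℝ) 1 × X) :
    Adj (Adj.par (A.par z.2.2)) :=
  substHom (A.par z.2.2) (Φ₁ (z.2.1, z.1) : ℝ) ((ε (z.2.1, z.1) * Φ₁ (z.2.1, z.1) : ℝ) : 𝕜)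
    (C.ev U f (flowPt Φ z))

theorem flowPull_mem (hA : A.IsNQManifold I) (C : Hom (A.T1 I) ((𝓡∂ 1).prod I) B J)
    (hΦ : IsFlow Φ Φ₁ ε μ) {U : Opens Y} {f : (y : U) → B.fib y} (hf : f ∈ B.Fun U d)
    (W : Opens (Icc (0 : ℝ) 1 × Icc (0 : ℝ) 1 × X)) (hW : ∀ z ∈ W, C.map (flowPt Φ z) ∈ U) :
    (fun z : W => flowPull C Φ Φ₁ ε U f z) ∈
      ((A.T1 I).T1 ((𝓡∂ 1).prod I)).Fun W d := by
  have hR := hA.restricts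
  have hτ := contMDiff_pt_of_square (X := X) (I := I) hΦ.smooth hΦ.mapsTo
  have hev : ∀ z ∈ W, _ := fun z hz => (T1_funAt_iff hR).1 (C.funAt_ev hf (hW z hz))
  constructor
  · refine isFamily_of_famAt (T1_restricts hR) (f := fun z => (flowPull C Φ Φ₁ ε U f z).re)
      fun z hz => ?_
    refine ((FamAt.lift_re hR hτ (hev z hz).1).add ((FamAt.lift_im hR hτ (hev z hz).2).smul
      (Filter.Eventually.of_forall (contMDiff_ofReal_square (I := I) hΦ.smooth₁)))).congr
      (Filter.Eventually.of_forall fun z => ?_)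
    refine Adj.ext ?_ ?_
    · change _ = _ + _ • (0 : A.fib z.2.2)
      rw [smul_zero, add_zero]
      rfl
    · change _ = (0 : A.fib z.2.2) + _
      rw [zero_add]
      rfl
  · refine isFamily_of_famAt (T1_restricts hR) (f := fun z => (flowPull C Φ Φ₁ ε U f z).im)
      fun z hz => ?_
    refine ((FamAt.lift_re hR hτ (hev z hz).2).smul (Filter.Eventually.of_forall
      (contMDiff_ofReal_square (I := I) (hΦ.smooth_field.mul hΦ.smooth₁)))).congr
      (Filter.Eventually.of_forall fun z => ?_)
    refine Adj.ext ?_ ?_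
    · rfl
    · change (0 : A.fib z.2.2) = _ • (0 : A.fib z.2.2)
      rw [smul_zero]

/-- The components `1`, `θ`, `ϑ`, `ϑθ` are compared. The first is `q` on a slice; the next two are
the chain rule with `∂_t Φ = Φ₁` and `∂_s Φ = ε Φ₁`; the last vanishes because `∂_s Φ₁` and `∂_t (ε
Φ₁)` are the same function `μ`. -/
theorem flowPull_q (hA : A.IsNQManifold I) (C : Hom (A.T1 I) ((𝓡∂ 1).prod I) B J)
    (hΦ : IsFlow Φ Φ₁ ε μ) {U : Opens Y} {f : (y : U) → B.fib y} (hf : f ∈ B.Fun U d)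
    (W : Opens (Icc (0 : ℝ) 1 × Icc (0 : ℝ) 1 × X)) (hW : ∀ z, z ∈ W ↔ C.map (flowPt Φ z) ∈ U)
    (z : W) : flowPull C Φ Φ₁ ε U (B.q U f) z =
      ((A.T1 I).T1 ((𝓡∂ 1).prod I)).q W (fun z => flowPull C Φ Φ₁ ε U f z) z := by
  obtain ⟨⟨s, t, y⟩, hz⟩ := z
  have hR := hA.restricts
  set WC : Opens (Icc (0 : ℝ) 1 × X) := Opens.comap ⟨C.map, C.smooth.continuous⟩ U with hWC
  set r : ℝ := Φ (t, s) with hr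
  have hrI : r ∈ Icc (0 : ℝ) 1 := hΦ.mapsTo ⟨t.2, s.2⟩
  have hp : C.map (pt r, y) ∈ U := (hW _).1 hz
  let a : (p : Icc (0 : ℝ) 1 × X) → A.fib p.2 := fun p => (C.ev U f p).re
  let b : (p : Icc (0 : ℝ) 1 × X) → A.fib p.2 := fun p => (C.ev U f p).im
  have hab : ∀ p, C.map p ∈ U → A.FamAt I d a p ∧ A.FamAt I (d - 1) b p := fun p hp =>
    (T1_funAt_iff hR).1 (C.funAt_ev hf hp)
  obtain ⟨va, hva⟩ := (hab _ hp).1.exists_hasWDeriv hrI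
  obtain ⟨vb, hvb⟩ := (hab _ hp).2.exists_hasWDeriv hrI
  let S : Opens X := slice WC (pt r)
  have hyS : y ∈ S := hp
  have hbS : (fun x : S => b (pt r, x)) ∈ A.Fun S (d - 1) :=
    hA.mem_fun_of_funAt (g := fun x => b (pt r, x)) fun x hx => hA.funAt_slice (hab _ hx).2
  -- the differential of the pullback along `C`
  have hq : C.ev U (B.q U f) (pt r, y) =
      (⟨A.q S (fun x => a (pt r, x)) ⟨y, hyS⟩, va - A.q S (fun x => b (pt r, x)) ⟨y, hyS⟩⟩ :
        Adj (A.par y)) := by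
    rw [C.ev_eq _ hp, C.pull_q U d f hf]
    refine Adj.ext ?_ (congrArg₂ (· - ·) ?_ ?_)
    · exact q_congr rfl (fun x hx hx' => congrArg Adj.re (C.ev_eq f hx).symm) _ _
    · exact wderiv_extend (K := a) (fun p => congrArg Adj.re (C.ev_eq f p.2).symm) hp
        (by rwa [coe_pt hrI])
    · exact q_congr rfl (fun x hx hx' => congrArg Adj.im (C.ev_eq f hx).symm) _ _
  -- At fixed `(t,s)` the factors `Φ₁` and `ε Φ₁` are constants along the slice, so `q` passes them;
  -- this needs `hbS`, since `q` is linear on functions of a given degree only.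
  have hqs : ∀ c : 𝕜, A.q S (fun x => c • b (pt r, x)) ⟨y, hyS⟩ =
      c • A.q S (fun x => b (pt r, x)) ⟨y, hyS⟩ := fun c =>
    congrFun (hA.q_smul S (d - 1) c _ hbS) ⟨y, hyS⟩
  -- derivatives along the flow
  have ht := t.2
  have hs := s.2
  have hmt : MapsTo (fun t' => Φ (t', s)) (Icc 0 1) (Icc 0 1) := fun t' ht' => hΦ.mapsTo ⟨ht', hs⟩
  have hms : MapsTo (fun s' => Φ (t, s')) (Icc 0 1) (Icc 0 1) := fun s' hs' => hΦ.mapsTo ⟨ht, hs'⟩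
  have hat := HasWDeriv.comp (ρ := fun t' => Φ (t', s)) hva (hΦ.deriv_t t ht s hs) hmt
  have has := HasWDeriv.comp (ρ := fun s' => Φ (t, s')) hva (hΦ.deriv_s t ht s hs) hms
  have hbt := HasWDeriv.comp (ρ := fun t' => Φ (t', s)) hvb (hΦ.deriv_t t ht s hs) hmt
  have hbs := HasWDeriv.comp (ρ := fun s' => Φ (t, s')) hvb (hΦ.deriv_s t ht s hs) hms
  have hbs' := HasWDeriv.smul (hΦ.deriv_s₁ t ht s hs) hbs
  have hbt' := HasWDeriv.smul (hΦ.deriv_t₁ t ht s hs) hbt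
  let P := flowPull C Φ Φ₁ ε U f
  have hS : S = slice (slice W s) t := by
    ext x
    exact (hW (s, t, x)).symm
  have hpt : ∀ r' ∈ Icc (0 : ℝ) 1, ((pt r' : Icc (0 : ℝ) 1) : ℝ) = r' := fun r' => coe_pt
  have hds : wderiv 𝕜 (F := (A.T1 I).fib (t, y)) (fun s' => open Classical in
      if h : (projIcc 0 1 zero_le_one s', t, y) ∈ W then (P (projIcc 0 1 zero_le_one s', t, y)).re
        else 0) s =
      (⟨((ε (t, s) * Φ₁ (t, s) : ℝ) : 𝕜) • va, (μ (t, s) : 𝕜) • b (pt r, y) +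
        (Φ₁ (t, s) : 𝕜) • ((ε (t, s) * Φ₁ (t, s) : ℝ) : 𝕜) • vb⟩ : Adj (A.par y)) := by
    refine wderiv_extend (A := A.T1 I) (k := fun z : W => (P z).re) (K := fun z => (P z).re)
      (fun _ => rfl) hz ?_
    refine HasWDeriv.congr_of_eqOn (HasWDeriv.adj has hbs') hs fun s' hs' => ?_
    change (⟨a (pt (Φ (t, pt s')), y), (Φ₁ (t, pt s') : 𝕜) • b (pt (Φ (t, pt s')), y)⟩ :
      Adj (A.par y)) = _
    rw [hpt s' hs']
  have hdt : wderiv 𝕜 (F := A.fib y) (fun t' => open Classical in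
      if h : (projIcc 0 1 zero_le_one t', y) ∈ slice W s then
        (P (s, projIcc 0 1 zero_le_one t', y)).re.re else 0) t = (Φ₁ (t, s) : 𝕜) • va := by
    refine wderiv_extend (k := fun z : slice W s => (P (s, z)).re.re)
      (K := fun z => (P (s, z)).re.re) (fun _ => rfl) hz ?_
    refine hat.congr_of_eqOn ht fun t' ht' => ?_
    change a (pt (Φ (pt t', s)), y) = _
    rw [hpt t' ht']
  have hdt' : wderiv 𝕜 (F := A.fib y) (fun t' => open Classical in
      if h : (projIcc 0 1 zero_le_one t', y) ∈ slice W s then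
        (P (s, projIcc 0 1 zero_le_one t', y)).im.re else 0) t = (μ (t, s) : 𝕜) • b (pt r, y) +
        ((ε (t, s) * Φ₁ (t, s) : ℝ) : 𝕜) • (Φ₁ (t, s) : 𝕜) • vb := by
    refine wderiv_extend (k := fun z : slice W s => (P (s, z)).im.re)
      (K := fun z => (P (s, z)).im.re) (fun _ => rfl) hz ?_
    refine hbt'.congr_of_eqOn ht fun t' ht' => ?_
    change ((ε (pt t', s) * Φ₁ (pt t', s) : ℝ) : 𝕜) • b (pt (Φ (pt t', s)), y) = _
    rw [hpt t' ht']
  have hL : flowPull C Φ Φ₁ ε U (B.q U f) (s, t, y) =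
      (⟨⟨A.q S (fun x => a (pt r, x)) ⟨y, hyS⟩,
        (Φ₁ (t, s) : 𝕜) • (va - A.q S (fun x => b (pt r, x)) ⟨y, hyS⟩)⟩,
       ⟨((ε (t, s) * Φ₁ (t, s) : ℝ) : 𝕜) • (va - A.q S (fun x => b (pt r, x)) ⟨y, hyS⟩), 0⟩⟩ :
        Adj (Adj.par (A.par y))) :=
    congrArg (substHom (A.par y) (Φ₁ (t, s) : ℝ) ((ε (t, s) * Φ₁ (t, s) : ℝ) : 𝕜)) hq
  refine hL.trans (Adj.ext (Adj.ext ?_ ?_) (Adj.ext ?_ ?_))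
  · exact q_congr hS (fun _ _ _ => rfl) _ _
  · refine Eq.trans ?_ (congrArg₂ (· - ·) hdt.symm (q_congr hS (f := fun x =>
      (Φ₁ (t, s) : 𝕜) • b (pt r, x)) (fun _ _ _ => rfl) hyS _))
    change _ • (_ - _) = _
    rw [smul_sub, ← hqs]
  · refine Eq.trans ?_ (map_sub (T1re A I (t, y)) _ _).symm
    refine Eq.trans ?_ (congrArg₂ (· - ·) (congrArg Adj.re hds.symm) (q_congr hS (f := fun x =>
      ((ε (t, s) * Φ₁ (t, s) : ℝ) : 𝕜) • b (pt r, x)) (fun _ _ _ => rfl) hyS _))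
    change _ • (_ - _) = _
    rw [smul_sub, ← hqs]
  · refine Eq.trans ?_ (map_sub (T1im A I (t, y)) _ _).symm
    refine Eq.trans ?_ (congrArg₂ (· - ·) (congrArg Adj.im hds.symm)
      (congrArg₂ (· - ·) hdt'.symm (q_congr hS (f := 0) (fun _ _ _ => rfl) hyS _)))
    rw [hA.q_zero]
    change (0 : A.fib y) = (_ + _) - ((_ + _) - 0)
    rw [smul_comm, sub_zero, sub_self]

/-- The homotopy generated by a flow of reparametrizations. -/
def flowHomotopy (hA : A.IsNQManifold I) (C : Hom (A.T1 I) ((𝓡∂ 1).prod I) B J)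
    (hΦ : IsFlow Φ Φ₁ ε μ) :
    Hom ((A.T1 I).T1 ((𝓡∂ 1).prod I)) ((𝓡∂ 1).prod ((𝓡∂ 1).prod I)) B J where
  map z := C.map (flowPt Φ z)
  smooth := C.smooth.comp hΦ.contMDiff_flowPt
  pull U f z := flowPull C Φ Φ₁ ε U f z
  pull_mem _ _ _ hf := flowPull_mem hA C hΦ hf _ fun _ h => h
  pull_res _ _ h _ _ hf z := congrArg (substHom _ _ _) (C.ev_res h hf z.2)
  pull_add _ _ _ _ hf hg := funext fun z =>
    (congrArg (substHom _ _ _) (C.ev_add hf hg z.2)).trans (map_add (substHom _ _ _) _ _)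
  pull_smul _ _ c _ hf := funext fun z =>
    (congrArg (substHom _ _ _) (C.ev_smul c hf z.2)).trans (map_smul (substHom _ _ _) _ _)
  pull_one _ := funext fun z =>
    (congrArg (substHom _ _ _) (C.ev_one z.2)).trans (map_one (substHom _ _ _))
  pull_mul _ _ _ _ _ hf hg := funext fun z =>
    (congrArg (substHom _ _ _) (C.ev_mul hf hg z.2)).trans (map_mul (substHom _ _ _) _ _)
  pull_q _ _ _ hf := funext fun z => flowPull_q hA C hΦ hf _ (fun _ => Iff.rfl) z

theorem isFamily_of_eq_famAt (hA : A.Restricts) {W : Opens (Icc (0 : ℝ) 1 × X)}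
    {k : (p : W) → A.fib p.1.2} {f : (p : Icc (0 : ℝ) 1 × X) → A.fib p.2} (hk : ∀ p : W, k p = f p.1)
    (h : ∀ p ∈ W, A.FamAt I d f p) : A.IsFamily I W d k := by
  have : k = fun p : W => f p.1 := funext hk
  rw [this]
  exact isFamily_of_famAt hA h

/-- The super-curve at a given parameter of a homotopy. -/
def Hom.atParam (hA : A.Restricts)
    (H : Hom ((A.T1 I).T1 ((𝓡∂ 1).prod I)) ((𝓡∂ 1).prod ((𝓡∂ 1).prod I)) B J)
    (s : Icc (0 : ℝ) 1) : Hom (A.T1 I) ((𝓡∂ 1).prod I) B J where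
  map p := H.map (s, p)
  smooth := H.smooth.comp (contMDiff_const.prodMk contMDiff_id)
  pull U f p := (H.pull U f ⟨(s, p.1), p.2⟩).re
  pull_mem U d f hf := by
    have h := fun p (hp : H.map (s, p) ∈ U) => FamAt.slice hA
      (((T1_funAt_iff (T1_restricts hA)).1 (H.funAt_ev hf hp)).1)
    exact ⟨isFamily_of_eq_famAt hA (f := fun p => (H.ev U f (s, p)).re.re)
        (fun p => congrArg (fun c => Adj.re (Adj.re c)) (H.ev_eq f p.2).symm) fun p hp => (h p hp).1,
      isFamily_of_eq_famAt hA (f := fun p => (H.ev U f (s, p)).re.im)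
        (fun p => congrArg (fun c => Adj.im (Adj.re c)) (H.ev_eq f p.2).symm) fun p hp => (h p hp).2⟩
  pull_res U V h d f hf p := congrArg Adj.re (H.pull_res U V h d f hf ⟨(s, p.1), p.2⟩)
  pull_add U d f g hf hg := funext fun p =>
    congrArg Adj.re (congrFun (H.pull_add U d f g hf hg) ⟨(s, p.1), p.2⟩)
  pull_smul U d c f hf := funext fun p =>
    congrArg Adj.re (congrFun (H.pull_smul U d c f hf) ⟨(s, p.1), p.2⟩)
  pull_one U := funext fun p => congrArg Adj.re (congrFun (H.pull_one U) ⟨(s, p.1), p.2⟩)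
  pull_mul U d e f g hf hg := funext fun p =>
    congrArg Adj.re (congrFun (H.pull_mul U d e f g hf hg) ⟨(s, p.1), p.2⟩)
  pull_q U d f hf := funext fun p =>
    congrArg Adj.re (congrFun (H.pull_q U d f hf) ⟨(s, p.1), p.2⟩)

theorem contMDiff_of_local {map : Icc (0 : ℝ) 1 × X → Y}
    (h : ∀ t, ∃ C : Hom (A.T1 I) ((𝓡∂ 1).prod I) B J, ∀ᶠ t' in 𝓝 t, ∀ y,
      map (t', y) = C.map (t', y)) : ContMDiff ((𝓡∂ 1).prod I) J ∞ map := fun p => by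
  obtain ⟨C, hC⟩ := h p.1
  refine (C.smooth p).congr_of_eventuallyEq ?_
  filter_upwards [continuousAt_fst.eventually hC] with z hz using hz z.2

/-- A morphism given by local data in the direction of `[0,1]`. -/
def Hom.glue (hA : A.Restricts) (hB : B.IsNQManifold J) {map : Icc (0 : ℝ) 1 × X → Y}
    (hmap : ContMDiff ((𝓡∂ 1).prod I) J ∞ map)
    (P : ∀ U : Opens Y, ((y : U) → B.fib y) → (p : Icc (0 : ℝ) 1 × X) → (A.T1 I).fib p)
    (h : ∀ t, ∃ C : Hom (A.T1 I) ((𝓡∂ 1).prod I) B J, ∀ᶠ t' in 𝓝 t, ∀ y,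
      map (t', y) = C.map (t', y) ∧ ∀ U d, ∀ f ∈ B.Fun U d, map (t', y) ∈ U →
        P U f (t', y) = C.ev U f (t', y)) :
    Hom (A.T1 I) ((𝓡∂ 1).prod I) B J where
  map := map
  smooth := hmap
  pull U f p := P U f p
  pull_mem U d f hf := by
    have hF : ∀ p, map p ∈ U → (A.T1 I).FunAt d (P U f) p := by
      intro p hp
      obtain ⟨C, hC⟩ := h p.1
      have hpC : C.map p ∈ U := by rwa [← (hC.self_of_nhds p.2).1]
      refine (T1_funAt_iff hA (F := P U f)).2 ?_
      have hCF := (T1_funAt_iff hA).1 (C.funAt_ev hf hpC)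
      have hev : ∀ᶠ z in 𝓝 p, P U f z = C.ev U f z := by
        have hU : ∀ᶠ z in 𝓝 p, C.map z ∈ U :=
          C.smooth.continuous.continuousAt.preimage_mem_nhds (U.isOpen.mem_nhds hpC)
        filter_upwards [continuousAt_fst.eventually hC, hU] with z hz hzU
        exact (hz z.2).2 U d f hf (by rw [(hz z.2).1]; exact hzU)
      exact ⟨hCF.1.congr (hev.mono fun z hz => congrArg Adj.re hz),
        hCF.2.congr (hev.mono fun z hz => congrArg Adj.im hz)⟩
    exact ⟨isFamily_of_famAt hA (f := fun p => Adj.re (P U f p)) fun p hp =>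
        ((T1_funAt_iff hA).1 (hF p hp)).1,
      isFamily_of_famAt hA (f := fun p => Adj.im (P U f p)) fun p hp =>
        ((T1_funAt_iff hA).1 (hF p hp)).2⟩
  pull_res U V hVU d f hf p := by
    obtain ⟨C, hC⟩ := h p.1.1
    obtain ⟨h1, h2⟩ := hC.self_of_nhds p.1.2
    have hp : C.map p.1 ∈ V := by rw [← h1]; exact p.2
    exact (h2 V d _ (hB.res_mem U V hVU d f hf) p.2).trans ((C.ev_res hVU hf hp).trans
      (h2 U d f hf (hVU p.2)).symm)
  pull_add U d f g hf hg := funext fun p => by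
    obtain ⟨C, hC⟩ := h p.1.1
    obtain ⟨h1, h2⟩ := hC.self_of_nhds p.1.2
    have hp : C.map p.1 ∈ U := by rw [← h1]; exact p.2
    refine (h2 U d _ (hB.add_mem U d f g hf hg) p.2).trans ((C.ev_add hf hg hp).trans ?_)
    exact congrArg₂ (· + ·) (h2 U d f hf p.2).symm (h2 U d g hg p.2).symm
  pull_smul U d c f hf := funext fun p => by
    obtain ⟨C, hC⟩ := h p.1.1
    obtain ⟨h1, h2⟩ := hC.self_of_nhds p.1.2
    have hp : C.map p.1 ∈ U := by rw [← h1]; exact p.2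
    refine (h2 U d _ (hB.smul_mem U d c f hf) p.2).trans ((C.ev_smul c hf hp).trans ?_)
    exact congrArg (c • ·) (h2 U d f hf p.2).symm
  pull_one U := funext fun p => by
    obtain ⟨C, hC⟩ := h p.1.1
    obtain ⟨h1, h2⟩ := hC.self_of_nhds p.1.2
    have hp : C.map p.1 ∈ U := by rw [← h1]; exact p.2
    exact (h2 U 0 _ (hB.one_mem U) p.2).trans (C.ev_one hp)
  pull_mul U d e f g hf hg := funext fun p => by
    obtain ⟨C, hC⟩ := h p.1.1
    obtain ⟨h1, h2⟩ := hC.self_of_nhds p.1.2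
    have hp : C.map p.1 ∈ U := by rw [← h1]; exact p.2
    refine (h2 U (d + e) _ (hB.mul_mem U d e f g hf hg) p.2).trans ((C.ev_mul hf hg hp).trans ?_)
    exact congrArg₂ (· * ·) (h2 U d f hf p.2).symm (h2 U e g hg p.2).symm
  pull_q U d f hf := funext fun p => by
    obtain ⟨⟨t, y⟩, hp⟩ := p
    obtain ⟨C, hC⟩ := h t
    obtain ⟨h1, h2⟩ := hC.self_of_nhds y
    have hpC : C.map (t, y) ∈ U := by rw [← h1]; exact hp
    refine (h2 U (d + 1) _ (hB.q_mem U d f hf) hp).trans ?_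
    have hev : ∀ x (hx : (t, x) ∈ Opens.comap ⟨C.map, C.smooth.continuous⟩ U),
        C.pull U f ⟨(t, x), hx⟩ = P U f (t, x) := fun x hx => by
      have hmx : map (t, x) ∈ U := by rw [(hC.self_of_nhds x).1]; exact hx
      rw [(hC.self_of_nhds x).2 U d f hf hmx]
      exact (C.ev_eq f hx).symm
    -- The operator `q` acts along `X` at fixed `t`, so agreement on the slice suffices for it; only
    -- the `t`-derivative below uses agreement for nearby parameters.
    have hS : slice (Opens.comap ⟨C.map, C.smooth.continuous⟩ U) t =
        slice (Opens.comap ⟨map, hmap.continuous⟩ U) t := by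
      ext x
      change C.map (t, x) ∈ U ↔ map (t, x) ∈ U
      rw [(hC.self_of_nhds x).1]
    obtain ⟨v, hv⟩ : ∃ v : A.fib y, HasWDeriv 𝕜 (F := A.fib y)
        (fun s => Adj.re (C.ev U f (pt s, y))) v t := by
      have hF := ((T1_funAt_iff hA).1 (C.funAt_ev hf hpC)).1
      rw [← pt_coe t] at hF
      exact hF.exists_hasWDeriv t.2
    rw [C.ev_eq _ hpC, C.pull_q U d f hf]
    refine Adj.ext ?_ (congrArg₂ (· - ·) ?_ ?_)
    · exact q_congr hS (fun x hx _ => congrArg Adj.re (hev x hx)) _ _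
    · refine (wderiv_extend (K := fun p => Adj.re (C.ev U f p))
        (fun p => congrArg Adj.re (C.ev_eq f p.2).symm) hpC hv).trans
        (wderiv_extend (K := fun p => Adj.re (P U f p)) (fun p => rfl) hp
          (hv.congr_of_eventuallyEq ?_)).symm
      have hc : Continuous fun s : ℝ => (pt s, y) := continuous_pt.prodMk continuous_const
      have h3 : ∀ᶠ s in 𝓝 (t : ℝ), C.map (pt s, y) ∈ U :=
        (C.smooth.continuous.comp hc).continuousAt.preimage_mem_nhds
          (U.isOpen.mem_nhds (by simpa [pt_coe] using hpC))
      have h4 := (continuous_pt.tendsto (t : ℝ)).eventually (by rwa [pt_coe] : _)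
      filter_upwards [h3, h4] with s hs3 hs4
      exact congrArg Adj.re ((hs4 y).2 U d f hf (by rw [(hs4 y).1]; exact hs3))
    · exact q_congr hS (fun x hx _ => congrArg Adj.im (hev x hx)) _ _

end QSpace

end NQ

end

/-! ### Existence of reparametrizations, homotopies and concatenations -/

noncomputable section

namespace NQ

open scoped Topology
open QSpace

/-! ### Partial derivatives on the closed unit square -/

section Square

variable {F : Type*} [NormedAddCommGroup F] [NormedSpace ℝ F] {g : ℝ × ℝ → F}

theorem uniqueDiffOn_square : UniqueDiffOn ℝ (Icc (0 : ℝ) 1 ×ˢ Icc (0 : ℝ) 1) :=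
  (uniqueDiffOn_Icc zero_lt_one).prod (uniqueDiffOn_Icc zero_lt_one)

theorem hasDerivWithinAt_left (hg : ContDiffOn ℝ ∞ g (Icc 0 1 ×ˢ Icc 0 1)) {t s : ℝ}
    (ht : t ∈ Icc (0 : ℝ) 1) (hs : s ∈ Icc (0 : ℝ) 1) :
    HasDerivWithinAt (fun t => g (t, s)) (fderivWithin ℝ g (Icc 0 1 ×ˢ Icc 0 1) (t, s) (1, 0))
      (Icc 0 1) t := by
  have h := ((hg.differentiableOn (by simp)) (t, s) ⟨ht, hs⟩).hasFDerivWithinAt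
  exact h.comp_hasDerivWithinAt (f := fun t => (t, s)) t
    ((hasDerivWithinAt_id t _).prodMk (hasDerivWithinAt_const t _ s)) fun x hx => ⟨hx, hs⟩

theorem hasDerivWithinAt_right (hg : ContDiffOn ℝ ∞ g (Icc 0 1 ×ˢ Icc 0 1)) {t s : ℝ}
    (ht : t ∈ Icc (0 : ℝ) 1) (hs : s ∈ Icc (0 : ℝ) 1) :
    HasDerivWithinAt (fun s => g (t, s)) (fderivWithin ℝ g (Icc 0 1 ×ˢ Icc 0 1) (t, s) (0, 1))
      (Icc 0 1) s := by
  have h := ((hg.differentiableOn (by simp)) (t, s) ⟨ht, hs⟩).hasFDerivWithinAt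
  exact h.comp_hasDerivWithinAt (f := fun s => (t, s)) s
    ((hasDerivWithinAt_const s _ t).prodMk (hasDerivWithinAt_id s _)) fun x hx => ⟨ht, hx⟩

theorem contDiffOn_fderivWithin_square (hg : ContDiffOn ℝ ∞ g (Icc 0 1 ×ˢ Icc 0 1)) (v : ℝ × ℝ) :
    ContDiffOn ℝ ∞ (fun p => fderivWithin ℝ g (Icc 0 1 ×ˢ Icc 0 1) p v) (Icc 0 1 ×ˢ Icc 0 1) :=
  (hg.fderivWithin uniqueDiffOn_square (by simp)).clm_apply contDiffOn_const

theorem fderivWithin_square_comm (hg : ContDiffOn ℝ ∞ g (Icc 0 1 ×ˢ Icc 0 1)) {p : ℝ × ℝ}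
    (hp : p ∈ Icc (0 : ℝ) 1 ×ˢ Icc (0 : ℝ) 1) (v w : ℝ × ℝ) :
    fderivWithin ℝ (fun p => fderivWithin ℝ g (Icc 0 1 ×ˢ Icc 0 1) p v) (Icc 0 1 ×ˢ Icc 0 1) p w =
      fderivWithin ℝ (fun p => fderivWithin ℝ g (Icc 0 1 ×ˢ Icc 0 1) p w) (Icc 0 1 ×ˢ Icc 0 1) p v := by
  have hU := uniqueDiffOn_square
  have hd : DifferentiableWithinAt ℝ (fderivWithin ℝ g (Icc 0 1 ×ˢ Icc 0 1)) (Icc 0 1 ×ˢ Icc 0 1) p :=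
    ((hg.fderivWithin (m := ∞) hU (by simp)).differentiableOn (by simp)) p hp
  -- Symmetry of the second derivative extends to boundary points because they are limits of
  -- interior ones.
  have hcl : p ∈ closure (interior (Icc (0 : ℝ) 1 ×ˢ Icc (0 : ℝ) 1)) := by
    rw [interior_prod_eq, interior_Icc, closure_prod_eq, closure_Ioo zero_ne_one]
    exact hp
  have hsymm : IsSymmSndFDerivWithinAt ℝ g (Icc 0 1 ×ˢ Icc 0 1) p :=
    (hg p hp).isSymmSndFDerivWithinAt
      (by rw [minSmoothness_of_isRCLikeNormedField]; exact WithTop.coe_le_coe.2 (le_top : (2 : ℕ∞) ≤ ⊤)) hU hcl hp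
  have key : ∀ v w, fderivWithin ℝ (fun p => fderivWithin ℝ g (Icc 0 1 ×ˢ Icc 0 1) p v)
      (Icc 0 1 ×ˢ Icc 0 1) p w =
      fderivWithin ℝ (fderivWithin ℝ g (Icc 0 1 ×ˢ Icc 0 1)) (Icc 0 1 ×ˢ Icc 0 1) p w v := by
    intro v w
    rw [fderivWithin_clm_apply (hU p hp) hd (differentiableWithinAt_const v)]
    simp
  rw [key, key]
  exact hsymm w v

end Square

/-- With `Φ₁ = ∂_t Ψ` and `μ = ∂_s Φ₁`, the flow equation turns `∂_t (ε Φ₁)` into `∂_t ∂_s Ψ`, which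
is `μ` by symmetry of second derivatives. -/
theorem Generates.isFlow {ε Ψ : ℝ → ℝ → ℝ} (h : Generates ε Ψ) :
    ∃ Φ₁ μ, IsFlow (fun p => Ψ p.1 p.2) Φ₁ (fun p => ε p.1 p.2) μ := by
  have hs := h.smooth
  set Φ : ℝ × ℝ → ℝ := fun p => Ψ p.1 p.2
  set Φ₁ : ℝ × ℝ → ℝ := fun p => fderivWithin ℝ Φ (Icc 0 1 ×ˢ Icc 0 1) p (1, 0)
  have hs₁ : ContDiffOn ℝ ∞ Φ₁ (Icc 0 1 ×ˢ Icc 0 1) := contDiffOn_fderivWithin_square hs (1, 0)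
  have hU := uniqueDiffOn_Icc (zero_lt_one (α := ℝ))
  have hflow : ∀ t ∈ Icc (0 : ℝ) 1, ∀ s ∈ Icc (0 : ℝ) 1,
      fderivWithin ℝ Φ (Icc 0 1 ×ˢ Icc 0 1) (t, s) (0, 1) = ε t s * Φ₁ (t, s) := by
    intro t ht s hs'
    have h1 := (hasDerivWithinAt_right hs ht hs').derivWithin (hU s hs')
    have h2 := (hasDerivWithinAt_left hs ht hs').derivWithin (hU t ht)
    rw [← h1]
    exact (h.flow t ht s hs').trans (congrArg (ε t s * ·) h2)
  refine ⟨Φ₁, fun p => fderivWithin ℝ Φ₁ (Icc 0 1 ×ˢ Icc 0 1) p (0, 1), hs, hs₁, h.field.smooth,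
    ?_, fun t ht s hs' => hasDerivWithinAt_left hs ht hs', fun t ht s hs' => ?_,
    fun t ht s hs' => hasDerivWithinAt_right hs₁ ht hs', fun t ht s hs' => ?_⟩
  · rintro ⟨t, s⟩ ⟨ht, hs'⟩
    have hp := h.param s hs'
    have h0 := hp.mono (left_mem_Icc.2 zero_le_one) ht ht.1
    have h1 := hp.mono ht (right_mem_Icc.2 zero_le_one) ht.2
    rw [hp.left] at h0
    rw [hp.right] at h1
    exact ⟨h0, h1⟩
  · exact (hasDerivWithinAt_right hs ht hs').congr_deriv (hflow t ht s hs')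
  · have h2 := hasDerivWithinAt_left (contDiffOn_fderivWithin_square hs (0, 1)) ht hs'
    rw [fderivWithin_square_comm hs ⟨ht, hs'⟩] at h2
    exact h2.congr (fun x hx => (hflow x hx s hs').symm) (hflow t ht s hs').symm

theorem isFlow_of_contDiffOn {ρ : ℝ → ℝ} (hρ : ContDiffOn ℝ ∞ ρ (Icc 0 1))
    (hm : MapsTo ρ (Icc 0 1) (Icc 0 1)) :
    IsFlow (fun p => ρ p.1) (fun p => derivWithin ρ (Icc 0 1) p.1) (fun _ => 0) (fun _ => 0) where
  smooth := hρ.comp contDiffOn_fst fun _ hp => hp.1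
  smooth₁ := (hρ.derivWithin (uniqueDiffOn_Icc zero_lt_one) (by simp)).comp contDiffOn_fst
    fun _ hp => hp.1
  smooth_field := contDiffOn_const
  mapsTo _ hp := hm hp.1
  deriv_t t ht _ _ := (hρ.differentiableOn (by simp) t ht).hasDerivWithinAt
  deriv_s t _ s _ := by simpa using hasDerivWithinAt_const s (Icc 0 1) (ρ t)
  deriv_s₁ t _ s _ := hasDerivWithinAt_const s (Icc 0 1) (derivWithin ρ (Icc 0 1) t)
  deriv_t₁ t _ _ _ := by simpa using hasDerivWithinAt_const t (Icc (0 : ℝ) 1) (0 : ℝ)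

/-- Linear interpolation between the identity and `ψ`. Its `t`-derivative `den` is a convex
combination of `1` and `ψ' > 0`, hence positive, so the flow equation can be solved for `ε = ∂_s Ψ /
∂_t Ψ`. -/
theorem exists_generates {ψ : ℝ → ℝ} (hψ : IsParam ψ 0 1 0 1)
    (hpos : ∀ t ∈ Icc (0 : ℝ) 1, 0 < derivWithin ψ (Icc 0 1) t) :
    ∃ ε Ψ : ℝ → ℝ → ℝ, Generates ε Ψ ∧ ∀ t ∈ Icc (0 : ℝ) 1, Ψ t 1 = ψ t := by
  have hU := uniqueDiffOn_Icc (zero_lt_one (α := ℝ))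
  let Ψ : ℝ → ℝ → ℝ := fun t s => (1 - s) * t + s * ψ t
  let den : ℝ × ℝ → ℝ := fun p => (1 - p.2) + p.2 * derivWithin ψ (Icc 0 1) p.1
  have hψ' : ContDiffOn ℝ ∞ (derivWithin ψ (Icc 0 1)) (Icc 0 1) :=
    hψ.smooth.derivWithin hU (by simp)
  have hψ1 : ContDiffOn ℝ ∞ (fun p : ℝ × ℝ => ψ p.1) (Icc 0 1 ×ˢ Icc 0 1) :=
    hψ.smooth.comp contDiffOn_fst fun p hp => hp.1
  have hψ1' : ContDiffOn ℝ ∞ (fun p : ℝ × ℝ => derivWithin ψ (Icc 0 1) p.1)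
    (Icc 0 1 ×ˢ Icc 0 1) := hψ'.comp contDiffOn_fst fun p hp => hp.1
  have hden : ∀ p ∈ Icc (0 : ℝ) 1 ×ˢ Icc (0 : ℝ) 1, 0 < den p := by
    rintro ⟨t, s⟩ ⟨ht, hs⟩
    have := hpos t ht
    rcases eq_or_lt_of_le hs.2 with h | h
    · simp only at h
      simp only [den, h]
      linarith
    · have h2 : 0 < 1 - s := sub_pos.2 h
      have h3 : 0 ≤ s * derivWithin ψ (Icc 0 1) t := mul_nonneg hs.1 this.le
      simp only [den]
      linarith
  have hdt : ∀ t ∈ Icc (0 : ℝ) 1, ∀ s, HasDerivWithinAt (fun t => Ψ t s) (den (t, s)) (Icc 0 1) t := by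
    intro t ht s
    have h1 := (hψ.smooth.differentiableOn (by simp) t ht).hasDerivWithinAt
    exact (((hasDerivWithinAt_id t (Icc (0 : ℝ) 1)).const_mul (1 - s)).add
      (h1.const_mul s)).congr_deriv (by simp [den])
  have hds : ∀ t s, HasDerivAt (fun s => Ψ t s) (ψ t - t) s := by
    intro t s
    have h1 := (((hasDerivAt_id s).const_sub 1).mul_const t).add ((hasDerivAt_id s).mul_const (ψ t))
    refine h1.congr_deriv ?_
    ring
  have hsm : ContDiffOn ℝ ∞ (fun p : ℝ × ℝ => Ψ p.1 p.2) (Icc 0 1 ×ˢ Icc 0 1) :=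
    ((contDiffOn_const.sub contDiffOn_snd).mul contDiffOn_fst).add (contDiffOn_snd.mul hψ1)
  refine ⟨fun t s => (ψ t - t) / den (t, s), Ψ, ⟨⟨?_, ?_, ?_⟩, hsm, ?_, ?_, ?_⟩, ?_⟩
  · exact (hψ1.sub contDiffOn_fst).div
      ((contDiffOn_const.sub contDiffOn_snd).add (contDiffOn_snd.mul hψ1')) fun p hp => (hden p hp).ne'
  · intro s _
    simp [hψ.left]
  · intro s _
    simp [hψ.right]
  · intro t _
    simp [Ψ]
  · intro s hs
    refine ⟨fun t ht => ?_, ?_, by simp [Ψ, hψ.left], by simp [Ψ, hψ.right]⟩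
    · exact (hsm (t, s) ⟨ht, hs⟩).comp (f := fun t => (t, s)) t
        (contDiffWithinAt_id.prodMk contDiffWithinAt_const) fun x hx => ⟨hx, hs⟩
    · intro t ht t' ht' h
      exact add_le_add (mul_le_mul_of_nonneg_left h (sub_nonneg.2 hs.2))
        (mul_le_mul_of_nonneg_left (hψ.mono ht ht' h) hs.1)
  · intro t ht s hs
    rw [(hds t s).hasDerivWithinAt.derivWithin (hU s hs), (hdt t ht s).derivWithin (hU t ht),
      div_mul_cancel₀ _ (hden (t, s) ⟨ht, hs⟩).ne']
  · intro t _
    simp [Ψ]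

theorem IsParam.mapsTo {ρ : ℝ → ℝ} {a b a' b' : ℝ} (h : IsParam ρ a b a' b') (hab : a ≤ b) :
    MapsTo ρ (Icc a b) (Icc a' b') := fun _ ht =>
  ⟨h.left ▸ h.mono (left_mem_Icc.2 hab) ht ht.1, h.right ▸ h.mono ht (right_mem_Icc.2 hab) ht.2⟩

section Curves

variable {𝕜 : Type*} [RCLike 𝕜] {M L : NQManifold 𝕜}

theorem isReparamOn_atParam (C : SuperCurve M L) {Φ Φ₁ ε μ : ℝ × ℝ → ℝ} (hΦ : IsFlow Φ Φ₁ ε μ)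
    (s : Icc (0 : ℝ) 1) :
    IsReparamOn ((flowHomotopy L.isNQ C hΦ).atParam L.isNQ.restricts s) C (fun t => Φ (t, s)) 0 1 := by
  intro t ht y
  have hm : (pt t : ℝ) = t := coe_pt ht
  refine ⟨?_, ?_⟩
  · change C.map (pt (Φ (pt t, s)), y) = _
    rw [hm]
  · intro U d f hf h' h
    change (⟨(C.ev U f (pt (Φ (pt t, s)), y)).re, (Φ₁ (pt t, s) : 𝕜) •
      (C.ev U f (pt (Φ (pt t, s)), y)).im⟩ : Adj (L.space.par y)) = _
    rw [hm, C.ev_eq f h,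
      (hΦ.deriv_t t ht s s.2).derivWithin (uniqueDiffOn_Icc zero_lt_one t ht)]

/-- A single reparametrization is a flow constant in `s`; the homotopy it generates is restricted to
one parameter. -/
theorem exists_isReparamOn (C : SuperCurve M L) {ρ : ℝ → ℝ} (hρ : ContDiffOn ℝ ∞ ρ (Icc 0 1))
    (hm : MapsTo ρ (Icc 0 1) (Icc 0 1)) : ∃ C' : SuperCurve M L, IsReparamOn C' C ρ 0 1 :=
  ⟨_, isReparamOn_atParam C (isFlow_of_contDiffOn hρ hm) 0⟩

theorem exists_homotopy (C : SuperCurve M L) {ε Ψ : ℝ → ℝ → ℝ} (h : Generates ε Ψ) :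
    ∃ H : SuperHomotopy M L, SuperHomotopy.IsReparamWith H ε ∧
      ∀ s : Icc (0 : ℝ) 1, ∃ C' : SuperCurve M L, SuperHomotopy.IsAt H s C' ∧
        IsReparamOn C' C (fun t => Ψ t s) 0 1 := by
  obtain ⟨Φ₁, μ, hΦ⟩ := h.isFlow
  refine ⟨flowHomotopy L.isNQ C hΦ, fun s t _ U d f hf hU => ?_, fun s =>
    ⟨_, fun t y => ⟨rfl, fun U d f hf _ _ => rfl⟩, isReparamOn_atParam C hΦ s⟩⟩
  refine Adj.ext ?_ rfl
  change ((ε t s * Φ₁ (t, s) : ℝ) : 𝕜) • _ = (ε t s : 𝕜) • (Φ₁ (t, s) : 𝕜) • _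
  rw [smul_smul, RCLike.ofReal_mul]

theorem pt_zero : pt 0 = 0 := Subtype.ext (coe_pt ⟨le_rfl, zero_le_one⟩)

theorem pt_one : pt 1 = 1 := Subtype.ext (coe_pt ⟨zero_le_one, le_rfl⟩)

section Reparam

variable {C C' : SuperCurve M L} {ρ : ℝ → ℝ} {a b t : ℝ} {y : L.body} {U : Opens M.body} {d : ℤ}

theorem IsReparamOn.ev_eq (h : IsReparamOn C' C ρ a b) (ht : t ∈ Icc a b)
    {f : (x : U) → M.space.fib x} (hf : f ∈ M.space.Fun U d) (hU : C.map (pt (ρ t), y) ∈ U) :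
    C'.ev U f (pt t, y) = (⟨(C.ev U f (pt (ρ t), y)).re,
      ((derivWithin ρ (Icc a b) t : ℝ) : 𝕜) • (C.ev U f (pt (ρ t), y)).im⟩ : Adj (L.space.par y)) := by
  have hU' : C'.map (pt t, y) ∈ U := by rwa [(h t ht y).1]
  rw [C'.ev_eq f hU', (h t ht y).2 U d f hf hU' hU, C.ev_eq f hU]

theorem isReparamOn_of_ev (h : ∀ t ∈ Icc a b, ∀ y, C'.map (pt t, y) = C.map (pt (ρ t), y) ∧
    ∀ (U : Opens M.body) (d : ℤ), ∀ f ∈ M.space.Fun U d, C.map (pt (ρ t), y) ∈ U →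
      C'.ev U f (pt t, y) = (⟨(C.ev U f (pt (ρ t), y)).re,
        ((derivWithin ρ (Icc a b) t : ℝ) : 𝕜) • (C.ev U f (pt (ρ t), y)).im⟩ : Adj (L.space.par y))) :
    IsReparamOn C' C ρ a b := by
  refine fun t ht y => ⟨(h t ht y).1, fun U d f hf hU' hU => ?_⟩
  have := (h t ht y).2 U d f hf hU
  rwa [C'.ev_eq f hU', C.ev_eq f hU] at this

theorem derivWithin_eq_zero_of_eventually {S : Set ℝ} {c : ℝ} (h : ∀ᶠ s in 𝓝 t, ρ s = c) :
    derivWithin ρ S t = 0 := by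
  have h' : ρ =ᶠ[𝓝[S] t] fun _ => c := h.filter_mono nhdsWithin_le_nhds
  rw [h'.derivWithin_eq h.self_of_nhds]
  exact congrFun (derivWithin_fun_const S c) t

/-- Where `ρ` is locally constant, the `θ`-component is killed by `ρ' = 0` and only the position
`C(c)` survives. Two curves that meet can thus be made to agree over an interval. -/
theorem IsReparamOn.ev_eq_of_eventually {c : ℝ} (h : IsReparamOn C' C ρ a b) (ht : t ∈ Icc a b)
    (hρ : ∀ᶠ s in 𝓝 t, ρ s = c)
    {f : (x : U) → M.space.fib x} (hf : f ∈ M.space.Fun U d) (hU : C.map (pt c, y) ∈ U) :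
    C'.ev U f (pt t, y) = (⟨(C.ev U f (pt c, y)).re, 0⟩ : Adj (L.space.par y)) := by
  have hc : ρ t = c := hρ.self_of_nhds
  rw [h.ev_eq ht hf (by rwa [hc]), hc, derivWithin_eq_zero_of_eventually hρ, RCLike.ofReal_zero,
    zero_smul]

end Reparam

/-- Joining the curves directly need not be smooth. After reparametrization both rest at the common
point for `1/3 < t < 2/3`, so switching at `1/2` is locally one of two smooth morphisms. -/
theorem exists_isConcat (C₁ C₂ : SuperCurve M L) (h : Meets C₁ C₂) :
    ∃ (C : SuperCurve M L) (c : ℝ) (ρ₁ ρ₂ : ℝ → ℝ), IsConcat C C₂ C₁ c ρ₁ ρ₂ := by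
  -- `ρ₁` has reached `1` at `t = 1/3`, and `ρ₂` stays at `0` up to `t = 2/3`.
  let ρ₁ : ℝ → ℝ := fun t => Real.smoothTransition (3 * t)
  let ρ₂ : ℝ → ℝ := fun t => Real.smoothTransition (3 * t - 2)
  have hs₁ : ContDiff ℝ ∞ ρ₁ := Real.smoothTransition.contDiff.comp (by fun_prop)
  have hs₂ : ContDiff ℝ ∞ ρ₂ := Real.smoothTransition.contDiff.comp (by fun_prop)
  have hm₁ : ∀ t, ρ₁ t ∈ Icc (0 : ℝ) 1 := fun t =>
    ⟨Real.smoothTransition.nonneg _, Real.smoothTransition.le_one _⟩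
  have hm₂ : ∀ t, ρ₂ t ∈ Icc (0 : ℝ) 1 := fun t =>
    ⟨Real.smoothTransition.nonneg _, Real.smoothTransition.le_one _⟩
  have hc₁ : ∀ t, 1 / 3 < t → ∀ᶠ s in 𝓝 t, ρ₁ s = 1 := fun t ht => by
    filter_upwards [lt_mem_nhds ht] with s hs
    exact Real.smoothTransition.one_of_one_le (by linarith)
  have hc₂ : ∀ t, t < 2 / 3 → ∀ᶠ s in 𝓝 t, ρ₂ s = 0 := fun t ht => by
    filter_upwards [gt_mem_nhds ht] with s hs
    exact Real.smoothTransition.zero_of_nonpos (by linarith)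
  obtain ⟨C₁', hC₁⟩ := exists_isReparamOn C₁ hs₁.contDiffOn fun t _ => hm₁ t
  obtain ⟨C₂', hC₂⟩ := exists_isReparamOn C₂ hs₂.contDiffOn fun t _ => hm₂ t
  have hmap : ∀ t : Icc (0 : ℝ) 1, 1 / 3 < (t : ℝ) → (t : ℝ) < 2 / 3 → ∀ y,
      C₁'.map (t, y) = C₁.map (1, y) ∧ C₂'.map (t, y) = C₁.map (1, y) := by
    intro t h1 h2 y
    have e1 := (hC₁ t t.2 y).1
    have e2 := (hC₂ t t.2 y).1
    rw [(hc₁ t h1).self_of_nhds, pt_one, pt_coe] at e1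
    rw [(hc₂ t h2).self_of_nhds, pt_zero, pt_coe] at e2
    exact ⟨e1, e2.trans (h y).1.symm⟩
  have hev : ∀ t : Icc (0 : ℝ) 1, 1 / 3 < (t : ℝ) → (t : ℝ) < 2 / 3 → ∀ y (U : Opens M.body) (d : ℤ),
      ∀ f ∈ M.space.Fun U d, C₁.map (1, y) ∈ U → C₁'.ev U f (t, y) = C₂'.ev U f (t, y) := by
    intro t h1 h2 y U d f hf hU
    have hU₂ : C₂.map (0, y) ∈ U := by rwa [← (h y).1]
    have e1 := hC₁.ev_eq_of_eventually t.2 (hc₁ t h1) (y := y) hf (by rwa [pt_one])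
    have e2 := hC₂.ev_eq_of_eventually t.2 (hc₂ t h2) (y := y) hf (by rwa [pt_zero])
    rw [pt_one, pt_coe, C₁.ev_eq f hU, (h y).2 U d f hf hU hU₂] at e1
    rw [pt_zero, pt_coe, C₂.ev_eq f hU₂] at e2
    exact e1.trans e2.symm
  classical
  let map : Icc (0 : ℝ) 1 × L.body → M.body := fun p =>
    if (p.1 : ℝ) ≤ 1 / 2 then C₁'.map p else C₂'.map p
  let P : ∀ U : Opens M.body, ((x : U) → M.space.fib x) → (p : Icc (0 : ℝ) 1 × L.body) →
      (L.space.T1 (𝓡 L.dim)).fib p := fun U f p =>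
    if (p.1 : ℝ) ≤ 1 / 2 then C₁'.ev U f p else C₂'.ev U f p
  have hlo : ∀ t : Icc (0 : ℝ) 1, (t : ℝ) < 2 / 3 → ∀ y, map (t, y) = C₁'.map (t, y) ∧
      ∀ (U : Opens M.body) (d : ℤ), ∀ f ∈ M.space.Fun U d, map (t, y) ∈ U →
        P U f (t, y) = C₁'.ev U f (t, y) := by
    intro t ht y
    by_cases h2 : (t : ℝ) ≤ 1 / 2
    · exact ⟨if_pos h2, fun U d f hf _ => if_pos h2⟩
    · have h3 : 1 / 3 < (t : ℝ) := by linarith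
      have e : map (t, y) = C₂'.map (t, y) := if_neg h2
      refine ⟨e.trans ((hmap t h3 ht y).2.trans (hmap t h3 ht y).1.symm), fun U d f hf hU => ?_⟩
      rw [e, (hmap t h3 ht y).2] at hU
      exact (if_neg h2).trans (hev t h3 ht y U d f hf hU).symm
  have hhi : ∀ t : Icc (0 : ℝ) 1, 1 / 3 < (t : ℝ) → ∀ y, map (t, y) = C₂'.map (t, y) ∧
      ∀ (U : Opens M.body) (d : ℤ), ∀ f ∈ M.space.Fun U d, map (t, y) ∈ U →
        P U f (t, y) = C₂'.ev U f (t, y) := by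
    intro t h3 y
    by_cases h2 : (t : ℝ) ≤ 1 / 2
    · have ht : (t : ℝ) < 2 / 3 := by linarith
      have e : map (t, y) = C₁'.map (t, y) := if_pos h2
      refine ⟨e.trans ((hmap t h3 ht y).1.trans (hmap t h3 ht y).2.symm), fun U d f hf hU => ?_⟩
      rw [e, (hmap t h3 ht y).1] at hU
      exact (if_pos h2).trans (hev t h3 ht y U d f hf hU)
    · exact ⟨if_neg h2, fun U d f hf _ => if_neg h2⟩
  have hloc : ∀ t, ∃ C : SuperCurve M L, ∀ᶠ t' in 𝓝 t, ∀ y, map (t', y) = C.map (t', y) ∧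
      ∀ (U : Opens M.body) (d : ℤ), ∀ f ∈ M.space.Fun U d, map (t', y) ∈ U →
        P U f (t', y) = C.ev U f (t', y) := by
    intro t
    have hct : Filter.Tendsto (fun t' : Icc (0 : ℝ) 1 => (t' : ℝ)) (𝓝 t) (𝓝 (t : ℝ)) :=
      continuous_subtype_val.tendsto t
    rcases lt_or_ge (t : ℝ) (2 / 3) with ht | ht
    · exact ⟨C₁', (hct.eventually (gt_mem_nhds ht)).mono hlo⟩
    · exact ⟨C₂', (hct.eventually (lt_mem_nhds (by linarith : 1 / 3 < (t : ℝ)))).mono hhi⟩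
  let C : SuperCurve M L := Hom.glue L.isNQ.restricts M.isNQ
    (contMDiff_of_local fun t => (hloc t).imp fun C hC => hC.mono fun t' h y => (h y).1) P hloc
  have hCev : ∀ (U : Opens M.body) (f) p, map p ∈ U → C.ev U f p = P U f p := fun U f p hp =>
    C.ev_eq f hp
  have hU : UniqueDiffOn ℝ (Icc (0 : ℝ) 1) := uniqueDiffOn_Icc zero_lt_one
  refine ⟨C, 1 / 2, ρ₁, ρ₂, by norm_num, by norm_num, ⟨hs₁.contDiffOn, ?_, ?_, ?_⟩,
    ⟨hs₂.contDiffOn, ?_, ?_, ?_⟩, ?_, ?_⟩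
  · exact (Real.smoothTransition.monotone.comp fun x y hxy => by linarith).monotoneOn _
  · simp [ρ₁, Real.smoothTransition.zero]
  · exact Real.smoothTransition.one_of_one_le (by norm_num)
  · exact (Real.smoothTransition.monotone.comp fun x y hxy => by linarith).monotoneOn _
  · exact Real.smoothTransition.zero_of_nonpos (by norm_num)
  · exact Real.smoothTransition.one_of_one_le (by norm_num)
  · refine isReparamOn_of_ev fun t ht y => ?_
    have ht' : t ∈ Icc (0 : ℝ) 1 := ⟨ht.1, by linarith [ht.2]⟩
    have e := hlo (pt t) (by rw [coe_pt ht']; linarith [ht.2]) y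
    refine ⟨e.1.trans (hC₁ t ht' y).1, fun U d f hf hU' => ?_⟩
    have hmU : map (pt t, y) ∈ U := by rwa [e.1, (hC₁ t ht' y).1]
    -- The derivatives within `[0,1]` and within `[0,1/2]` coincide, both being the derivative of
    -- the globally smooth `ρ₁`.
    rw [hCev U f _ hmU, e.2 U d f hf hmU, hC₁.ev_eq ht' hf hU',
      (hs₁.differentiable (by simp) t).derivWithin (hU t ht'),
      (hs₁.differentiable (by simp) t).derivWithin (uniqueDiffOn_Icc (by norm_num) t ht)]
  · refine isReparamOn_of_ev fun t ht y => ?_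
    have ht' : t ∈ Icc (0 : ℝ) 1 := ⟨by linarith [ht.1], ht.2⟩
    have e := hhi (pt t) (by rw [coe_pt ht']; linarith [ht.1]) y
    refine ⟨e.1.trans (hC₂ t ht' y).1, fun U d f hf hU' => ?_⟩
    have hmU : map (pt t, y) ∈ U := by rwa [e.1, (hC₂ t ht' y).1]
    rw [hCev U f _ hmU, e.2 U d f hf hmU, hC₂.ev_eq ht' hf hU',
      (hs₂.differentiable (by simp) t).derivWithin (hU t ht'),
      (hs₂.differentiable (by simp) t).derivWithin (uniqueDiffOn_Icc (by norm_num) t ht)]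

end Curves

end NQ

end

/-! ### Wilson lines in a patch -/

noncomputable section

namespace NQ

open scoped Topology
open QSpace

variable {𝕜 : Type*} [RCLike 𝕜] {M L : NQManifold 𝕜} {E : NQRepresentation M}

theorem QSpace.IsNQManifold.sgn_smul_mem {X : Type*} [TopologicalSpace X] {A : QSpace 𝕜 X}
    {E₀ H₀ : Type*} [NormedAddCommGroup E₀] [NormedSpace ℝ E₀] [TopologicalSpace H₀]
    {I : ModelWithCorners ℝ E₀ H₀} [ChartedSpace H₀ X] (hA : A.IsNQManifold I) {U : Opens X} {d : ℤ}
    {f : (x : U) → A.fib x} (hf : f ∈ A.Fun U d) (n : ℤ) : (fun x => sgn n • f x) ∈ A.Fun U d := by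
  convert! hA.smul_mem U d ((sgn n : ℤ) : 𝕜) f hf using 1
  funext x
  exact (Int.cast_smul_eq_zsmul 𝕜 _ _).symm

/-! ### Degrees of the components in a trivialization -/

namespace Patch

variable (φ φ' : Patch E) (α β : E.ι)

theorem basis_apply (x : φ.dom) (i : E.ι) : φ.basis x i = φ.ζ i x :=
  Module.Basis.mk_apply (φ.isFrame.indep x) (φ.isFrame.span x).ge i

theorem repr_mem {V : Opens M.body} (h : V ≤ φ.dom) {k : ℤ} {s : (x : V) → E.bundle.fib x}
    (hs : s ∈ E.bundle.Sec V k) (β : E.ι) :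
    (fun x : V => (φ.basis ⟨x.1, h x.2⟩).repr (s x) β) ∈ M.space.Fun V (k - E.lev β) := by
  obtain ⟨a, ha, hsum⟩ := (φ.isFrame.sec_iff V h k s).1 hs
  convert! ha β using 1
  funext x
  have hb : ∀ i, φ.ζ i ⟨x.1, h x.2⟩ = φ.basis ⟨x.1, h x.2⟩ i := fun i =>
    (φ.basis_apply _ i).symm
  rw [hsum x]
  simp only [hb]
  rw [Module.Basis.repr_sum_self]

theorem T_mem : φ.T β α ∈ M.space.Fun φ.dom (E.lev α + 1 - E.lev β) :=
  M.isNQ.sgn_smul_mem (φ.repr_mem le_rfl (E.isRep.qhat_mem _ _ _ (φ.isFrame.mem α)) β) _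

theorem Ω_mem : φ.Ω φ' β α ∈ M.space.Fun (φ.dom ⊓ φ'.dom) (E.lev α - E.lev β) :=
  M.isNQ.sgn_smul_mem (φ.repr_mem inf_le_left
    (E.isRep.res_mem _ (φ.dom ⊓ φ'.dom) inf_le_right _ _ (φ'.isFrame.mem α)) β) _

theorem Ω_self : φ.Ω φ β α = if β = α then 1 else 0 := by
  funext x
  have hb : φ.ζ α ⟨x.1, x.2.2⟩ = φ.basis ⟨x.1, x.2.1⟩ α := (φ.basis_apply _ α).symm
  rw [Ω, hb, Module.Basis.repr_self]
  split_ifs with h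
  · subst h
    simp [sgn]
  · simp [Ne.symm h]

end Patch

/-- The subspace of the fibre of `L` containing an entry of the matrix of a degree-preserving map. -/
def entrySpace (E : NQRepresentation M) (y : L.body) (α β : E.ι) : Submodule 𝕜 (L.space.fib y) :=
  L.space.homog (E.lev β - E.lev α) y

instance (y : L.body) (α β : E.ι) : FiniteDimensional 𝕜 (entrySpace E y α β) :=
  L.isNQ.finiteDimensional_homog _ y

theorem one_mem_entrySpace (y : L.body) (α : E.ι) : 1 ∈ entrySpace E y α α := by
  rw [entrySpace, sub_self]
  exact L.isNQ.one_mem_homog y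

/-- The degrees `lev β - lev α` and `lev γ - lev β` telescope, which closes the matrices under
multiplication. -/
theorem mul_mem_entrySpace (y : L.body) (α β γ : E.ι) (v w : L.space.fib y)
    (hv : v ∈ entrySpace E y α β) (hw : w ∈ entrySpace E y β γ) : v * w ∈ entrySpace E y α γ := by
  have := L.isNQ.mul_mem_homog hv hw
  rwa [sub_add_sub_cancel'] at this

variable {C C' : SuperCurve M L} {φ φ' : Patch E} {y : L.body}

theorem conn_apply (C : SuperCurve M L) (φ : Patch E) (y : L.body) (t : ℝ) (α β : E.ι) :
    conn C φ y t α β = Adj.im (C.ev φ.dom (φ.T α β) (pt t, y)) := by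
  by_cases h : C.map (pt t, y) ∈ φ.dom
  · rw [C.ev_eq _ h]
    exact dif_pos h
  · have h1 : C.ev φ.dom (φ.T α β) (pt t, y) = 0 := dif_neg h
    rw [h1]
    exact dif_neg h

theorem famAt_conn {t : ℝ} (h : C.map (pt t, y) ∈ φ.dom) (α β : E.ι) :
    L.space.FamAt (𝓡 L.dim) (E.lev β - E.lev α)
      (fun p => Adj.im (C.ev φ.dom (φ.T α β) p)) (pt t, y) := by
  have := ((T1_funAt_iff L.isNQ.restricts).1 (C.funAt_ev (φ.T_mem β α) h)).2
  rwa [show E.lev β + 1 - E.lev α - 1 = E.lev β - E.lev α by ring] at this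

theorem conn_mem {t : ℝ} (h : C.map (pt t, y) ∈ φ.dom) (α β : E.ι) :
    conn C φ y t α β ∈ entrySpace E y α β := by
  rw [conn_apply]
  exact (famAt_conn h α β).mem_homog

section Regularity

variable {F : Type} [Ring F] [Algebra 𝕜 F] {ι : Type} [Fintype ι] [DecidableEq ι]
  {B : Type*} [NormedRing B] [NormedAlgebra ℝ B] [NormedAlgebra 𝕜 B] [IsScalarTower ℝ 𝕜 B]
  [FiniteDimensional 𝕜 B]

/-- `Λ` is a finite combination of functionals of the entries, so regularity tested by functionals
becomes regularity in the norm of `B`. -/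
theorem contDiffOn_of_functionals {Z : Type*} [NormedAddCommGroup Z] [NormedSpace ℝ Z] {n : ℕ∞ω}
    (Λ : Matrix ι ι F →ₗ[𝕜] B) {N : Z → Matrix ι ι F} {S : Set Z}
    (h : ∀ (ℓ : Module.Dual 𝕜 F) α β, ContDiffOn ℝ n (fun z => ℓ (N z α β)) S) :
    ContDiffOn ℝ n (fun z => Λ (N z)) S := by
  obtain ⟨m, b, ℓ, hΛ⟩ := exists_functionals 𝕜 Λ
  simp only [hΛ]
  exact ContDiffOn.sum fun k _ => ContDiffOn.smul (ContDiffOn.sum fun α _ => ContDiffOn.sum fun β _ =>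
    h _ α β) contDiffOn_const

theorem hasDerivWithinAt_of_functionals (Λ : Matrix ι ι F →ₗ[𝕜] B) {N : ℝ → Matrix ι ι F}
    {v : Matrix ι ι F} {t : ℝ} (h : ∀ α β, HasWDeriv 𝕜 (fun t => N t α β) (v α β) t) :
    HasDerivWithinAt (fun t => Λ (N t)) (Λ v) (Icc 0 1) t := by
  obtain ⟨m, b, ℓ, hΛ⟩ := exists_functionals 𝕜 Λ
  simp only [hΛ]
  exact HasDerivWithinAt.fun_sum fun k _ => HasDerivWithinAt.smul_const
    (HasDerivWithinAt.fun_sum fun α _ => HasDerivWithinAt.fun_sum fun β _ => h α β (ℓ k α β)) _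

end Regularity

theorem contDiffOn_conn {B : Type*} [NormedRing B] [NormedAlgebra ℝ B] [NormedAlgebra 𝕜 B]
    [IsScalarTower ℝ 𝕜 B] [FiniteDimensional 𝕜 B] (Λ : Matrix E.ι E.ι (L.space.fib y) →ₗ[𝕜] B)
    {a b : ℝ} (ha : 0 ≤ a) (hb : b ≤ 1) (h : LiesIn C φ a b) :
    ContDiffOn ℝ ∞ (fun t => Λ (conn C φ y t)) (Icc a b) := by
  refine contDiffOn_of_functionals Λ fun ℓ α β t ht => ?_
  simp only [conn_apply]
  exact ((famAt_conn (h t ht y) α β).contDiffWithinAt ⟨ha.trans ht.1, ht.2.trans hb⟩ ℓ).mono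
    (Icc_subset_Icc ha hb)

/-- Freezing `f` beyond the end points supplies the globally continuous and bounded coefficients
required for `evol`. -/
theorem exists_bounded_extension {B : Type*} [NormedRing B] {f : ℝ → B} {a b : ℝ} (hab : a ≤ b)
    (hf : ContinuousOn f (Icc a b)) :
    ∃ g : ℝ → B, Continuous g ∧ (∃ K, ∀ s, ‖g s‖ ≤ K) ∧ ∀ s ∈ Icc a b, g s = f s := by
  obtain ⟨K, hK⟩ := isCompact_Icc.exists_bound_of_continuousOn hf
  refine ⟨fun s => f (projIcc a b hab s), ?_, ⟨K, fun s => hK _ (projIcc a b hab s).2⟩, fun s hs => ?_⟩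
  · exact hf.comp_continuous (continuous_subtype_val.comp continuous_projIcc) fun s =>
      (projIcc a b hab s).2
  · simp only [projIcc_of_mem hab hs]

variable {B : Type*} [NormedRing B] [NormedAlgebra ℝ B] [NormedAlgebra 𝕜 B]
    [IsScalarTower ℝ 𝕜 B] [FiniteDimensional 𝕜 B]

theorem exists_conn_lift {Θ : B →ₐ[𝕜] Matrix E.ι E.ι (L.space.fib y)}
    {Λ : Matrix E.ι E.ι (L.space.fib y) →ₗ[𝕜] B}
    (hΘ : ∀ N : Matrix E.ι E.ι (L.space.fib y), (∀ α β, N α β ∈ entrySpace E y α β) → Θ (Λ N) = N)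
    {a b : ℝ} (ha : 0 ≤ a) (hab : a ≤ b) (hb : b ≤ 1) (h : LiesIn C φ a b) :
    ∃ A : ℝ → B, Continuous A ∧ (∃ K, ∀ s, ‖A s‖ ≤ K) ∧ (∀ s ∈ Icc a b, A s = Λ (conn C φ y s)) ∧
      ∀ s ∈ Icc a b, conn C φ y s = Θ (A s) := by
  obtain ⟨A, hA, hK, hs⟩ := exists_bounded_extension hab (contDiffOn_conn Λ ha hb h).continuousOn
  refine ⟨A, hA, hK, hs, fun s hs' => ?_⟩
  rw [hs s hs', hΘ _ fun α β => conn_mem (h s hs' y) α β]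

theorem wilson_converges {a b : ℝ} (ha : 0 ≤ a) (hab : a ≤ b) (hb : b ≤ 1) (h : LiesIn C φ a b) :
    PathExpConverges 𝕜 (conn C φ y) b a := by
  obtain ⟨B, _, _, _, _, _, _, Θ, Λ, -, hΘ⟩ := exists_normedModel 𝕜 (entrySpace E y)
    (one_mem_entrySpace y) (mul_mem_entrySpace y)
  obtain ⟨A, hA, ⟨K, hK⟩, -, hc⟩ := exists_conn_lift hΘ ha hab hb h
  exact pathExpConverges_of_eq Θ hA hK hab hc

theorem wilson_mul {a b c : ℝ} (ha : 0 ≤ a) (hab : a ≤ b) (hbc : b ≤ c) (hc : c ≤ 1)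
    (h : LiesIn C φ a c) : wilson C φ y c a = wilson C φ y c b * wilson C φ y b a := by
  obtain ⟨B, _, _, _, _, _, _, Θ, Λ, -, hΘ⟩ := exists_normedModel 𝕜 (entrySpace E y)
    (one_mem_entrySpace y) (mul_mem_entrySpace y)
  obtain ⟨A, hA, ⟨K, hK⟩, -, hs⟩ := exists_conn_lift hΘ ha (hab.trans hbc) hc h
  rw [wilson, wilson, wilson, pathExp_eq Θ hA hK (hab.trans hbc) hs,
    pathExp_eq Θ hA hK hbc fun s h => hs s ⟨hab.trans h.1, h.2⟩,
    pathExp_eq Θ hA hK hab fun s h => hs s ⟨h.1, h.2.trans hbc⟩, ← map_mul,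
    ← evol_mul_evol hA hK hbc]

theorem IsReparamOn.conn_eq {ρ : ℝ → ℝ} {a b t : ℝ} (h : IsReparamOn C' C ρ a b) (ht : t ∈ Icc a b)
    (hφ : C.map (pt (ρ t), y) ∈ φ.dom) :
    conn C' φ y t = ((derivWithin ρ (Icc a b) t : ℝ) : 𝕜) • conn C φ y (ρ t) := by
  ext α β
  rw [Matrix.smul_apply, conn_apply, conn_apply, h.ev_eq ht (φ.T_mem β α) hφ]

theorem IsReparamOn.liesIn {ρ : ℝ → ℝ} {a b u v : ℝ} (h : IsReparamOn C' C ρ a b)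
    (hρ : MonotoneOn ρ (Icc a b)) (hau : a ≤ u) (hvb : v ≤ b) (hl : LiesIn C φ (ρ u) (ρ v)) :
    LiesIn C' φ u v := fun t ht y => by
  have hu : u ≤ v := ht.1.trans ht.2
  have ht' : t ∈ Icc a b := ⟨hau.trans ht.1, ht.2.trans hvb⟩
  rw [(h t ht' y).1]
  exact hl _ ⟨hρ ⟨hau, hu.trans hvb⟩ ht' ht.1, hρ ht' ⟨hau.trans hu, hvb⟩ ht.2⟩ y

/-- Both connections are lifted to one normed algebra, where `evol_reparam` applies. The interval
`[u,v]` is separate from the domain `[a,b]` of `ρ`, so that single pieces of a subdivision and the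
halves of a concatenation are covered. -/
theorem wilson_reparam {ρ : ℝ → ℝ} {a b u v : ℝ} (h : IsReparamOn C' C ρ a b)
    (hρ : ContDiffOn ℝ ∞ ρ (Icc a b)) (hm : MonotoneOn ρ (Icc a b)) (ha : 0 ≤ a) (hau : a ≤ u)
    (huv : u ≤ v) (hvb : v ≤ b) (hb : b ≤ 1) (h0 : 0 ≤ ρ u) (h1 : ρ v ≤ 1)
    (hl : LiesIn C φ (ρ u) (ρ v)) : wilson C' φ y v u = wilson C φ y (ρ v) (ρ u) := by
  obtain ⟨B, _, _, _, _, _, _, Θ, Λ, -, hΘ⟩ := exists_normedModel 𝕜 (entrySpace E y)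
    (one_mem_entrySpace y) (mul_mem_entrySpace y)
  have hu : u ∈ Icc a b := ⟨hau, huv.trans hvb⟩
  have hv : v ∈ Icc a b := ⟨hau.trans huv, hvb⟩
  have hsub : Icc u v ⊆ Icc a b := Icc_subset_Icc hau hvb
  have huv' : ρ u ≤ ρ v := hm hu hv huv
  obtain ⟨A, hA, ⟨K, hK⟩, hAΛ, hs⟩ := exists_conn_lift hΘ h0 huv' h1 hl
  obtain ⟨A', hA', ⟨K', hK'⟩, hAΛ', hs'⟩ := exists_conn_lift hΘ (ha.trans hau) huv (hvb.trans hb)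
    (h.liesIn hm hau hvb hl)
  rw [wilson, wilson, pathExp_eq Θ hA hK huv' hs, pathExp_eq Θ hA' hK' huv hs']
  refine congrArg Θ (evol_reparam hA hK hA' hK' huv (r := fun t => derivWithin ρ (Icc a b) t)
    (fun t ht => ?_) fun t ht => ?_)
  · exact ((hρ.differentiableOn (by simp) t (hsub ht)).hasDerivWithinAt).mono hsub
  · have hρt : ρ t ∈ Icc (ρ u) (ρ v) := ⟨hm hu (hsub ht) ht.1, hm (hsub ht) hv ht.2⟩
    rw [hAΛ' t ht, hAΛ _ hρt, h.conn_eq (hsub ht) (hl _ hρt y), map_smul,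
      ← RCLike.real_smul_eq_coe_smul]

theorem transitionAt_apply (C : SuperCurve M L) (φ φ' : Patch E) (y : L.body) (t : ℝ) (α β : E.ι) :
    transitionAt C φ φ' y t α β =
      Adj.re (C.ev (φ.dom ⊓ φ'.dom) (φ.Ω φ' α β) (pt t, y)) := by
  by_cases h : C.map (pt t, y) ∈ φ.dom ⊓ φ'.dom
  · rw [C.ev_eq _ h]
    exact dif_pos h
  · have h1 : C.ev (φ.dom ⊓ φ'.dom) (φ.Ω φ' α β) (pt t, y) = 0 := dif_neg h
    rw [h1]
    exact dif_neg h

theorem transitionAt_self {t : ℝ} (h : C.map (pt t, y) ∈ φ.dom) : transitionAt C φ φ y t = 1 := by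
  have h' : C.map (pt t, y) ∈ φ.dom ⊓ φ.dom := ⟨h, h⟩
  ext α β
  rw [transitionAt_apply, Patch.Ω_self, Matrix.one_apply]
  split_ifs with hαβ
  · rw [C.ev_one h']
    rfl
  · have h0 : C.ev (φ.dom ⊓ φ.dom) ((0 : 𝕜) • 0) (pt t, y) = _ :=
      C.ev_smul 0 (M.isNQ.zero_mem _ 0) h'
    rw [zero_smul, zero_smul] at h0
    rw [h0]
    rfl

/-- Only the `θ`-independent part enters, and it does not see `ρ'`. Outside the common domain both
sides take the default value zero. -/
theorem IsReparamOn.transitionAt_eq {ρ : ℝ → ℝ} {a b t : ℝ} (h : IsReparamOn C' C ρ a b)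
    (ht : t ∈ Icc a b) : transitionAt C' φ φ' y t = transitionAt C φ φ' y (ρ t) := by
  ext α β
  rw [transitionAt_apply, transitionAt_apply]
  by_cases hφ : C.map (pt (ρ t), y) ∈ φ.dom ⊓ φ'.dom
  · rw [h.ev_eq ht (φ.Ω_mem φ' β α) hφ]
  · have hφ' : C'.map (pt t, y) ∉ φ.dom ⊓ φ'.dom := by rwa [(h t ht y).1]
    have h1 : C.ev (φ.dom ⊓ φ'.dom) (φ.Ω φ' α β) (pt (ρ t), y) = 0 := dif_neg hφ
    have h2 : C'.ev (φ.dom ⊓ φ'.dom) (φ.Ω φ' α β) (pt t, y) = 0 := dif_neg hφ'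
    rw [h1, h2]
    rfl

theorem exists_isAt (H : SuperHomotopy M L) (s : Icc (0 : ℝ) 1) :
    ∃ C : SuperCurve M L, SuperHomotopy.IsAt H s C :=
  ⟨H.atParam L.isNQ.restricts s, fun _ _ => ⟨rfl, fun _ _ _ _ _ _ => rfl⟩⟩

end NQ

end

/-! ### Invariance of Wilson lines under homotopies -/

noncomputable section

namespace NQ

open scoped Topology
open QSpace

variable {𝕜 : Type*} [RCLike 𝕜] {M L : NQManifold 𝕜} {E : NQRepresentation M}

namespace SuperHomotopy

variable {H : SuperHomotopy M L} {ε : ℝ → ℝ → ℝ} {y : L.body} {U : Opens M.body} {d : ℤ}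
  {f : (x : U) → M.space.fib x} {s t : Icc (0 : ℝ) 1}

theorem famAt_re_im (hf : f ∈ M.space.Fun U d) (hU : H.map (s, t, y) ∈ U) :
    (L.space.T1 (𝓡 L.dim)).FamAt ((𝓡∂ 1).prod (𝓡 L.dim)) d (fun z => (H.ev U f z).re) (s, t, y) ∧
      (L.space.T1 (𝓡 L.dim)).FamAt ((𝓡∂ 1).prod (𝓡 L.dim)) (d - 1) (fun z => (H.ev U f z).im)
        (s, t, y) :=
  (T1_funAt_iff (T1_restricts L.isNQ.restricts)).1 (H.funAt_ev hf hU)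

theorem IsReparamWith.ev_im (h : IsReparamWith H ε) (hf : f ∈ M.space.Fun U d)
    (hU : H.map (s, t, y) ∈ U) : (H.ev U f (s, t, y)).im =
      (⟨((ε t s : ℝ) : 𝕜) • (H.ev U f (s, t, y)).re.im, 0⟩ : Adj (L.space.par y)) := by
  rw [H.ev_eq f hU]
  exact h s t y U d f hf hU

/-- The equation of motion `∂_s b = ∂_t (ε b)` of the `θ`-component `b` of a function along a
homotopy generated by `ε`. -/
theorem IsReparamWith.exists_hasWDeriv (h : IsReparamWith H ε) (hf : f ∈ M.space.Fun U d)
    (hU : ∀ p, H.map p ∈ U) (s t : Icc (0 : ℝ) 1) (y : L.body) : ∃ v : L.space.fib y,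
      HasWDeriv 𝕜 (fun s' => ((H.ev U f (pt s', t, y)).re.im : L.space.fib y)) v s ∧
      HasWDeriv 𝕜 (fun t' => ((ε t' s : ℝ) : 𝕜) •
        ((H.ev U f (s, pt t', y)).re.im : L.space.fib y)) v t := by
  have hR := L.isNQ.restricts
  obtain ⟨h1, h2⟩ := famAt_re_im (s := s) (t := t) (y := y) hf (hU _)
  rw [← pt_coe s] at h1
  obtain ⟨v, hv⟩ := h1.exists_hasWDeriv s.2
  have h3 := (h2.slice hR).1
  rw [← pt_coe t] at h3
  obtain ⟨w, hw⟩ := h3.exists_hasWDeriv t.2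
  have hz : ∀ z, H.ev U f z = H.pull U f ⟨z, hU z⟩ := fun z => H.ev_eq f (hU z)
  -- The `ϑ`-component of any pullback is `ε ∂_θ` of the rest and has no `θ`-term. Applied to `q f`,
  -- and expanded by compatibility with the differentials, this gives `∂_s b - ∂_t (ε b) = 0`.
  have hq : (H.ev U (M.space.q U f) (s, t, y)).im.im = 0 := by
    rw [h.ev_im (M.isNQ.q_mem U d f hf) (hU _)]
  have hvw : Adj.im v = w := by
    rw [H.ev_eq _ (hU _), H.pull_q U d f hf] at hq
    have hq' : T1im L.space (𝓡 L.dim) (t, y) (_ - _) = 0 := hq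
    rw [map_sub] at hq'
    refine Eq.trans ?_ ((sub_eq_zero.1 hq').trans ?_)
    · refine congrArg Adj.im (Eq.symm ?_)
      exact wderiv_extend (A := L.space.T1 (𝓡 L.dim)) (K := fun z => (H.ev U f z).re)
        (fun p => congrArg Adj.re (hz p.1).symm) (hU _) hv
    · refine (congrArg₂ (· - ·) (wderiv_extend (W := slice (Opens.comap
        ⟨H.map, H.smooth.continuous⟩ U) s) (K := fun z => (H.ev U f (s, z)).im.re)
        (fun p => congrArg (fun a => a.im.re) (hz (s, p.1)).symm) (hU (s, t, y)) hw) ?_).trans (sub_zero w)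
      refine Eq.trans ?_ (congrFun (L.isNQ.q_zero (slice (slice (Opens.comap
        ⟨H.map, H.smooth.continuous⟩ U) s) t)) ⟨y, hU _⟩)
      refine q_congr rfl (fun x hx _ => ?_) _ _
      exact congrArg Adj.im (h s t x U d f hf (hU _))
  refine ⟨Adj.im v, fun ℓ => hv (ℓ ∘ₗ T1im L.space (𝓡 L.dim) (t, y)), ?_⟩
  rw [hvw]
  refine hw.congr_of_eqOn t.2 fun t' ht' => ?_
  refine Eq.trans ?_ (congrArg Adj.re (h.ev_im (s := s) (t := pt t') (y := y) hf (hU _))).symm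
  simp only [coe_pt ht']

variable {φ : Patch E}

/-- The connection matrix along a homotopy, at `θ = ϑ = 0`. -/
def conn (H : SuperHomotopy M L) (φ : Patch E) (y : L.body) (s t : Icc (0 : ℝ) 1) :
    Matrix E.ι E.ι (L.space.fib y) :=
  Matrix.of fun α β => ((H.ev φ.dom (φ.T α β) (s, t, y)).re.im : L.space.fib y)

theorem IsAt.conn_eq {C : SuperCurve M L} {s : Icc (0 : ℝ) 1} (hC : IsAt H s C)
    (hφ : ∀ p, H.map p ∈ φ.dom) (t : ℝ) : NQ.conn C φ y t = conn H φ y s (pt t) := by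
  ext α β
  have hU := hφ (s, pt t, y)
  have hU' : C.map (pt t, y) ∈ φ.dom := (hC (pt t) y).1 ▸ hU
  have h : C.ev φ.dom (φ.T α β) (pt t, y) = (H.ev φ.dom (φ.T α β) (s, pt t, y)).re :=
    (C.ev_eq _ hU').trans (((hC (pt t) y).2 φ.dom _ _ (φ.T_mem β α) hU hU').symm.trans
      (congrArg Adj.re (H.ev_eq _ hU).symm))
  rw [conn_apply, h]
  rfl

theorem conn_mem (hφ : ∀ p, H.map p ∈ φ.dom) (s t : Icc (0 : ℝ) 1) (α β : E.ι) :
    conn H φ y s t α β ∈ entrySpace E y α β := by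
  have := ((famAt_re_im (φ.T_mem β α) (hφ (s, t, y))).1.slice L.isNQ.restricts).2.mem_homog
  rwa [show E.lev β + 1 - E.lev α - 1 = E.lev β - E.lev α by ring] at this

theorem contDiffOn_conn {B : Type*} [NormedRing B] [NormedAlgebra ℝ B] [NormedAlgebra 𝕜 B]
    [IsScalarTower ℝ 𝕜 B] [FiniteDimensional 𝕜 B] (Λ : Matrix E.ι E.ι (L.space.fib y) →ₗ[𝕜] B)
    (hφ : ∀ p, H.map p ∈ φ.dom) :
    ContDiffOn ℝ ∞ (fun p : ℝ × ℝ => Λ (conn H φ y (pt p.1) (pt p.2))) (Icc 0 1 ×ˢ Icc 0 1) :=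
  contDiffOn_of_functionals Λ fun ℓ α β p hp =>
    (famAt_re_im (φ.T_mem β α) (hφ (pt p.1, pt p.2, y))).1.contDiffWithinAt_im L.isNQ.restricts
      hp.1 hp.2 ℓ

/-- The entrywise equation of motion is transported by `Λ` to the normed algebra, where
`evol_homotopy` applies. Clamping both parameters by `pt` makes `A` continuous and bounded on the
whole plane. -/
theorem IsReparamWith.wilson_eq_zero (h : IsReparamWith H ε) (hε : IsEndFixingField ε)
    (hφ : ∀ p, H.map p ∈ φ.dom) (y : L.body) (s : Icc (0 : ℝ) 1) :
    pathExp 𝕜 (fun t => conn H φ y s (pt t)) 1 0 = pathExp 𝕜 (fun t => conn H φ y 0 (pt t)) 1 0 := by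
  obtain ⟨B, _, _, _, _, _, _, Θ, Λ, -, hΘ⟩ := exists_normedModel 𝕜 (entrySpace E y)
    (one_mem_entrySpace y) (mul_mem_entrySpace y)
  let A : ℝ → ℝ → B := fun s t => Λ (conn H φ y (pt s) (pt t))
  let D : ℝ → ℝ → B := fun s t =>
    fderivWithin ℝ (fun p : ℝ × ℝ => A p.1 p.2) (Icc 0 1 ×ˢ Icc 0 1) (s, t) (1, 0)
  have hAs : ContDiffOn ℝ ∞ (fun p : ℝ × ℝ => A p.1 p.2) (Icc 0 1 ×ˢ Icc 0 1) :=
    contDiffOn_conn Λ hφ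
  have hmem : ∀ r, ((pt r : Icc (0 : ℝ) 1) : ℝ) ∈ Icc (0 : ℝ) 1 := fun r => (pt r).2
  have hApt : ∀ s t, A s t = A (pt s) (pt t) := fun s t => by
    simp only [A, pt_coe]
  have hAc : Continuous fun p : ℝ × ℝ => A p.1 p.2 := by
    have hc : Continuous fun p : ℝ × ℝ => (((pt p.1 : ℝ), (pt p.2 : ℝ)) : ℝ × ℝ) :=
      (continuous_subtype_val.comp (continuous_pt.comp continuous_fst)).prodMk
        (continuous_subtype_val.comp (continuous_pt.comp continuous_snd))
    exact (hAs.continuousOn.comp_continuous hc fun p => ⟨hmem _, hmem _⟩).congr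
      fun p => (hApt p.1 p.2).symm
  obtain ⟨K, hK⟩ := (isCompact_Icc.prod isCompact_Icc).exists_bound_of_continuousOn hAs.continuousOn
  have hK' : ∀ s t, ‖A s t‖ ≤ K := fun s t => by
    rw [hApt]
    exact hK (_, _) ⟨hmem s, hmem t⟩
  have hs : ∀ s ∈ Icc (0 : ℝ) 1, ∀ t ∈ Icc (0 : ℝ) 1,
      HasDerivWithinAt (fun s => A s t) (D s t) (Icc 0 1) s := fun s hs t ht =>
    hasDerivWithinAt_left hAs hs ht
  have ht : ∀ s ∈ Icc (0 : ℝ) 1, ∀ t ∈ Icc (0 : ℝ) 1,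
      HasDerivWithinAt (fun t => ε t s • A s t) (D s t) (Icc 0 1) t := by
    intro s hs' t ht'
    choose v hv using fun α β => h.exists_hasWDeriv (φ.T_mem β α) hφ (pt s) (pt t) y
    have h1 : HasDerivWithinAt (fun s => A s t) (Λ (Matrix.of v)) (Icc 0 1) s := by
      refine hasDerivWithinAt_of_functionals Λ fun α β => ?_
      have := (hv α β).1
      rwa [coe_pt hs'] at this
    have h2 : HasDerivWithinAt (fun t => Λ (((ε t s : ℝ) : 𝕜) • conn H φ y (pt s) (pt t)))
        (Λ (Matrix.of v)) (Icc 0 1) t := by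
      refine hasDerivWithinAt_of_functionals Λ fun α β => ?_
      have := (hv α β).2
      rwa [coe_pt hs', coe_pt ht'] at this
    -- `D` was taken as a partial derivative of `A` because that is visibly continuous; uniqueness
    -- identifies it with the weak derivative `v`, which is also the derivative of `ε A` in `t`.
    rw [(uniqueDiffOn_Icc zero_lt_one s hs').eq_deriv _ (hs s hs' t ht') h1]
    simpa only [map_smul, ← RCLike.real_smul_eq_coe_smul] using h2
  have hD : ContinuousOn (fun p : ℝ × ℝ => D p.1 p.2) (Icc 0 1 ×ˢ Icc 0 1) :=
    (contDiffOn_fderivWithin_square hAs (1, 0)).continuousOn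
  have key := evol_homotopy hAc hK' hD hε.smooth.continuousOn hs ht hε.zero hε.one
  have hpe : ∀ s : ℝ, pathExp 𝕜 (fun t => conn H φ y (pt s) (pt t)) 1 0 = Θ (evol (A s) 0 1) := fun s =>
    pathExp_eq Θ (hAc.comp (by fun_prop : Continuous fun t : ℝ => (s, t))) (hK' s) zero_le_one
      fun t _ => (hΘ _ fun α β => conn_mem hφ _ _ α β).symm
  have h1 := hpe s
  have h0 := hpe 0
  rw [pt_coe, key s s.2] at h1
  rw [pt_zero, ← h1] at h0
  exact h0.symm

theorem IsReparamWith.wilson_eq (h : IsReparamWith H ε) (hε : IsEndFixingField ε)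
    (hφ : ∀ p, H.map p ∈ φ.dom) {s s' : Icc (0 : ℝ) 1} {C C' : SuperCurve M L} (hC : IsAt H s C)
    (hC' : IsAt H s' C') (y : L.body) : wilson C' φ y 1 0 = wilson C φ y 1 0 := by
  rw [wilson, wilson, funext (hC.conn_eq hφ), funext (hC'.conn_eq hφ),
    h.wilson_eq_zero hε hφ, ← h.wilson_eq_zero hε hφ y s]

end SuperHomotopy
end NQ
end

/-! ### Spliced Wilson lines and concatenations -/

noncomputable section

namespace NQ

variable {𝕜 : Type*} [RCLike 𝕜] {M L : NQManifold 𝕜} {E : NQRepresentation M}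

theorem le_of_subdivision {t : ℕ → ℝ} {k : ℕ} (h : ∀ i ≤ k, t i ≤ t (i + 1)) {i j : ℕ} (hij : i ≤ j)
    (hj : j ≤ k + 1) : t i ≤ t j := by
  induction j, hij using Nat.le_induction with
  | base => exact le_rfl
  | succ n _ ih => exact (ih (by omega)).trans (h n (by omega))

/-- Nodes are lifted from the last to the first: the intermediate value theorem gives `c` over `t (k
+ 1)`, and the induction continues on `[a,c]`, which keeps the lifted nodes ordered. -/
theorem exists_subdivision {ρ : ℝ → ℝ} {t : ℕ → ℝ} {a : ℝ} (k : ℕ) : ∀ {b : ℝ}, a ≤ b →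
    ContinuousOn ρ (Icc a b) → (∀ i ≤ k, t i ≤ t (i + 1)) → t 0 = ρ a → t (k + 1) = ρ b →
    ∃ t' : ℕ → ℝ, t' 0 = a ∧ t' (k + 1) = b ∧ (∀ i ≤ k, t' i ≤ t' (i + 1)) ∧
      ∀ i ≤ k + 1, ρ (t' i) = t i := by
  induction k with
  | zero =>
    intro b hab _ _ h0 h1
    refine ⟨fun i => if i = 0 then a else b, rfl, rfl, fun i hi => ?_, fun i hi => ?_⟩
    · obtain rfl : i = 0 := by omega
      exact hab
    · obtain rfl | rfl : i = 0 ∨ i = 1 := by omega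
      exacts [h0.symm, h1.symm]
  | succ k ih =>
    intro b hab hρ hm h0 h1
    have hlo : t 0 ≤ t (k + 1) := le_of_subdivision hm (by omega) (by omega)
    have hhi : t (k + 1) ≤ t (k + 1 + 1) := hm _ le_rfl
    obtain ⟨c, hc, hct⟩ := intermediate_value_Icc hab hρ ⟨h0 ▸ hlo, h1 ▸ hhi⟩
    obtain ⟨t', h0', h1', hm', ht'⟩ := ih hc.1 (hρ.mono (Icc_subset_Icc_right hc.2))
      (fun i hi => hm i (by omega)) h0 hct.symm
    have hold : ∀ i ≤ k + 1, Function.update t' (k + 1 + 1) b i = t' i := fun i hi =>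
      Function.update_of_ne (by omega) _ _
    have hnew : Function.update t' (k + 1 + 1) b (k + 1 + 1) = b := Function.update_self _ _ _
    refine ⟨Function.update t' (k + 1 + 1) b, ?_, hnew, fun i hi => ?_, fun i hi => ?_⟩
    · rw [hold 0 (by omega), h0']
    · rcases Nat.lt_or_ge k i with h | h
      · obtain rfl : i = k + 1 := by omega
        rw [hold _ le_rfl, hnew, h1']
        exact hc.2
      · rw [hold i (by omega), hold (i + 1) (by omega)]
        exact hm' i h
    · rcases Nat.lt_or_ge (k + 1) i with h | h
      · obtain rfl : i = k + 1 + 1 := by omega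
        rw [hnew, h1]
      · rw [hold i h, ht' i h]

theorem Fits.mem_Icc {C : SuperCurve M L} {φ : ℕ → Patch E} {k : ℕ} {t : ℕ → ℝ} (h : Fits C φ k t)
    {i : ℕ} (hi : i ≤ k + 1) : t i ∈ Icc (0 : ℝ) 1 :=
  ⟨h.zero ▸ le_of_subdivision h.mono (Nat.zero_le i) hi, h.one ▸ le_of_subdivision h.mono hi le_rfl⟩

/-! ### Factorization and reparametrization of spliced products -/

section Splice

variable {C C' : SuperCurve M L} {φ φ' : ℕ → Patch E} {y : L.body} {t t' : ℕ → ℝ} {k : ℕ}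

theorem spliced_congr (h : ∀ i ≤ k, φ i = φ' i) : spliced C φ t y k = spliced C φ' t y k := by
  induction k with
  | zero => rw [spliced, spliced, h 0 le_rfl]
  | succ k ih =>
    rw [spliced, spliced, h (k + 1) le_rfl, h k (by omega), ih fun i hi => h i (by omega)]

theorem spliced_add (n : ℕ) : spliced C φ t y (n + k + 1) =
    spliced C (fun i => φ (n + 1 + i)) (fun i => t (n + 1 + i)) y k *
      transitionAt C (φ (n + 1)) (φ n) y (t (n + 1)) * spliced C φ t y n := by
  induction k with
  | zero => rfl
  | succ k ih =>
    have h : spliced C φ t y (n + (k + 1) + 1) = wilson C (φ (n + k + 1 + 1)) y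
        (t (n + k + 1 + 2)) (t (n + k + 1 + 1)) *
          transitionAt C (φ (n + k + 1 + 1)) (φ (n + k + 1)) y (t (n + k + 1 + 1)) *
            spliced C φ t y (n + k + 1) := rfl
    rw [h, ih, spliced, show n + 1 + (k + 1) = n + k + 1 + 1 by omega,
      show n + 1 + (k + 2) = n + k + 1 + 2 by omega, show n + 1 + k = n + k + 1 by omega]
    simp only [mul_assoc]

theorem spliced_reparam {ρ : ℝ → ℝ} {a b : ℝ} (h : IsReparamOn C' C ρ a b)
    (hρ : ContDiffOn ℝ ∞ ρ (Icc a b)) (hm : MonotoneOn ρ (Icc a b)) (ha : 0 ≤ a) (hb : b ≤ 1)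
    (ht' : ∀ i ≤ k + 1, t' i ∈ Icc a b) (hmono : ∀ i ≤ k, t' i ≤ t' (i + 1))
    (ht : ∀ i ≤ k + 1, t i ∈ Icc (0 : ℝ) 1) (hρt : ∀ i ≤ k + 1, ρ (t' i) = t i)
    (hl : ∀ i ≤ k, LiesIn C (φ i) (t i) (t (i + 1))) :
    spliced C' φ t' y k = spliced C φ t y k := by
  have hw : ∀ i ≤ k, wilson C' (φ i) y (t' (i + 1)) (t' i) = wilson C (φ i) y (t (i + 1)) (t i) := by
    intro i hi
    have e := hρt i (by omega)
    have e' := hρt (i + 1) (by omega)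
    have := wilson_reparam (y := y) h hρ hm ha (ht' i (by omega)).1 (hmono i hi)
      (ht' (i + 1) (by omega)).2 hb (by rw [e]; exact (ht i (by omega)).1)
      (by rw [e']; exact (ht (i + 1) (by omega)).2) (φ := φ i) (by rw [e, e']; exact hl i hi)
    rwa [e, e'] at this
  have key : ∀ j ≤ k, spliced C' φ t' y j = spliced C φ t y j := by
    intro j
    induction j with
    | zero => exact hw 0
    | succ j ih =>
      intro hj
      rw [spliced, spliced, hw (j + 1) hj, ih (by omega),
        h.transitionAt_eq (ht' (j + 1) (by omega)), hρt (j + 1) (by omega)]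
  exact key k le_rfl

end Splice

section Reparam

variable {C C' : SuperCurve M L} {φ : ℕ → Patch E} {ρ : ℝ → ℝ} {t : ℕ → ℝ} {k : ℕ}

theorem IsReparamOn.wilson_eq {a b : ℝ} {φ : Patch E} (h : IsReparamOn C' C ρ 0 1) (ha : 0 ≤ a)
    (hb : b ≤ 1) (hρ : IsParam ρ 0 1 a b) (hl : LiesIn C φ a b) (y : L.body) :
    wilson C' φ y 1 0 = wilson C φ y b a := by
  have := wilson_reparam (y := y) (φ := φ) h hρ.smooth hρ.mono le_rfl le_rfl zero_le_one le_rfl le_rfl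
    (by rwa [hρ.left]) (by rwa [hρ.right]) (by rwa [hρ.left, hρ.right])
  rwa [hρ.left, hρ.right] at this

theorem Fits.exists_reparam {a b : ℝ} (hab : a ≤ b) (hρ : IsParam ρ a b 0 1)
    (h : IsReparamOn C' C ρ a b) (hf : Fits C φ k t) :
    ∃ t' : ℕ → ℝ, t' 0 = a ∧ t' (k + 1) = b ∧ (∀ i ≤ k, t' i ≤ t' (i + 1)) ∧
      (∀ i ≤ k + 1, ρ (t' i) = t i) ∧ ∀ i ≤ k, LiesIn C' (φ i) (t' i) (t' (i + 1)) := by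
  obtain ⟨t', h0, h1, hm, ht⟩ := exists_subdivision k hab hρ.smooth.continuousOn hf.mono
    (hf.zero.trans hρ.left.symm) (hf.one.trans hρ.right.symm)
  refine ⟨t', h0, h1, hm, ht, fun i hi => h.liesIn hρ.mono ?_ ?_ ?_⟩
  · exact h0 ▸ le_of_subdivision hm (Nat.zero_le i) (by omega)
  · exact h1 ▸ le_of_subdivision hm (by omega : i + 1 ≤ k + 1) le_rfl
  · rw [ht i (by omega), ht (i + 1) (by omega)]
    exact hf.liesIn i hi

theorem Fits.exists_reparam_unit (hρ : IsParam ρ 0 1 0 1) (h : IsReparamOn C' C ρ 0 1)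
    (hf : Fits C φ k t) : ∃ t' : ℕ → ℝ, Fits C' φ k t' ∧ ∀ i ≤ k + 1, ρ (t' i) = t i := by
  obtain ⟨t', h0, h1, hm, ht, hl⟩ := hf.exists_reparam zero_le_one hρ h
  exact ⟨t', ⟨h0, h1, hm, hl⟩, ht⟩

theorem Fits.spliced_reparam {t' : ℕ → ℝ} (hρ : IsParam ρ 0 1 0 1) (h : IsReparamOn C' C ρ 0 1)
    (hf : Fits C φ k t) (hf' : Fits C' φ k t') (ht : ∀ i ≤ k + 1, ρ (t' i) = t i) (y : L.body) :
    spliced C' φ t' y k = spliced C φ t y k :=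
  NQ.spliced_reparam h hρ.smooth hρ.mono le_rfl le_rfl (fun _ hi => hf'.mem_Icc hi) hf'.mono
    (fun _ hi => hf.mem_Icc hi) ht hf.liesIn

/-- `ρ` is onto `[0,1]` by the intermediate value theorem, so every point of `C` is visited by `C'`.
-/
theorem LiesIn.of_isReparamOn {φ : Patch E} {a b : ℝ} (hl : LiesIn C' φ a b) (hab : a ≤ b)
    (hρ : IsParam ρ a b 0 1) (h : IsReparamOn C' C ρ a b) : LiesIn C φ 0 1 := by
  intro τ hτ y
  obtain ⟨t, ht, rfl⟩ := intermediate_value_Icc hab hρ.smooth.continuousOn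
    (by rwa [hρ.left, hρ.right] : τ ∈ Icc (ρ a) (ρ b))
  rw [← (h t ht y).1]
  exact hl t ht y

end Reparam

section Concat

variable {C C₁ C₂ : SuperCurve M L} {c : ℝ} {ρ₁ ρ₂ : ℝ → ℝ}

theorem followedBy_of_le {φ₁ φ₂ : ℕ → Patch E} {k i : ℕ} (h : i ≤ k) :
    followedBy φ₁ k φ₂ i = φ₁ i := if_pos h

theorem followedBy_add (φ₁ φ₂ : ℕ → Patch E) (k i : ℕ) : followedBy φ₁ k φ₂ (k + 1 + i) = φ₂ i := by
  rw [followedBy, if_neg (by omega), Nat.add_sub_cancel_left]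

theorem IsConcat.wilson_mul (h : IsConcat C C₂ C₁ c ρ₁ ρ₂) {φ : Patch E} (hl : LiesIn C φ 0 1)
    (y : L.body) : wilson C₂ φ y 1 0 * wilson C₁ φ y 1 0 = wilson C φ y 1 0 := by
  have hc0 := h.pos.le
  have hc1 := h.lt_one.le
  have hl₁ : LiesIn C₁ φ 0 1 := LiesIn.of_isReparamOn
    (fun t ht y => hl t ⟨ht.1, ht.2.trans hc1⟩ y) hc0 h.param₁ h.first
  have hl₂ : LiesIn C₂ φ 0 1 := LiesIn.of_isReparamOn
    (fun t ht y => hl t ⟨hc0.trans ht.1, ht.2⟩ y) hc1 h.param₂ h.second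
  have e₁ := wilson_reparam (y := y) (φ := φ) h.first h.param₁.smooth h.param₁.mono le_rfl le_rfl hc0
    le_rfl hc1 h.param₁.left.ge h.param₁.right.le (by rwa [h.param₁.left, h.param₁.right])
  have e₂ := wilson_reparam (y := y) (φ := φ) h.second h.param₂.smooth h.param₂.mono hc0 le_rfl hc1
    le_rfl le_rfl h.param₂.left.ge h.param₂.right.le (by rwa [h.param₂.left, h.param₂.right])
  rw [h.param₁.left, h.param₁.right] at e₁
  rw [h.param₂.left, h.param₂.right] at e₂
  rw [NQ.wilson_mul le_rfl hc0 hc1 le_rfl hl, e₁, e₂]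

variable {φ₁ φ₂ : ℕ → Patch E} {k₁ k₂ : ℕ} {t₁ t₂ : ℕ → ℝ}

theorem IsConcat.exists_fits (h : IsConcat C C₂ C₁ c ρ₁ ρ₂) (hf₁ : Fits C₁ φ₁ k₁ t₁)
    (hf₂ : Fits C₂ φ₂ k₂ t₂) :
    ∃ t : ℕ → ℝ, Fits C (followedBy φ₁ k₁ φ₂) (k₁ + k₂ + 1) t ∧ t (k₁ + 1) = c ∧
      (∀ i ≤ k₁ + 1, ρ₁ (t i) = t₁ i) ∧ ∀ i ≤ k₂ + 1, ρ₂ (t (k₁ + 1 + i)) = t₂ i := by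
  obtain ⟨s₁, h10, h11, hm₁, hs₁, hl₁⟩ := hf₁.exists_reparam h.pos.le h.param₁ h.first
  obtain ⟨s₂, h20, h21, hm₂, hs₂, hl₂⟩ := hf₂.exists_reparam h.lt_one.le h.param₂ h.second
  let t : ℕ → ℝ := fun i => if i ≤ k₁ then s₁ i else s₂ (i - (k₁ + 1))
  have ht₂ : ∀ i, t (k₁ + 1 + i) = s₂ i := fun i => by
    simp only [t]
    rw [if_neg (by omega), Nat.add_sub_cancel_left]
  -- The node `k₁ + 1` belongs to both subdivisions; it is defined as `s₂ 0`, which equals `s₁ (k₁ +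
  -- 1)`, both being `c`.
  have ht₁ : ∀ i ≤ k₁ + 1, t i = s₁ i := fun i hi => by
    rcases Nat.lt_or_ge k₁ i with hk | hk
    · obtain rfl : i = k₁ + 1 := by omega
      rw [h11, ← h20]
      exact ht₂ 0
    · exact if_pos hk
  have hcases : ∀ i ≤ k₁ + k₂ + 1, i ≤ k₁ ∨ ∃ j ≤ k₂, i = k₁ + 1 + j := fun i hi =>
    (Nat.lt_or_ge k₁ i).symm.imp id fun hk => ⟨i - (k₁ + 1), by omega, by omega⟩
  refine ⟨t, ⟨?_, ?_, fun i hi => ?_, fun i hi => ?_⟩, ?_, fun i hi => ?_, fun i hi => ?_⟩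
  · rw [ht₁ 0 (by omega), h10]
  · rw [show k₁ + k₂ + 1 + 1 = k₁ + 1 + (k₂ + 1) by omega, ht₂, h21]
  · rcases hcases i hi with hk | ⟨j, hj, rfl⟩
    · rw [ht₁ i (by omega), ht₁ (i + 1) (by omega)]
      exact hm₁ i hk
    · rw [ht₂, add_assoc (k₁ + 1), ht₂]
      exact hm₂ j hj
  · rcases hcases i hi with hk | ⟨j, hj, rfl⟩
    · rw [followedBy_of_le hk, ht₁ i (by omega), ht₁ (i + 1) (by omega)]
      exact hl₁ i hk
    · rw [followedBy_add, ht₂, add_assoc (k₁ + 1), ht₂]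
      exact hl₂ j hj
  · rw [ht₁ _ le_rfl, h11]
  · rw [ht₁ i hi, hs₁ i hi]
  · rw [ht₂, hs₂ i hi]

/-- The product is cut at the node `k₁ + 1`, which is `c`. Its two outer factors are
reparametrizations of the given spliced lines, and `ρ₁ c = 1` places the middle transition at the
end of `C₁`. -/
theorem IsConcat.spliced_mul (h : IsConcat C C₂ C₁ c ρ₁ ρ₂) (hf₁ : Fits C₁ φ₁ k₁ t₁)
    (hf₂ : Fits C₂ φ₂ k₂ t₂) {t : ℕ → ℝ} (hf : Fits C (followedBy φ₁ k₁ φ₂) (k₁ + k₂ + 1) t)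
    (hc : t (k₁ + 1) = c) (ht₁ : ∀ i ≤ k₁ + 1, ρ₁ (t i) = t₁ i)
    (ht₂ : ∀ i ≤ k₂ + 1, ρ₂ (t (k₁ + 1 + i)) = t₂ i) (y : L.body) :
    spliced C₂ φ₂ t₂ y k₂ * transitionAt C₁ (φ₂ 0) (φ₁ k₁) y 1 * spliced C₁ φ₁ t₁ y k₁ =
      spliced C (followedBy φ₁ k₁ φ₂) t y (k₁ + k₂ + 1) := by
  have hlo : ∀ i ≤ k₁ + 1, t i ∈ Icc 0 c := fun i hi =>
    ⟨(hf.mem_Icc (by omega)).1, hc ▸ le_of_subdivision hf.mono hi (by omega)⟩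
  have hhi : ∀ i ≤ k₂ + 1, t (k₁ + 1 + i) ∈ Icc c 1 := fun i hi =>
    ⟨hc ▸ le_of_subdivision hf.mono (Nat.le_add_right _ i) (by omega), (hf.mem_Icc (by omega)).2⟩
  rw [spliced_add, hc, h.first.transitionAt_eq (right_mem_Icc.2 h.pos.le), h.param₁.right,
    spliced_congr (k := k₁) fun i hi => followedBy_of_le hi,
    spliced_congr (k := k₂) fun i _ => followedBy_add φ₁ φ₂ k₁ i, followedBy_of_le le_rfl,
    spliced_reparam (t' := t) h.first h.param₁.smooth h.param₁.mono le_rfl h.lt_one.le hlo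
      (fun i hi => hf.mono i (by omega)) (fun i hi => hf₁.mem_Icc hi) ht₁ hf₁.liesIn,
    spliced_reparam (t' := fun i => t (k₁ + 1 + i)) h.second h.param₂.smooth h.param₂.mono h.pos.le
      le_rfl hhi (fun i hi => hf.mono (k₁ + 1 + i) (by omega)) (fun i hi => hf₂.mem_Icc hi) ht₂
      hf₂.liesIn]
  exact congrArg (fun ψ => _ * transitionAt C₁ ψ (φ₁ k₁) y 1 * _) (followedBy_add φ₁ φ₂ k₁ 0).symm

end Concat

end NQ

end

theorem mainTheorem5 {𝕜 : Type*} [RCLike 𝕜] (M L : NQManifold 𝕜) (E : NQRepresentation M) :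
    -- the path-ordered exponential defining the Wilson line converges
    (∀ (C : SuperCurve M L) (φ : Patch E) (a b : ℝ), 0 ≤ a → a ≤ b → b ≤ 1 →
      LiesIn C φ a b → ∀ y, PathExpConverges 𝕜 (conn C φ y) b a) ∧
    -- invariance of the Wilson line under reparametrization of `[0,1]`
    (∀ (C : SuperCurve M L) (ρ : ℝ → ℝ), IsParam ρ 0 1 0 1 →
      (∃ C' : SuperCurve M L, IsReparamOn C' C ρ 0 1) ∧
      ∀ C' : SuperCurve M L, IsReparamOn C' C ρ 0 1 →
        ∀ φ : Patch E, LiesIn C φ 0 1 →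
          ∀ y, wilson C' φ y 1 0 = wilson C φ y 1 0) ∧
    -- reparametrizations are homotopies with `x̄ = ε ∂_θ x`:
    -- every diffeomorphism of `[0,1]` fixing the ends is reached by a family generated by some `ε`,
    (∀ ψ : ℝ → ℝ, IsParam ψ 0 1 0 1 → (∀ t ∈ Icc (0 : ℝ) 1, 0 < derivWithin ψ (Icc 0 1) t) →
      ∃ ε Ψ : ℝ → ℝ → ℝ, Generates ε Ψ ∧ ∀ t ∈ Icc (0 : ℝ) 1, Ψ t 1 = ψ t) ∧
    -- such a family of reparametrizations of a super-curve is a homotopy with `x̄ = ε ∂_θ x`,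
    (∀ (C : SuperCurve M L) (ε Ψ : ℝ → ℝ → ℝ), Generates ε Ψ →
      ∃ H : SuperHomotopy M L, SuperHomotopy.IsReparamWith H ε ∧
        ∀ s : Icc (0 : ℝ) 1, ∃ C' : SuperCurve M L, SuperHomotopy.IsAt H s C' ∧
          IsReparamOn C' C (fun t => Ψ t s) 0 1) ∧
    -- and the Wilson line is constant along every homotopy with `x̄ = ε ∂_θ x`
    (∀ (H : SuperHomotopy M L) (ε : ℝ → ℝ → ℝ), IsEndFixingField ε → SuperHomotopy.IsReparamWith H ε →
      (∀ s : Icc (0 : ℝ) 1, ∃ C : SuperCurve M L, SuperHomotopy.IsAt H s C) ∧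
      ∀ (s s' : Icc (0 : ℝ) 1) (C C' : SuperCurve M L), SuperHomotopy.IsAt H s C →
        SuperHomotopy.IsAt H s' C' → ∀ φ : Patch E, (∀ p, H.map p ∈ φ.dom) →
          ∀ y, wilson C' φ y 1 0 = wilson C φ y 1 0) ∧
    -- cutting and reconnecting inside a patch; the pieces may be reparametrized to `[0,1]`
    (∀ (C : SuperCurve M L) (φ : Patch E) (a b c : ℝ), 0 ≤ a → a ≤ b → b ≤ c → c ≤ 1 →
      LiesIn C φ a c → ∀ y, wilson C φ y c a = wilson C φ y c b * wilson C φ y b a) ∧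
    (∀ (C : SuperCurve M L) (ρ : ℝ → ℝ) (a b : ℝ), 0 ≤ a → a ≤ b → b ≤ 1 → IsParam ρ 0 1 a b →
      (∃ C' : SuperCurve M L, IsReparamOn C' C ρ 0 1) ∧
      ∀ C' : SuperCurve M L, IsReparamOn C' C ρ 0 1 →
        ∀ φ : Patch E, LiesIn C φ a b →
          ∀ y, wilson C' φ y 1 0 = wilson C φ y b a) ∧
    (∀ (C : SuperCurve M L) (φ : Patch E) (t : ℝ) (y : L.body), C.map (pt t, y) ∈ φ.dom →
      transitionAt C φ φ y t = 1) ∧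
    -- invariance of Wilson lines spliced across patches
    (∀ (C C' : SuperCurve M L) (ρ : ℝ → ℝ), IsParam ρ 0 1 0 1 → IsReparamOn C' C ρ 0 1 →
      ∀ (φ : ℕ → Patch E) (k : ℕ) (t : ℕ → ℝ), Fits C φ k t →
        (∃ t' : ℕ → ℝ, Fits C' φ k t' ∧ ∀ i ≤ k + 1, ρ (t' i) = t i) ∧
        ∀ t' : ℕ → ℝ, Fits C' φ k t' → (∀ i ≤ k + 1, ρ (t' i) = t i) →
          ∀ y, spliced C' φ t' y k = spliced C φ t y k) ∧
    -- super-curves that meet can be concatenated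
    (∀ C₁ C₂ : SuperCurve M L, Meets C₁ C₂ →
      ∃ (C : SuperCurve M L) (c : ℝ) (ρ₁ ρ₂ : ℝ → ℝ), IsConcat C C₂ C₁ c ρ₁ ρ₂) ∧
    -- composition, in a patch and across patches
    (∀ (C C₁ C₂ : SuperCurve M L) (c : ℝ) (ρ₁ ρ₂ : ℝ → ℝ), IsConcat C C₂ C₁ c ρ₁ ρ₂ →
      (∀ φ : Patch E, LiesIn C φ 0 1 →
        ∀ y, wilson C₂ φ y 1 0 * wilson C₁ φ y 1 0 = wilson C φ y 1 0) ∧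
      ∀ (φ₁ φ₂ : ℕ → Patch E) (k₁ k₂ : ℕ) (t₁ t₂ : ℕ → ℝ),
        Fits C₁ φ₁ k₁ t₁ → Fits C₂ φ₂ k₂ t₂ →
        (∃ t : ℕ → ℝ, Fits C (followedBy φ₁ k₁ φ₂) (k₁ + k₂ + 1) t ∧ t (k₁ + 1) = c ∧
          (∀ i ≤ k₁ + 1, ρ₁ (t i) = t₁ i) ∧ ∀ i ≤ k₂ + 1, ρ₂ (t (k₁ + 1 + i)) = t₂ i) ∧
        ∀ t : ℕ → ℝ, Fits C (followedBy φ₁ k₁ φ₂) (k₁ + k₂ + 1) t → t (k₁ + 1) = c →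
          (∀ i ≤ k₁ + 1, ρ₁ (t i) = t₁ i) → (∀ i ≤ k₂ + 1, ρ₂ (t (k₁ + 1 + i)) = t₂ i) →
          ∀ y, spliced C₂ φ₂ t₂ y k₂ * transitionAt C₁ (φ₂ 0) (φ₁ k₁) y 1 *
              spliced C₁ φ₁ t₁ y k₁ =
            spliced C (followedBy φ₁ k₁ φ₂) t y (k₁ + k₂ + 1)) := by
  refine ⟨fun C φ a b ha hab hb h y => wilson_converges ha hab hb h,
    fun C ρ hρ => ⟨exists_isReparamOn C hρ.smooth (hρ.mapsTo zero_le_one),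
      fun C' h φ hl y => h.wilson_eq le_rfl le_rfl hρ hl y⟩,
    fun ψ hψ hpos => exists_generates hψ hpos, fun C ε Ψ h => exists_homotopy C h,
    fun H ε hε h => ⟨exists_isAt H, fun s s' C C' hC hC' φ hφ y => h.wilson_eq hε hφ hC hC' y⟩,
    fun C φ a b c ha hab hbc hc h y => wilson_mul ha hab hbc hc h,
    fun C ρ a b ha hab hb hρ => ⟨exists_isReparamOn C hρ.smooth
      ((hρ.mapsTo zero_le_one).mono_right (Icc_subset_Icc ha hb)),
      fun C' h φ hl y => h.wilson_eq ha hb hρ hl y⟩,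
    fun C φ t y h => transitionAt_self h,
    fun C C' ρ hρ h φ k t hf => ⟨hf.exists_reparam_unit hρ h,
      fun t' hf' ht y => hf.spliced_reparam hρ h hf' ht y⟩,
    exists_isConcat,
    fun C C₁ C₂ c ρ₁ ρ₂ h => ⟨fun φ hl y => h.wilson_mul hl y,
      fun φ₁ φ₂ k₁ k₂ t₁ t₂ hf₁ hf₂ => ⟨h.exists_fits hf₁ hf₂,
        fun t hf hc ht₁ ht₂ y => h.spliced_mul hf₁ hf₂ hf hc ht₁ ht₂ y⟩⟩⟩
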